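/- Let $M$ be a (Hausdorff, second countable, finite-dimensional) smooth manifold, $m\ge 0$, and let $\omega\in\Omega^{m+1}(M)$ be closed, so that $(M,\omega)$ is a pre-$m$-symplectic manifold. **Conventions.** $\mathfrak X^k(M)=\Gamma(\Lambda^kTM)=\Lambda^k_{C^\infty(M)}\mathfrak X(M)$ are the multivector fields of degree $k$ (with $\mathfrak X^k(M)=0$ and $\Omega^k(M)=0$ for $k<0$). Contraction of forms is given by $\iota_X\alpha=\alpha(X,\cdot)$ for a vector field $X$, $\iota_f\alpha=f\alpha$ for a function $f$ and $\iota_{x\wedge y}=\iota_x\circ\iota_y$, and $\mathcal L_x=d\,\iota_x-(-1)^{|x|}\iota_x\,d$. Let $\nu(x,y)=(-1)^{|x|-1}[x,y]$, where $[\cdot,\cdot]$ is the Schouten bracket, given on products of vector fields by $[X_1\wedge\dots\wedge X_r,Y_1\wedge\dots\wedge Y_s]=\sum_{i,j}(-1)^{i+j}[X_i,Y_j]\wedge X_1\wedge\dots\widehat{X_i}\dots\wedge X_r\wedge Y_1\wedge\dots\widehat{Y_j}\dots\wedge Y_s$, with $\nu(X,f)=\nu(f,X)=X(f)$ for a function $f$;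 $\nu$ is graded symmetric of degree $-1$. Put $\nu_1=0$ and, for $r\ge2$ and homogeneous $x_1,\dots,x_r$, $$\nu_r(x_1,\dots,x_r)=\sum_{\sigma}\epsilon(\sigma)\,\nu(x_{\sigma(1)},x_{\sigma(2)})\wedge x_{\sigma(3)}\wedge\dots\wedge x_{\sigma(r)},$$ where $\sigma$ runs over the $(2,r-2)$-unshuffles and $\epsilon(\sigma)$ is the Koszul sign. An $L_\infty$-algebra is a graded vector space $L$ concentrated in positive degrees with graded symmetric multilinear brackets $l_r$ ($r\ge1$) of degree $-1$ such that for all $r\ge1$ and all homogeneous $x_1,\dots,x_r$ $$\sum_{i=1}^{r}\ \sum_{\sigma}\epsilon(\sigma)\,l_{r-i+1}\big(l_i(x_{\sigma(1)},\dots,x_{\sigma(i)}),x_{\sigma(i+1)},\dots,x_{\sigma(r)}\big)=0,$$ $\sigma$ running over the $(i,r-i)$-unshuffles. An $L_\infty$-subalgebra is a graded subspace closed under all the brackets; with their restrictions it is an $L_\infty$-algebra. The multisymplectic and the Hamiltonian multivector fields of degree $k$ are $$\mathfrak X^k_{\rm sym}(M)=\{x\in\mathfrak X^k(M):\mathcal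 L_x\omega=0\},\qquad \mathfrak X^k_{\rm ham}(M)=\{x\in\mathfrak X^k(M):\iota_x\omega=d\alpha\text{ for some }\alpha\in\Omega^{m-k}(M)\}.$$ Let $\mathcal V$ be $\mathfrak X^\bullet_{\rm sym}(M)$ or $\mathfrak X^\bullet_{\rm ham}(M)$, and let $\mathcal V^{>0}$ be its part of positive degree. **1.** Let $\mathcal W$ be $\mathcal V$ or $\mathcal V^{>0}$. Then $\mathcal W$ is closed under $\nu$, and on the free graded commutative algebra $S\mathcal W$ there is a unique linear map $\hat\nu_2$ such that for homogeneous $x_1,\dots,x_r\in\mathcal W$ $$\hat\nu_2(x_1\cdots x_r)=\sum_\sigma\epsilon(\sigma)\,\nu(x_{\sigma(1)},x_{\sigma(2)})\cdot x_{\sigma(3)}\cdots x_{\sigma(r)},$$ $\sigma$ running over the $(2,r-2)$-unshuffles (the right side being $0$ for $r\le1$). Let $C^k=(S\mathcal W)_{m+1-k}$ be the part of total degree $m+1-k$, for $k\in\mathbb Z$. Then $(C^\bullet,\hat\nu_2)$ and $(\Omega^\bullet(M),d)$ are cochain complexes, and the linear map $$\widetilde\omega\colon C^\bullet\to\Omega^\bullet(M),\qquad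 \widetilde\omega(x_1\cdots x_r)=\iota_{x_1\wedge\dots\wedge x_r}\,\omega,$$ is a cochain map. The truncations of the two complexes to the degrees $0,\dots,m$ (the spaces and the differentials between them in these degrees, $0$ otherwise) are cochain complexes too, and $\widetilde\omega$ restricts to a cochain map between them. **2.** For all $r\ge1$, $\mathcal V$ is closed under $\nu_r$. The multivector fields of positive degree with the brackets $\{\nu_r\}_{r\ge1}$ form an $L_\infty$-algebra, and $\mathcal V^{>0}$ is an $L_\infty$-subalgebra of it. -/

import Mathlib

open scoped Manifold ContDiff

set_option linter.unusedSectionVars false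

namespace Multisymplectic

open VectorField

/-- The ring `C^∞(M)` of smooth real functions. -/
abbrev SmoothFn (n : ℕ) (M : Type*) [TopologicalSpace M]
    [ChartedSpace (EuclideanSpace ℝ (Fin n)) M] : Type _ :=
  ContMDiffMap (𝓡 n) 𝓘(ℝ, ℝ) M ℝ ∞

/-- The space `𝔛(M)` of smooth vector fields. -/
abbrev VecField (n : ℕ) (M : Type*) [TopologicalSpace M]
    [ChartedSpace (EuclideanSpace ℝ (Fin n)) M] [IsManifold (𝓡 n) ∞ M] : Type _ :=
  ContMDiffSection (𝓡 n) (EuclideanSpace ℝ (Fin n)) ∞ (TangentSpace (𝓡 n) (M := M))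

section Fields

variable {n : ℕ} {M : Type*} [TopologicalSpace M] [ChartedSpace (EuclideanSpace ℝ (Fin n)) M]
  [IsManifold (𝓡 n) ∞ M]

namespace VecField

/-- The pointwise product of a function and a vector field. -/
noncomputable instance : SMul (SmoothFn n M) (VecField n M) :=
  ⟨fun f X ↦ ⟨fun x ↦ f x • X x, f.contMDiff.smul_section X.contMDiff⟩⟩

theorem smul_apply (f : SmoothFn n M) (X : VecField n M) (x : M) : (f • X) x = f x • X x := rfl

noncomputable instance : Module (SmoothFn n M) (VecField n M) where
  one_smul X := by ext x; simp [smul_apply]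
  mul_smul f g X := by ext x; simp [smul_apply, mul_smul]
  smul_zero f := by ext x; simp [smul_apply]
  smul_add f X Y := by ext x; simp [smul_apply]
  add_smul f g X := by ext x; simp [smul_apply, add_smul]
  zero_smul X := by ext x; simp [smul_apply]

instance : IsScalarTower ℝ (SmoothFn n M) (VecField n M) where
  smul_assoc c f X := by ext x; simp [smul_apply, mul_smul]

theorem mdiffAt (X : VecField n M) (x : M) :
    MDifferentiableAt (𝓡 n) (𝓡 n).tangent (T% fun y ↦ X y) x := X.mdifferentiableAt

theorem mdiffAt' (f : SmoothFn n M) (x : M) : MDifferentiableAt (𝓡 n) 𝓘(ℝ, ℝ) f x :=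
  f.contMDiff.mdifferentiableAt (by simp)

/-- The derivative `X(f)` of a function along a vector field. -/
noncomputable def lieDerivFn (X : VecField n M) (f : SmoothFn n M) : SmoothFn n M :=
  ⟨fun x ↦ mfderiv (𝓡 n) 𝓘(ℝ, ℝ) f x (X x), by
    have h := (f.contMDiff.contMDiff_tangentMap (m := ∞) (by simp)).comp X.contMDiff
    have h2 := (contMDiff_snd_tangentBundle_modelSpace ℝ 𝓘(ℝ, ℝ) (n := ∞)).comp h
    exact h2⟩

/-- The Lie bracket of vector fields. -/
noncomputable instance : Bracket (VecField n M) (VecField n M) :=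
  ⟨fun X Y ↦ ⟨mlieBracket (𝓡 n) (fun x ↦ X x) (fun x ↦ Y x), by
    have : IsManifold (𝓡 n) ((∞ : WithTop ℕ∞) + 1) M := by simpa
    have : IsManifold (𝓡 n) (minSmoothness ℝ 2) M :=
      IsManifold.of_le (n := ∞) (by simp; exact WithTop.coe_le_coe.2 le_top)
    exact ContDiff.mlieBracket_vectorField (m := ⊤) (n := ⊤) X.contMDiff Y.contMDiff (by simp)⟩⟩

theorem lie_apply (X Y : VecField n M) (x : M) :
    ⁅X, Y⁆ x = mlieBracket (𝓡 n) (fun x ↦ X x) (fun x ↦ Y x) x := rfl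

noncomputable instance : LieRing (VecField n M) where
  add_lie X Y Z := by
    ext x
    exact mlieBracket_add_left (X.mdiffAt x) (Y.mdiffAt x)
  lie_add X Y Z := by
    ext x
    exact mlieBracket_add_right (Y.mdiffAt x) (Z.mdiffAt x)
  lie_self X := by
    ext x
    simp [lie_apply]
  leibniz_lie X Y Z := by
    have : IsManifold (𝓡 n) (minSmoothness ℝ 3) M :=
      IsManifold.of_le (n := ∞) (by simp; exact WithTop.coe_le_coe.2 le_top)
    ext x
    exact leibniz_identity_mlieBracket_apply
      (X.contMDiff.contMDiffAt.of_le (by simp; exact WithTop.coe_le_coe.2 le_top))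
      (Y.contMDiff.contMDiffAt.of_le (by simp; exact WithTop.coe_le_coe.2 le_top)) (Z.contMDiff.contMDiffAt.of_le (by simp; exact WithTop.coe_le_coe.2 le_top))

theorem lieDerivFn_apply (X : VecField n M) (f : SmoothFn n M) (x : M) :
    lieDerivFn X f x = mfderiv (𝓡 n) 𝓘(ℝ, ℝ) f x (X x) := rfl

theorem lieDerivFn_smul_left (f : SmoothFn n M) (X : VecField n M) (g : SmoothFn n M) :
    lieDerivFn (f • X) g = f * lieDerivFn X g := by
  ext x
  exact (mfderiv (𝓡 n) 𝓘(ℝ, ℝ) g x).map_smul (f x) (X x)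

theorem lieDerivFn_add_left (X Y : VecField n M) (g : SmoothFn n M) :
    lieDerivFn (X + Y) g = lieDerivFn X g + lieDerivFn Y g := by
  ext x
  exact (mfderiv (𝓡 n) 𝓘(ℝ, ℝ) g x).map_add (X x) (Y x)

theorem lieDerivFn_add (X : VecField n M) (f g : SmoothFn n M) :
    lieDerivFn X (f + g) = lieDerivFn X f + lieDerivFn X g := by
  ext x
  exact DFunLike.congr_fun (mfderiv_add (mdiffAt' f x) (mdiffAt' g x)) (X x)

theorem lieDerivFn_mul (X : VecField n M) (f g : SmoothFn n M) :
    lieDerivFn X (f * g) = f * lieDerivFn X g + lieDerivFn X f * g := by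
  ext x
  have h := DFunLike.congr_fun
    ((mdiffAt' f x).hasMFDerivAt.mul (mdiffAt' g x).hasMFDerivAt).mfderiv (X x)
  refine h.trans ?_
  change f x * _ + g x * _ = f x * _ + _ * g x
  rw [mul_comm (g x)]
  rfl

theorem lie_smul_right (X Y : VecField n M) (f : SmoothFn n M) :
    ⁅X, f • Y⁆ = f • ⁅X, Y⁆ + lieDerivFn X f • Y := by
  ext x
  rw [add_comm]
  exact mlieBracket_smul_right (mdiffAt' f x) (Y.mdiffAt x)

theorem lie_apply_of_zero {X Y : VecField n M} {x : M} (hX : X x = 0) (hY : Y x = 0) :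
    ⁅X, Y⁆ x = 0 := by
  have h : ∀ Z : VecField n M, Z x = 0 →
      mpullbackWithin 𝓘(ℝ, EuclideanSpace ℝ (Fin n)) (𝓡 n) (extChartAt (𝓡 n) x).symm (fun y ↦ Z y)
        (Set.range (𝓡 n)) (extChartAt (𝓡 n) x x) = 0 := by
    intro Z hZ
    rw [mpullbackWithin_apply]
    have : (Z ((extChartAt (𝓡 n) x).symm (extChartAt (𝓡 n) x x)) :
      EuclideanSpace ℝ (Fin n)) = 0 := by
      rw [extChartAt_to_inv]; exact hZ
    exact (congrArg _ this).trans (map_zero _)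
  have h2 : ∀ (V W : EuclideanSpace ℝ (Fin n) → EuclideanSpace ℝ (Fin n))
      (s : Set (EuclideanSpace ℝ (Fin n))) (y : EuclideanSpace ℝ (Fin n)), V y = 0 → W y = 0 →
      lieBracketWithin ℝ V W s y = 0 := by
    intro V W s y hV hW
    simp [lieBracketWithin, hV, hW]
  rw [lie_apply, ← mlieBracketWithin_univ, mlieBracketWithin_apply]
  exact (congrArg _ (h2 _ _ _ _ (h X hX) (h Y hY))).trans (map_zero _)

theorem lieDerivFn_lie (X Y : VecField n M) (f : SmoothFn n M) :
    lieDerivFn ⁅X, Y⁆ f = lieDerivFn X (lieDerivFn Y f) - lieDerivFn Y (lieDerivFn X f) := by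
  have key : ∀ Z : VecField n M, (lieDerivFn ⁅X, Y⁆ f) • Z =
      (lieDerivFn X (lieDerivFn Y f) - lieDerivFn Y (lieDerivFn X f)) • Z := by
    intro Z
    have h := leibniz_lie X Y (f • Z)
    simp only [lie_smul_right, lie_add, sub_smul] at h ⊢
    rw [leibniz_lie X Y Z, smul_add] at h
    rw [← sub_eq_zero] at h ⊢
    rw [← neg_eq_zero, ← h]
    abel
  ext x
  by_cases hX : X x = 0
  · by_cases hY : Y x = 0
    · have h0 : ∀ (Z : VecField n M) (g : SmoothFn n M), Z x = 0 → lieDerivFn Z g x = 0 := by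
        intro Z g hZ
        rw [lieDerivFn_apply, hZ]; exact map_zero _
      rw [h0 _ _ (lie_apply_of_zero hX hY)]
      change (0 : ℝ) = lieDerivFn X _ x - lieDerivFn Y _ x
      rw [h0 _ _ hX, h0 _ _ hY, sub_zero]
    · have h := DFunLike.congr_fun (key Y) x
      exact smul_left_injective ℝ hY h
  · have h := DFunLike.congr_fun (key X) x
    exact smul_left_injective ℝ hX h

/-- Vector fields act on functions by `⁅X, f⁆ = X(f)`. -/
noncomputable instance : LieRingModule (VecField n M) (SmoothFn n M) where
  bracket := lieDerivFn
  add_lie := lieDerivFn_add_left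
  lie_add := lieDerivFn_add
  leibniz_lie X Y f := by
    change lieDerivFn X (lieDerivFn Y f) = lieDerivFn ⁅X, Y⁆ f + lieDerivFn Y (lieDerivFn X f)
    rw [lieDerivFn_lie]; abel

theorem lie_fn_apply (X : VecField n M) (f : SmoothFn n M) (x : M) :
    ⁅X, f⁆ x = mfderiv (𝓡 n) 𝓘(ℝ, ℝ) f x (X x) := rfl

instance : LieRinehartRing (SmoothFn n M) (VecField n M) where
  lie_smul_eq_mul' f g X := lieDerivFn_smul_left f X g
  leibniz_mul_right' X f g := lieDerivFn_mul X f g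
  leibniz_smul_right' X Y f := lie_smul_right X Y f

noncomputable instance : LieAlgebra ℝ (VecField n M) where
  lie_smul c X Y := by
    ext x
    exact mlieBracket_const_smul_right (Y.mdiffAt x)

instance : LieModule ℝ (VecField n M) (SmoothFn n M) where
  smul_lie c X f := by
    ext x
    exact (mfderiv (𝓡 n) 𝓘(ℝ, ℝ) f x).map_smul c (X x)
  lie_smul c X f := by
    ext x
    exact DFunLike.congr_fun (const_smul_mfderiv (mdiffAt' f x) c) (X x)

instance : LieRinehartAlgebra ℝ (SmoothFn n M) (VecField n M) where

end VecField

end Fields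

section Rough

variable {n : ℕ} {M : Type*} [TopologicalSpace M] [ChartedSpace (EuclideanSpace ℝ (Fin n)) M]

/-- Differential `k`-forms without a smoothness condition: a choice of an alternating `k`-linear form
on every tangent space. -/
abbrev RoughForm (n : ℕ) (M : Type*) [TopologicalSpace M]
    [ChartedSpace (EuclideanSpace ℝ (Fin n)) M] (k : ℕ) : Type _ :=
  (x : M) → (TangentSpace (𝓡 n) x) [⋀^Fin k]→L[ℝ] ℝ

namespace RoughForm

/-- The representative of a form in the preferred chart at `x₀`, that is, its pullback by the inverse
of the chart. -/
noncomputable def inChart {k : ℕ} (α : RoughForm n M k) (x₀ : M) :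
    EuclideanSpace ℝ (Fin n) → (EuclideanSpace ℝ (Fin n)) [⋀^Fin k]→L[ℝ] ℝ :=
  fun y ↦ (α ((extChartAt (𝓡 n) x₀).symm y)).compContinuousLinearMap
    (mfderiv 𝓘(ℝ, EuclideanSpace ℝ (Fin n)) (𝓡 n) (extChartAt (𝓡 n) x₀).symm y)

theorem inChart_apply {k : ℕ} (α : RoughForm n M k) (x₀ : M) (y : EuclideanSpace ℝ (Fin n))
    (v : Fin k → EuclideanSpace ℝ (Fin n)) :
    α.inChart x₀ y v = α ((extChartAt (𝓡 n) x₀).symm y) fun i ↦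
      mfderiv 𝓘(ℝ, EuclideanSpace ℝ (Fin n)) (𝓡 n) (extChartAt (𝓡 n) x₀).symm y (v i) := rfl

/-- A form is smooth if its representatives in charts are. -/
def IsSmooth {k : ℕ} (α : RoughForm n M k) : Prop :=
  ∀ x₀ : M, ContDiffOn ℝ ∞ (α.inChart x₀) (extChartAt (𝓡 n) x₀).target

/-- The exterior derivative: at `x`, it is the exterior derivative of the representative in the
preferred chart at `x`, pulled back to `M`. The lemma `extD_inChart` shows that any other chart gives
the same result for a smooth form. -/
noncomputable def extD {k : ℕ} (α : RoughForm n M k) : RoughForm n M (k + 1) := fun x ↦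
  (extDeriv (α.inChart x) (extChartAt (𝓡 n) x x)).compContinuousLinearMap
    (mfderiv (𝓡 n) 𝓘(ℝ, EuclideanSpace ℝ (Fin n)) (extChartAt (𝓡 n) x) x)

theorem extD_apply {k : ℕ} (α : RoughForm n M k) (x : M) (v : Fin (k + 1) → TangentSpace (𝓡 n) x) :
    extD α x v = extDeriv (α.inChart x) (extChartAt (𝓡 n) x x) fun i ↦
      mfderiv (𝓡 n) 𝓘(ℝ, EuclideanSpace ℝ (Fin n)) (extChartAt (𝓡 n) x) x (v i) := rfl

/-- The contraction `α(X, -)` of a form with a vector field. -/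
noncomputable def contract {k : ℕ} (X : (x : M) → TangentSpace (𝓡 n) x)
    (α : RoughForm n M (k + 1)) : RoughForm n M k := fun x ↦
  { (α x).toAlternatingMap.curryLeft (X x) with
    cont := (α x).cont.comp (continuous_const.matrixVecCons continuous_id) }

theorem contract_apply {k : ℕ} (X : (x : M) → TangentSpace (𝓡 n) x)
    (α : RoughForm n M (k + 1)) (x : M) (v : Fin k → TangentSpace (𝓡 n) x) :
    contract X α x v = α x (Matrix.vecCons (X x) v) := rfl

variable [IsManifold (𝓡 n) ∞ M]

theorem mfderiv_symm_comp {x₀ : M} {y : EuclideanSpace ℝ (Fin n)}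
    (hy : y ∈ (extChartAt (𝓡 n) x₀).target) :
    (mfderiv 𝓘(ℝ, EuclideanSpace ℝ (Fin n)) (𝓡 n) (extChartAt (𝓡 n) x₀).symm y).comp
      (mfderiv (𝓡 n) 𝓘(ℝ, EuclideanSpace ℝ (Fin n)) (extChartAt (𝓡 n) x₀)
        ((extChartAt (𝓡 n) x₀).symm y)) = ContinuousLinearMap.id ℝ _ := by
  have := mfderivWithin_extChartAt_symm_comp_mfderiv_extChartAt (I := 𝓡 n) hy
  rwa [ModelWithCorners.range_eq_univ, mfderivWithin_univ] at this

theorem mfderiv_comp_symm {x₀ : M} {y : EuclideanSpace ℝ (Fin n)}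
    (hy : y ∈ (extChartAt (𝓡 n) x₀).target) :
    (mfderiv (𝓡 n) 𝓘(ℝ, EuclideanSpace ℝ (Fin n)) (extChartAt (𝓡 n) x₀)
        ((extChartAt (𝓡 n) x₀).symm y)).comp
      (mfderiv 𝓘(ℝ, EuclideanSpace ℝ (Fin n)) (𝓡 n) (extChartAt (𝓡 n) x₀).symm y) =
      ContinuousLinearMap.id ℝ _ := by
  have := mfderiv_extChartAt_comp_mfderivWithin_extChartAt_symm (I := 𝓡 n) hy
  rwa [ModelWithCorners.range_eq_univ, mfderivWithin_univ] at this

/-- The representative of a vector field in the preferred chart at `x₀`. -/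
noncomputable def vfInChart (X : (x : M) → TangentSpace (𝓡 n) x) (x₀ : M)
    (y : EuclideanSpace ℝ (Fin n)) : EuclideanSpace ℝ (Fin n) :=
  mfderiv (𝓡 n) 𝓘(ℝ, EuclideanSpace ℝ (Fin n)) (extChartAt (𝓡 n) x₀)
    ((extChartAt (𝓡 n) x₀).symm y) (X ((extChartAt (𝓡 n) x₀).symm y))

theorem vfInChart_contDiffOn {X : (x : M) → TangentSpace (𝓡 n) x}
    (hX : ContMDiff (𝓡 n) (𝓡 n).tangent ∞ (T% X)) (x₀ : M) :
    ContDiffOn ℝ ∞ (vfInChart X x₀) (extChartAt (𝓡 n) x₀).target := by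
  rw [← contMDiffOn_iff_contDiffOn]
  have h1 := (contMDiffOn_extChartAt (I := 𝓡 n) (n := ∞) (x := x₀)).contMDiffOn_tangentMapWithin
    (m := ∞) (by simp) (chartAt _ x₀).open_source.uniqueMDiffOn
  have h2 := hX.comp_contMDiffOn (contMDiffOn_extChartAt_symm (I := 𝓡 n) (n := ∞) x₀)
  have h3 := h1.comp h2 (fun y hy => by
    simpa using (extChartAt (𝓡 n) x₀).map_target hy)
  have h4 := (contMDiff_snd_tangentBundle_modelSpace (EuclideanSpace ℝ (Fin n))
    𝓘(ℝ, EuclideanSpace ℝ (Fin n)) (n := ∞)).comp_contMDiffOn h3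
  refine h4.congr fun y hy => ?_
  have hs : (extChartAt (𝓡 n) x₀).symm y ∈ (chartAt (EuclideanSpace ℝ (Fin n)) x₀).source := by
    simpa using (extChartAt (𝓡 n) x₀).map_target hy
  simp only [Function.comp, tangentMapWithin, vfInChart]
  rw [mfderivWithin_of_isOpen (chartAt _ x₀).open_source hs]

theorem contract_inChart {k : ℕ} (X : (x : M) → TangentSpace (𝓡 n) x)
    (α : RoughForm n M (k + 1)) {x₀ : M} {y : EuclideanSpace ℝ (Fin n)}
    (hy : y ∈ (extChartAt (𝓡 n) x₀).target) :
    (contract X α).inChart x₀ y = (α.inChart x₀ y).curryLeft (vfInChart X x₀ y) := by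
  ext v
  rw [inChart_apply, contract_apply, ContinuousAlternatingMap.curryLeft_apply_apply, inChart_apply]
  congr 1
  funext i
  refine Fin.cases ?_ (fun i => ?_) i
  · exact (DFunLike.congr_fun (mfderiv_symm_comp hy) (X _)).symm
  · rfl

theorem IsSmooth.contract {k : ℕ} {X : (x : M) → TangentSpace (𝓡 n) x}
    (hX : ContMDiff (𝓡 n) (𝓡 n).tangent ∞ (T% X)) {α : RoughForm n M (k + 1)}
    (hα : α.IsSmooth) : (α.contract X).IsSmooth := fun x₀ => by
  have h1 : ContDiff ℝ ∞ (fun β : (EuclideanSpace ℝ (Fin n)) [⋀^Fin (k + 1)]→L[ℝ] ℝ ↦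
      β.curryLeft) := IsBoundedLinearMap.contDiff
    ⟨⟨fun _ _ ↦ rfl, fun _ _ ↦ rfl⟩, 1, one_pos, fun β ↦ by simp⟩
  have h : ContDiffOn ℝ ∞ (fun y => (α.inChart x₀ y).curryLeft (vfInChart X x₀ y))
      (extChartAt (𝓡 n) x₀).target :=
    ContDiffOn.clm_apply (f := fun y => (α.inChart x₀ y).curryLeft)
      (h1.comp_contDiffOn (hα x₀)) (vfInChart_contDiffOn hX x₀)
  exact h.congr fun y hy => contract_inChart X α hy

theorem eventually_symm_eq {x₀ x : M} {w : EuclideanSpace ℝ (Fin n)}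
    (hw : w ∈ (extChartAt (𝓡 n) x).target)
    (hw' : (extChartAt (𝓡 n) x).symm w ∈ (extChartAt (𝓡 n) x₀).source) :
    ∀ᶠ u in nhds w, u ∈ (extChartAt (𝓡 n) x).target ∧
      (extChartAt (𝓡 n) x).symm u ∈ (extChartAt (𝓡 n) x₀).source :=
  ((isOpen_extChartAt_target x).eventually_mem hw).and
    (((continuousOn_extChartAt_symm x).continuousAt
      ((isOpen_extChartAt_target x).mem_nhds hw)).eventually
        ((isOpen_extChartAt_source x₀).eventually_mem hw'))

theorem mdiffAt_symm {x : M} {w : EuclideanSpace ℝ (Fin n)}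
    (hw : w ∈ (extChartAt (𝓡 n) x).target) :
    MDifferentiableAt 𝓘(ℝ, EuclideanSpace ℝ (Fin n)) (𝓡 n) (extChartAt (𝓡 n) x).symm w :=
  ((contMDiffOn_extChartAt_symm (I := 𝓡 n) (n := ∞) x).contMDiffAt
    ((isOpen_extChartAt_target x).mem_nhds hw)).mdifferentiableAt (by simp)

theorem contDiffAt_transition {x₀ x : M} {w : EuclideanSpace ℝ (Fin n)}
    (hw : w ∈ (extChartAt (𝓡 n) x).target)
    (hw' : (extChartAt (𝓡 n) x).symm w ∈ (extChartAt (𝓡 n) x₀).source) :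
    ContDiffAt ℝ ∞ (fun u ↦ extChartAt (𝓡 n) x₀ ((extChartAt (𝓡 n) x).symm u)) w := by
  rw [← contMDiffAt_iff_contDiffAt]
  exact (contMDiffAt_extChartAt' (by simpa using hw')).comp w
    ((contMDiffOn_extChartAt_symm (I := 𝓡 n) (n := ∞) x).contMDiffAt
    ((isOpen_extChartAt_target x).mem_nhds hw))

theorem mfderiv_symm_eq {x₀ x : M} {w : EuclideanSpace ℝ (Fin n)}
    (hw : w ∈ (extChartAt (𝓡 n) x).target)
    (hw' : (extChartAt (𝓡 n) x).symm w ∈ (extChartAt (𝓡 n) x₀).source)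
    (v : EuclideanSpace ℝ (Fin n)) :
    (mfderiv 𝓘(ℝ, EuclideanSpace ℝ (Fin n)) (𝓡 n) (extChartAt (𝓡 n) x).symm w v :
      EuclideanSpace ℝ (Fin n)) =
    mfderiv 𝓘(ℝ, EuclideanSpace ℝ (Fin n)) (𝓡 n) (extChartAt (𝓡 n) x₀).symm
      (extChartAt (𝓡 n) x₀ ((extChartAt (𝓡 n) x).symm w))
      (fderiv ℝ (fun u ↦ extChartAt (𝓡 n) x₀ ((extChartAt (𝓡 n) x).symm u)) w v) := by
  have h1 : (extChartAt (𝓡 n) x).symm =ᶠ[nhds w] (extChartAt (𝓡 n) x₀).symm ∘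
      (fun u ↦ extChartAt (𝓡 n) x₀ ((extChartAt (𝓡 n) x).symm u)) := by
    filter_upwards [eventually_symm_eq hw hw'] with u hu
    exact ((extChartAt (𝓡 n) x₀).left_inv hu.2).symm
  rw [h1.mfderiv_eq, mfderiv_comp (I' := 𝓘(ℝ, EuclideanSpace ℝ (Fin n))) w
    (mdiffAt_symm ((extChartAt (𝓡 n) x₀).map_source hw'))
    ((contDiffAt_transition hw hw').differentiableAt (by simp)).mdifferentiableAt, mfderiv_eq_fderiv]
  rfl

theorem apply_congr {k : ℕ} (α : RoughForm n M k) {p q : M} (h : p = q)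
    (v : Fin k → EuclideanSpace ℝ (Fin n)) : α p v = α q v := by subst h; rfl

theorem inChart_eq {k : ℕ} (α : RoughForm n M k) {x₀ x : M} {w : EuclideanSpace ℝ (Fin n)}
    (hw : w ∈ (extChartAt (𝓡 n) x).target)
    (hw' : (extChartAt (𝓡 n) x).symm w ∈ (extChartAt (𝓡 n) x₀).source) :
    α.inChart x w = (α.inChart x₀ (extChartAt (𝓡 n) x₀ ((extChartAt (𝓡 n) x).symm w))
      ).compContinuousLinearMap
      (fderiv ℝ (fun u ↦ extChartAt (𝓡 n) x₀ ((extChartAt (𝓡 n) x).symm u)) w) := by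
  ext v
  rw [ContinuousAlternatingMap.compContinuousLinearMap_apply, inChart_apply, inChart_apply]
  have : (fun i ↦ (mfderiv 𝓘(ℝ, EuclideanSpace ℝ (Fin n)) (𝓡 n) (extChartAt (𝓡 n) x).symm w (v i) :
      EuclideanSpace ℝ (Fin n))) = fun i ↦
      mfderiv 𝓘(ℝ, EuclideanSpace ℝ (Fin n)) (𝓡 n) (extChartAt (𝓡 n) x₀).symm
      (extChartAt (𝓡 n) x₀ ((extChartAt (𝓡 n) x).symm w))
      (fderiv ℝ (fun u ↦ extChartAt (𝓡 n) x₀ ((extChartAt (𝓡 n) x).symm u)) w (v i)) :=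
    funext fun i => mfderiv_symm_eq hw hw' (v i)
  exact (congrArg (α ((extChartAt (𝓡 n) x).symm w)) this).trans
    (apply_congr α ((extChartAt (𝓡 n) x₀).left_inv hw').symm _)

theorem IsSmooth.differentiableAt {k : ℕ} {α : RoughForm n M k} (hα : α.IsSmooth) {x₀ : M}
    {y : EuclideanSpace ℝ (Fin n)} (hy : y ∈ (extChartAt (𝓡 n) x₀).target) :
    DifferentiableAt ℝ (α.inChart x₀) y :=
  ((hα x₀).contDiffAt ((isOpen_extChartAt_target x₀).mem_nhds hy)).differentiableAt (by simp)

theorem extDeriv_inChart {k : ℕ} {α : RoughForm n M k} (hα : α.IsSmooth) {x₀ x : M}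
    {w : EuclideanSpace ℝ (Fin n)} (hw : w ∈ (extChartAt (𝓡 n) x).target)
    (hw' : (extChartAt (𝓡 n) x).symm w ∈ (extChartAt (𝓡 n) x₀).source) :
    extDeriv (α.inChart x) w = (extDeriv (α.inChart x₀)
      (extChartAt (𝓡 n) x₀ ((extChartAt (𝓡 n) x).symm w))).compContinuousLinearMap
      (fderiv ℝ (fun u ↦ extChartAt (𝓡 n) x₀ ((extChartAt (𝓡 n) x).symm u)) w) := by
  have h : α.inChart x =ᶠ[nhds w] fun u ↦ (α.inChart x₀
      (extChartAt (𝓡 n) x₀ ((extChartAt (𝓡 n) x).symm u))).compContinuousLinearMap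
      (fderiv ℝ (fun u ↦ extChartAt (𝓡 n) x₀ ((extChartAt (𝓡 n) x).symm u)) u) := by
    filter_upwards [eventually_symm_eq hw hw'] with u hu
    exact inChart_eq α hu.1 hu.2
  rw [h.extDeriv_eq]
  exact extDeriv_pullback (r := ∞) (f := fun u ↦ extChartAt (𝓡 n) x₀ ((extChartAt (𝓡 n) x).symm u))
    (hα.differentiableAt ((extChartAt (𝓡 n) x₀).map_source hw'))
    (contDiffAt_transition hw hw') (by simp; exact WithTop.coe_le_coe.2 le_top)

/-- In any chart, the exterior derivative is the exterior derivative of the representative. -/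
theorem extD_inChart {k : ℕ} {α : RoughForm n M k} (hα : α.IsSmooth) {x₀ : M}
    {y : EuclideanSpace ℝ (Fin n)} (hy : y ∈ (extChartAt (𝓡 n) x₀).target) :
    (extD α).inChart x₀ y = extDeriv (α.inChart x₀) y := by
  have hs : (extChartAt (𝓡 n) x₀).symm y ∈ (extChartAt (𝓡 n) x₀).source :=
    (extChartAt (𝓡 n) x₀).map_target hy
  have hx := mem_extChartAt_source (I := 𝓡 n) ((extChartAt (𝓡 n) x₀).symm y)
  have hsym := (extChartAt (𝓡 n) ((extChartAt (𝓡 n) x₀).symm y)).left_inv hx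
  have key := extDeriv_inChart hα (x₀ := (extChartAt (𝓡 n) x₀).symm y) hy hx
  rw [key]
  ext v
  rw [inChart_apply, ContinuousAlternatingMap.compContinuousLinearMap_apply, extD_apply]
  refine congrArg (extDeriv _ _) ?_
  funext i
  have := mfderiv_comp (I' := 𝓡 n) y (g := extChartAt (𝓡 n) ((extChartAt (𝓡 n) x₀).symm y))
    (I'' := 𝓘(ℝ, EuclideanSpace ℝ (Fin n))) (f := (extChartAt (𝓡 n) x₀).symm)
    (mdifferentiableAt_extChartAt (by simp)) (mdiffAt_symm hy)
  rw [mfderiv_eq_fderiv] at this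
  exact (DFunLike.congr_fun this (v i)).symm

theorem IsSmooth.extD {k : ℕ} {α : RoughForm n M k} (hα : α.IsSmooth) : (extD α).IsSmooth := by
  intro x₀
  have h : ContDiffOn ℝ ∞ (fun y => extDeriv (α.inChart x₀) y) (extChartAt (𝓡 n) x₀).target := by
    have h1 := (hα x₀).fderiv_of_isOpen (m := ∞) (isOpen_extChartAt_target x₀) (by simp)
    exact (ContinuousAlternatingMap.alternatizeUncurryFinCLM ℝ (EuclideanSpace ℝ (Fin n)) ℝ
      (n := k)).contDiff.comp_contDiffOn h1
  exact h.congr fun y hy => extD_inChart hα hy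

end RoughForm

end Rough

section Forms

variable {n : ℕ} {M : Type*} [TopologicalSpace M] [ChartedSpace (EuclideanSpace ℝ (Fin n)) M]

namespace RoughForm

theorem inChart_add {k : ℕ} (α β : RoughForm n M k) (x₀ : M) :
    (α + β).inChart x₀ = α.inChart x₀ + β.inChart x₀ := rfl

theorem inChart_smul {k : ℕ} (f : M → ℝ) (α : RoughForm n M k) (x₀ : M) :
    RoughForm.inChart (fun x ↦ f x • α x) x₀ =
      fun y ↦ f ((extChartAt (𝓡 n) x₀).symm y) • α.inChart x₀ y := rfl

end RoughForm

/-- The real vector space of smooth `k`-forms. -/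
noncomputable def smoothForms (n : ℕ) (M : Type*) [TopologicalSpace M]
    [ChartedSpace (EuclideanSpace ℝ (Fin n)) M] (k : ℕ) : Submodule ℝ (RoughForm n M k) where
  carrier := {α | α.IsSmooth}
  add_mem' ha hb x₀ := (ha x₀).add (hb x₀)
  zero_mem' _ := contDiffOn_const (c := 0)
  smul_mem' c _ ha x₀ := (ha x₀).const_smul c

/-- The type `Ω^k(M)` of smooth `k`-forms. -/
def SmoothForm (n : ℕ) (M : Type*) [TopologicalSpace M]
    [ChartedSpace (EuclideanSpace ℝ (Fin n)) M] (k : ℕ) : Type _ := smoothForms n M k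

noncomputable instance (k : ℕ) : AddCommGroup (SmoothForm n M k) :=
  inferInstanceAs (AddCommGroup (smoothForms n M k))

noncomputable instance (k : ℕ) : Module ℝ (SmoothForm n M k) :=
  inferInstanceAs (Module ℝ (smoothForms n M k))

theorem SmoothForm.smooth {k : ℕ} (α : SmoothForm n M k) : RoughForm.IsSmooth α.1 := α.2

theorem SmoothForm.ext' {k : ℕ} {α β : SmoothForm n M k} (h : ∀ x, α.1 x = β.1 x) : α = β :=
  Subtype.ext (funext h)

variable [IsManifold (𝓡 n) ∞ M]

noncomputable instance (k : ℕ) : SMul (SmoothFn n M) (SmoothForm n M k) where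
  smul f α := ⟨fun x ↦ f x • α.1 x, show RoughForm.IsSmooth _ from fun x₀ ↦ by
    have h : ContDiffOn ℝ ∞ (fun y ↦ f ((extChartAt (𝓡 n) x₀).symm y))
        (extChartAt (𝓡 n) x₀).target := by
      rw [← contMDiffOn_iff_contDiffOn]
      exact f.contMDiff.comp_contMDiffOn (contMDiffOn_extChartAt_symm x₀)
    exact h.smul (α.smooth x₀)⟩

theorem SmoothForm.smul_apply {k : ℕ} (f : SmoothFn n M) (α : SmoothForm n M k) (x : M) :
    (f • α).1 x = f x • α.1 x := rfl

noncomputable instance (k : ℕ) : Module (SmoothFn n M) (SmoothForm n M k) where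
  one_smul α := SmoothForm.ext' fun x ↦ one_smul ℝ (α.1 x)
  mul_smul f g α := SmoothForm.ext' fun x ↦ mul_smul (f x) (g x) (α.1 x)
  smul_zero f := SmoothForm.ext' fun x ↦ smul_zero (f x)
  smul_add f α β := SmoothForm.ext' fun x ↦ smul_add (f x) (α.1 x) (β.1 x)
  add_smul f g α := SmoothForm.ext' fun x ↦ add_smul (f x) (g x) (α.1 x)
  zero_smul α := SmoothForm.ext' fun x ↦ zero_smul ℝ (α.1 x)

instance (k : ℕ) : IsScalarTower ℝ (SmoothFn n M) (SmoothForm n M k) where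
  smul_assoc c f α := SmoothForm.ext' fun x ↦ smul_assoc c (f x) (α.1 x)

theorem RoughForm.IsSmooth.differentiableAt_extChartAt {k : ℕ} {α : RoughForm n M k}
    (hα : α.IsSmooth) (x : M) :
    DifferentiableAt ℝ (α.inChart x) (extChartAt (𝓡 n) x x) :=
  hα.differentiableAt (mem_extChartAt_target x)

/-- The exterior derivative `Ω^k(M) → Ω^{k+1}(M)`. -/
noncomputable def SmoothForm.d {k : ℕ} : SmoothForm n M k →ₗ[ℝ] SmoothForm n M (k + 1) where
  toFun α := ⟨α.1.extD, α.smooth.extD⟩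
  map_add' α β := SmoothForm.ext' fun x ↦ by
    change RoughForm.extD (α.1 + β.1) x = RoughForm.extD α.1 x + RoughForm.extD β.1 x
    rw [RoughForm.extD, RoughForm.inChart_add, extDeriv_add
      (α.smooth.differentiableAt_extChartAt x)
      (β.smooth.differentiableAt_extChartAt x)]
    rfl
  map_smul' c α := SmoothForm.ext' fun x ↦ by
    change RoughForm.extD (c • α.1) x = c • RoughForm.extD α.1 x
    have h : (c • α.1).inChart x = c • α.1.inChart x := rfl
    rw [RoughForm.extD, h, extDeriv_smul]
    rfl

/-- Contraction `Ω^{k+1}(M) → Ω^k(M)`, `α ↦ α(X, -)`, with a vector field. -/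
noncomputable def SmoothForm.contract {k : ℕ} (X : VecField n M) (α : SmoothForm n M (k + 1)) :
    SmoothForm n M k :=
  ⟨RoughForm.contract (fun x ↦ X x) α.1, RoughForm.IsSmooth.contract X.contMDiff α.smooth⟩

theorem SmoothForm.contract_apply {k : ℕ} (X : VecField n M) (α : SmoothForm n M (k + 1)) (x : M)
    (v : Fin k → TangentSpace (𝓡 n) x) :
    (SmoothForm.contract X α).1 x v = α.1 x (Matrix.vecCons (X x) v) := rfl

/-- The space `Ω(M)` of differential forms. As forms of degree larger than `n` vanish, the product
of the spaces `Ω^k(M)` is also their direct sum. -/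
def Forms (n : ℕ) (M : Type*) [TopologicalSpace M]
    [ChartedSpace (EuclideanSpace ℝ (Fin n)) M] : Type _ := (k : ℕ) → SmoothForm n M k

noncomputable instance : AddCommGroup (Forms n M) :=
  inferInstanceAs (AddCommGroup ((k : ℕ) → SmoothForm n M k))

noncomputable instance : Module ℝ (Forms n M) :=
  inferInstanceAs (Module ℝ ((k : ℕ) → SmoothForm n M k))

noncomputable instance : Module (SmoothFn n M) (Forms n M) :=
  inferInstanceAs (Module (SmoothFn n M) ((k : ℕ) → SmoothForm n M k))

instance : IsScalarTower ℝ (SmoothFn n M) (Forms n M) :=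
  inferInstanceAs (IsScalarTower ℝ (SmoothFn n M) ((k : ℕ) → SmoothForm n M k))

/-- The exterior derivative on `Ω(M)`. -/
noncomputable def extDer : Forms n M →ₗ[ℝ] Forms n M where
  toFun α := fun
    | 0 => 0
    | k + 1 => SmoothForm.d (α k)
  map_add' α β := funext fun
    | 0 => (add_zero 0).symm
    | k + 1 => map_add SmoothForm.d (α k) (β k)
  map_smul' c α := funext fun
    | 0 => (smul_zero c).symm
    | k + 1 => map_smul SmoothForm.d c (α k)

/-- Contraction with vector fields on `Ω(M)`. -/
noncomputable def contractVec : VecField n M →ₗ[SmoothFn n M] Module.End (SmoothFn n M) (Forms n M)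
    where
  toFun X :=
    { toFun := fun α k ↦ SmoothForm.contract X (α (k + 1))
      map_add' := fun _ _ ↦ rfl
      map_smul' := fun _ _ ↦ rfl }
  map_add' X Y := LinearMap.ext fun α ↦ funext fun k ↦ SmoothForm.ext' fun x ↦
    ContinuousAlternatingMap.ext fun v ↦
      (α (k + 1)).1 x |>.toAlternatingMap.map_vecCons_add v (X x) (Y x)
  map_smul' f X := LinearMap.ext fun α ↦ funext fun k ↦ SmoothForm.ext' fun x ↦
    ContinuousAlternatingMap.ext fun v ↦
      (α (k + 1)).1 x |>.toAlternatingMap.map_vecCons_smul v (f x) (X x)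

theorem contractVec_sq (X : VecField n M) : contractVec X * contractVec X = 0 :=
  LinearMap.ext fun α ↦ funext fun k ↦ SmoothForm.ext' fun x ↦
    ContinuousAlternatingMap.ext fun v ↦
      ((α (k + 1 + 1)).1 x).map_eq_zero_of_eq (Matrix.vecCons (X x) (Matrix.vecCons (X x) v))
        (i := 0) (j := 1) rfl (by simp)

end Forms

section Schouten

open ExteriorAlgebra

variable {A L : Type*} [CommRing A] [LieRing L] [Module A L] [LieRingModule L A]
  [LieRinehartRing A L]

theorem lie_one (X : L) : ⁅X, (1 : A)⁆ = 0 := by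
  have h := LieRinehartRing.leibniz_mul_right X (1 : A) 1
  simpa using h

/-- The differential of `a`, as the `A`-linear map `X ↦ X(a)`. -/
def differential (a : A) : Module.Dual A L where
  toFun X := ⁅X, a⁆
  map_add' X Y := add_lie X Y a
  map_smul' b X := LieRinehartRing.lie_smul_eq_mul b a X

/-- The bracket `ν(a, -)` with `a ∈ A`: the graded derivation of degree `-1` of the exterior algebra
that sends `X` to `X(a)`, that is, contraction with the differential of `a`. -/
def fnBracket (a : A) : ExteriorAlgebra A L →ₗ[A] ExteriorAlgebra A L :=
  CliffordAlgebra.contractLeft (differential a)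

theorem fnBracket_ι_mul (a : A) (X : L) (z : ExteriorAlgebra A L) :
    fnBracket a (ι A X * z) = ⁅X, a⁆ • z - ι A X * fnBracket a z :=
  CliffordAlgebra.contractLeft_ι_mul (differential a) X z

theorem fnBracket_algebraMap (a b : A) :
    fnBracket a (algebraMap A (ExteriorAlgebra A L) b) = 0 :=
  CliffordAlgebra.contractLeft_algebraMap _ (differential a) b

theorem fnBracket_add (a b : A) (z : ExteriorAlgebra A L) :
    fnBracket (a + b) z = fnBracket a z + fnBracket b z := by
  have : differential (L := L) (a + b) = differential a + differential b := by
    ext X; exact lie_add X a b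
  simp [fnBracket, this]

theorem fnBracket_mul (a b : A) (z : ExteriorAlgebra A L) :
    fnBracket (a * b) z = a • fnBracket b z + b • fnBracket a z := by
  have : differential (L := L) (a * b) = a • differential b + b • differential a := by
    ext X
    exact (LieRinehartRing.leibniz_mul_right X a b).trans (by simp [differential, mul_comm])
  simp [fnBracket, this]

theorem fnBracket_one (z : ExteriorAlgebra A L) : fnBracket (1 : A) z = 0 := by
  have : differential (L := L) (1 : A) = 0 := by ext X; exact lie_one X
  simp [fnBracket, this]

theorem fnBracket_zero (z : ExteriorAlgebra A L) : fnBracket (0 : A) z = 0 := by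
  have : differential (L := L) (0 : A) = 0 := by ext X; exact lie_zero X
  simp [fnBracket, this]

/-- A copy of `Λ × Λ`, with the `A`-module structure
`a • (u, v) = (a u, a v + X(a) u)`, used to extend the derivation `[X, -]` to `Λ`. -/
def LieTwist (A : Type*) {L : Type*} [CommRing A] [LieRing L] [Module A L] (_X : L) : Type _ :=
  ExteriorAlgebra A L × ExteriorAlgebra A L

instance (X : L) : AddCommGroup (LieTwist A X) :=
  inferInstanceAs (AddCommGroup (ExteriorAlgebra A L × ExteriorAlgebra A L))

/-- The pair `(u, v)` as an element of `LieTwist A X`. -/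
def LieTwist.mk {X : L} (u v : ExteriorAlgebra A L) : LieTwist A X := (u, v)

instance (X : L) : Module A (LieTwist A X) where
  smul a w := LieTwist.mk (a • w.1) (a • w.2 + ⁅X, a⁆ • w.1)
  one_smul w := Prod.ext (one_smul _ _)
    (show (1 : A) • w.2 + ⁅X, (1 : A)⁆ • w.1 = w.2 by simp [lie_one])
  mul_smul a b w := Prod.ext (mul_smul _ _ _)
    (show (a * b) • w.2 + ⁅X, a * b⁆ • w.1 = a • (b • w.2 + ⁅X, b⁆ • w.1) + ⁅X, a⁆ • b • w.1 by
      simp only [LieRinehartRing.leibniz_mul_right, smul_eq_mul]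
      module)
  smul_zero a := Prod.ext (smul_zero _) (show a • (0 : ExteriorAlgebra A L) + ⁅X, a⁆ •
    (0 : ExteriorAlgebra A L) = 0 by simp)
  smul_add a v w := Prod.ext (smul_add _ _ _)
    (show a • (v.2 + w.2) + ⁅X, a⁆ • (v.1 + w.1) = (a • v.2 + ⁅X, a⁆ • v.1) +
      (a • w.2 + ⁅X, a⁆ • w.1) by module)
  add_smul a b w := Prod.ext (add_smul _ _ _)
    (show (a + b) • w.2 + ⁅X, a + b⁆ • w.1 = (a • w.2 + ⁅X, a⁆ • w.1) +
      (b • w.2 + ⁅X, b⁆ • w.1) by rw [lie_add]; module)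
  zero_smul w := Prod.ext (zero_smul _ _)
    (show (0 : A) • w.2 + ⁅X, (0 : A)⁆ • w.1 = 0 by simp)

theorem LieTwist.smul_def {X : L} (a : A) (w : LieTwist A X) :
    a • w = LieTwist.mk (a • w.1) (a • w.2 + ⁅X, a⁆ • w.1) := rfl

/-- The action of `Y ∈ L` on `LieTwist A X`, `(u, v) ↦ (Y u, [X, Y] u + Y v)`. -/
def LieTwist.step (X : L) : L →ₗ[A] Module.End A (LieTwist A X) where
  toFun Y :=
    { toFun := fun w ↦ LieTwist.mk (ι A Y * w.1) (ι A ⁅X, Y⁆ * w.1 + ι A Y * w.2)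
      map_add' := fun v w ↦ Prod.ext (mul_add _ _ _)
        (show ι A ⁅X, Y⁆ * (v.1 + w.1) + ι A Y * (v.2 + w.2) = _ by
          rw [mul_add, mul_add]; exact add_add_add_comm _ _ _ _)
      map_smul' := fun a w ↦ Prod.ext (mul_smul_comm _ _ _)
        (show ι A ⁅X, Y⁆ * (a • w.1) + ι A Y * (a • w.2 + ⁅X, a⁆ • w.1) =
          a • (ι A ⁅X, Y⁆ * w.1 + ι A Y * w.2) + ⁅X, a⁆ • (ι A Y * w.1) by
          simp only [mul_add, mul_smul_comm, smul_add]; abel) }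
  map_add' Y Z := LinearMap.ext fun w ↦ Prod.ext
    (show ι A (Y + Z) * w.1 = ι A Y * w.1 + ι A Z * w.1 by simp [add_mul])
    (show ι A ⁅X, Y + Z⁆ * w.1 + ι A (Y + Z) * w.2 = (ι A ⁅X, Y⁆ * w.1 + ι A Y * w.2) +
      (ι A ⁅X, Z⁆ * w.1 + ι A Z * w.2) by simp only [lie_add, map_add, add_mul]; abel)
  map_smul' a Y := LinearMap.ext fun w ↦ Prod.ext
    (show ι A (a • Y) * w.1 = a • (ι A Y * w.1) by simp)
    (show ι A ⁅X, a • Y⁆ * w.1 + ι A (a • Y) * w.2 =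
      a • (ι A ⁅X, Y⁆ * w.1 + ι A Y * w.2) + ⁅X, a⁆ • (ι A Y * w.1) by
      simp only [LieRinehartRing.leibniz_smul_right, map_add, map_smul, add_mul, smul_mul_assoc,
        smul_add]; abel)

theorem LieTwist.step_sq (X Y : L) : LieTwist.step (A := A) X Y * LieTwist.step X Y = 0 :=
  LinearMap.ext fun w ↦ Prod.ext
    (show ι A Y * (ι A Y * w.1) = 0 by rw [← mul_assoc, ι_sq_zero, zero_mul])
    (show ι A ⁅X, Y⁆ * (ι A Y * w.1) + ι A Y * (ι A ⁅X, Y⁆ * w.1 + ι A Y * w.2) = 0 by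
      have h : ι A ⁅X, Y⁆ * ι A Y + ι A Y * ι A ⁅X, Y⁆ = 0 := ι_add_mul_swap _ _
      rw [mul_add, ← mul_assoc, ← mul_assoc, ← mul_assoc, ι_sq_zero, zero_mul, add_zero,
        ← add_mul, h, zero_mul])

/-- Multivector fields act on `LieTwist A X`. -/
def LieTwist.act (X : L) : ExteriorAlgebra A L →ₐ[A] Module.End A (LieTwist A X) :=
  lift A ⟨LieTwist.step X, LieTwist.step_sq X⟩

theorem LieTwist.act_ι_mul (X Y : L) (z : ExteriorAlgebra A L) (w : LieTwist A X) :
    act X (ι A Y * z) w = step X Y (act X z w) := by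
  rw [map_mul, act, lift_ι_apply]; rfl

theorem LieTwist.act_algebraMap (X : L) (a : A) (w : LieTwist A X) :
    act X (algebraMap A (ExteriorAlgebra A L) a) w = a • w := by
  rw [AlgHom.commutes]; rfl

theorem LieTwist.act_fst (X : L) (z : ExteriorAlgebra A L) (w : LieTwist A X) :
    (act X z w).1 = z * w.1 := by
  induction z using CliffordAlgebra.left_induction with
  | algebraMap a => rw [act_algebraMap, ← Algebra.smul_def]; rfl
  | add a b ha hb =>
    rw [map_add, add_mul, ← ha, ← hb]; rfl
  | ι_mul a Y ha =>
    exact (congrArg Prod.fst (act_ι_mul X Y a w)).trans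
      ((congrArg (ι A Y * ·) ha).trans (mul_assoc _ _ _).symm)

/-- The derivation of the exterior algebra `Λ` of `L` over `A` that extends `X` acting on `A` and
`[X, -]` on `L`, namely the Lie derivative of multivector fields along `X`. -/
def lieMv (X : L) (z : ExteriorAlgebra A L) : ExteriorAlgebra A L :=
  (LieTwist.act X z (LieTwist.mk 1 0)).2

theorem lieMv_algebraMap (X : L) (a : A) :
    lieMv X (algebraMap A (ExteriorAlgebra A L) a) = algebraMap A _ ⁅X, a⁆ := by
  rw [lieMv, LieTwist.act_algebraMap]
  change a • (0 : ExteriorAlgebra A L) + ⁅X, a⁆ • (1 : ExteriorAlgebra A L) = _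
  rw [smul_zero, zero_add, Algebra.smul_def, mul_one]

theorem lieMv_ι_mul (X Y : L) (z : ExteriorAlgebra A L) :
    lieMv X (ι A Y * z) = ι A ⁅X, Y⁆ * z + ι A Y * lieMv X z := by
  rw [lieMv, LieTwist.act_ι_mul]
  change ι A ⁅X, Y⁆ * (LieTwist.act X z (LieTwist.mk 1 0)).1 + _ = _
  rw [LieTwist.act_fst]
  change ι A ⁅X, Y⁆ * (z * 1) + _ = _
  rw [mul_one]; rfl

theorem lieMv_add (X : L) (y z : ExteriorAlgebra A L) :
    lieMv X (y + z) = lieMv X y + lieMv X z := by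
  rw [lieMv, map_add]; rfl

theorem lieMv_smul (X : L) (a : A) (z : ExteriorAlgebra A L) :
    lieMv X (a • z) = a • lieMv X z + ⁅X, a⁆ • z := by
  rw [lieMv, map_smul, LinearMap.smul_apply]
  change a • (LieTwist.act X z (LieTwist.mk 1 0)).2 + ⁅X, a⁆ • (LieTwist.act X z _).1 = _
  rw [LieTwist.act_fst]
  change _ + ⁅X, a⁆ • (z * 1) = _
  rw [mul_one]; rfl

theorem lieMv_add_left (X Y : L) (z : ExteriorAlgebra A L) :
    lieMv (X + Y) z = lieMv X z + lieMv Y z := by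
  induction z using CliffordAlgebra.left_induction with
  | algebraMap a =>
    refine (lieMv_algebraMap _ _).trans ?_
    rw [add_lie, map_add]
    exact congrArg₂ _ (lieMv_algebraMap _ _).symm (lieMv_algebraMap _ _).symm
  | add a b ha hb => rw [lieMv_add, lieMv_add, lieMv_add, ha, hb]; abel
  | ι_mul a Z ha =>
    refine (lieMv_ι_mul _ _ _).trans ?_
    refine Eq.trans ?_ (congrArg₂ _ (lieMv_ι_mul _ _ _).symm (lieMv_ι_mul _ _ _).symm)
    rw [ha, add_lie, map_add, add_mul, mul_add]; abel

theorem smul_lie_eq (a : A) (X Y : L) : ⁅a • X, Y⁆ = a • ⁅X, Y⁆ - ⁅Y, a⁆ • X := by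
  rw [← lie_skew, LieRinehartRing.leibniz_smul_right, ← lie_skew, smul_neg]; abel

theorem lieMv_smul_left (a : A) (X : L) (z : ExteriorAlgebra A L) :
    lieMv (a • X) z = a • lieMv X z - ι A X * fnBracket a z := by
  induction z using CliffordAlgebra.left_induction with
  | algebraMap b =>
    refine (lieMv_algebraMap _ _).trans ?_
    refine Eq.trans ?_ (congrArg₂ (fun u v ↦ a • u - ι A X * v) (lieMv_algebraMap X b).symm
      (fnBracket_algebraMap a b).symm)
    rw [LieRinehartRing.lie_smul_eq_mul, mul_zero, sub_zero, map_mul, Algebra.smul_def]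
  | add u v hu hv => rw [lieMv_add, lieMv_add, map_add, hu, hv, mul_add, smul_add]; abel
  | ι_mul u Y hu =>
    refine (lieMv_ι_mul _ _ _).trans ?_
    refine Eq.trans ?_ (congrArg₂ (fun u v ↦ a • u - ι A X * v) (lieMv_ι_mul X Y u).symm
      (fnBracket_ι_mul a Y u).symm)
    have h : ι A X * ι A Y = - (ι A Y * ι A X) := eq_neg_of_add_eq_zero_left (ι_add_mul_swap _ _)
    rw [hu, smul_lie_eq]
    simp only [mul_sub, map_sub, map_smul, sub_mul, smul_mul_assoc, mul_smul_comm, smul_add,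
      ← mul_assoc, h, neg_mul]
    abel

/-- `lieMv X` as an additive map. -/
def lieMvHom (X : L) : ExteriorAlgebra A L →+ ExteriorAlgebra A L :=
  AddMonoidHom.mk' (lieMv X) (lieMv_add X)

theorem involute_mul_ι (X : L) (y : ExteriorAlgebra A L) :
    y * ι A X = ι A X * CliffordAlgebra.involute y := by
  induction y using CliffordAlgebra.left_induction with
  | algebraMap b =>
    rw [AlgHom.commutes]; exact Algebra.commutes _ _
  | add u v hu hv => rw [add_mul, hu, hv, map_add, mul_add]
  | ι_mul u Y hu =>
    rw [map_mul, CliffordAlgebra.involute_ι, mul_assoc, hu, ← mul_assoc, ← mul_assoc, mul_neg]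
    congr 1
    exact eq_neg_of_add_eq_zero_left (ι_add_mul_swap _ _)

/-- A copy of `Λ × Hom(Λ, Λ)`, with the `A`-module structure
`a • (y, P) = (a y, z ↦ a P(z) + ȳ ν(a, z))`, where `ȳ = (-1)^{|y|} y`. It is used to extend the
bracket of vector fields to multivector fields. -/
def NuTwist (A L : Type*) [CommRing A] [LieRing L] [Module A L] : Type _ :=
  ExteriorAlgebra A L × (ExteriorAlgebra A L →+ ExteriorAlgebra A L)

instance : AddCommGroup (NuTwist A L) :=
  inferInstanceAs (AddCommGroup (ExteriorAlgebra A L ×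
    (ExteriorAlgebra A L →+ ExteriorAlgebra A L)))

/-- The pair `(y, P)` as an element of `NuTwist A L`. -/
def NuTwist.mk (y : ExteriorAlgebra A L) (P : ExteriorAlgebra A L →+ ExteriorAlgebra A L) :
    NuTwist A L := (y, P)

theorem NuTwist.ext {u v : NuTwist A L} (h1 : u.1 = v.1) (h2 : ∀ z, u.2 z = v.2 z) : u = v :=
  Prod.ext h1 (AddMonoidHom.ext h2)

instance : Module A (NuTwist A L) where
  smul a w := NuTwist.mk (a • w.1) (AddMonoidHom.mk' (fun z ↦ a • w.2 z +
    CliffordAlgebra.involute w.1 * fnBracket a z) fun y z ↦ by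
      simp only [map_add, smul_add, mul_add]; abel)
  one_smul w := NuTwist.ext (one_smul _ _) fun z ↦
    (show (1 : A) • w.2 z + CliffordAlgebra.involute w.1 * fnBracket (1 : A) z = w.2 z by
      simp [fnBracket_one])
  mul_smul a b w := NuTwist.ext (mul_smul _ _ _) fun z ↦
    (show (a * b) • w.2 z + CliffordAlgebra.involute w.1 * fnBracket (a * b) z =
      a • (b • w.2 z + CliffordAlgebra.involute w.1 * fnBracket b z) +
      CliffordAlgebra.involute (b • w.1) * fnBracket a z by
      rw [fnBracket_mul, map_smul, mul_add, mul_smul_comm, mul_smul_comm, smul_mul_assoc]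
      module)
  smul_zero a := NuTwist.ext (smul_zero _) fun z ↦
    (show a • (0 : ExteriorAlgebra A L) +
      CliffordAlgebra.involute (0 : ExteriorAlgebra A L) * fnBracket a z = 0 by simp)
  smul_add a v w := NuTwist.ext (smul_add _ _ _) fun z ↦
    (show a • (v.2 z + w.2 z) + CliffordAlgebra.involute (v.1 + w.1) * fnBracket a z =
      (a • v.2 z + CliffordAlgebra.involute v.1 * fnBracket a z) +
      (a • w.2 z + CliffordAlgebra.involute w.1 * fnBracket a z) by
      rw [map_add, add_mul]; module)
  add_smul a b w := NuTwist.ext (add_smul _ _ _) fun z ↦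
    (show (a + b) • w.2 z + CliffordAlgebra.involute w.1 * fnBracket (a + b) z =
      (a • w.2 z + CliffordAlgebra.involute w.1 * fnBracket a z) +
      (b • w.2 z + CliffordAlgebra.involute w.1 * fnBracket b z) by
      rw [fnBracket_add, mul_add]; module)
  zero_smul w := NuTwist.ext (zero_smul _ _) fun z ↦
    (show (0 : A) • w.2 z + CliffordAlgebra.involute w.1 * fnBracket (0 : A) z = 0 by
      simp [fnBracket_zero])

/-- The action of `X ∈ L` on `NuTwist A L`, `(y, P) ↦ (X y, z ↦ y L_X z - X P(z))`. -/
def NuTwist.step : L →ₗ[A] Module.End A (NuTwist A L) where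
  toFun X :=
    { toFun := fun w ↦ NuTwist.mk (ι A X * w.1) (AddMonoidHom.mk' (fun z ↦
        w.1 * lieMv X z - ι A X * w.2 z) fun y z ↦ by
          simp only [map_add, lieMv_add, mul_add]; abel)
      map_add' := fun v w ↦ NuTwist.ext (mul_add _ _ _) fun z ↦
        (show (v.1 + w.1) * lieMv X z - ι A X * (v.2 z + w.2 z) =
          (v.1 * lieMv X z - ι A X * v.2 z) + (w.1 * lieMv X z - ι A X * w.2 z) by
          rw [add_mul, mul_add]; abel)
      map_smul' := fun a w ↦ NuTwist.ext (mul_smul_comm _ _ _) fun z ↦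
        (show (a • w.1) * lieMv X z - ι A X * (a • w.2 z +
            CliffordAlgebra.involute w.1 * fnBracket a z) =
          a • (w.1 * lieMv X z - ι A X * w.2 z) +
            CliffordAlgebra.involute (ι A X * w.1) * fnBracket a z by
          rw [map_mul, CliffordAlgebra.involute_ι, mul_add, smul_mul_assoc, mul_smul_comm,
            smul_sub, ← mul_assoc, neg_mul, neg_mul]
          abel) }
  map_add' X Y := LinearMap.ext fun w ↦ NuTwist.ext
    (show ι A (X + Y) * w.1 = ι A X * w.1 + ι A Y * w.1 by simp [add_mul]) fun z ↦
    (show w.1 * lieMv (X + Y) z - ι A (X + Y) * w.2 z = (w.1 * lieMv X z - ι A X * w.2 z) +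
      (w.1 * lieMv Y z - ι A Y * w.2 z) by
      rw [lieMv_add_left, map_add, mul_add, add_mul]; abel)
  map_smul' a X := LinearMap.ext fun w ↦ NuTwist.ext
    (show ι A (a • X) * w.1 = a • (ι A X * w.1) by simp) fun z ↦
    (show w.1 * lieMv (a • X) z - ι A (a • X) * w.2 z =
      a • (w.1 * lieMv X z - ι A X * w.2 z) +
        CliffordAlgebra.involute (ι A X * w.1) * fnBracket a z by
      rw [map_mul, CliffordAlgebra.involute_ι, lieMv_smul_left, mul_sub, ← mul_assoc,
        involute_mul_ι, map_smul, smul_mul_assoc, mul_smul_comm, smul_sub, neg_mul, neg_mul]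
      abel)

theorem NuTwist.step_sq (X : L) : NuTwist.step (A := A) X * NuTwist.step X = 0 :=
  LinearMap.ext fun w ↦ NuTwist.ext
    (show ι A X * (ι A X * w.1) = 0 by rw [← mul_assoc, ι_sq_zero, zero_mul]) fun z ↦
    (show (ι A X * w.1) * lieMv X z - ι A X * (w.1 * lieMv X z - ι A X * w.2 z) = 0 by
      rw [mul_sub, ← mul_assoc, ← mul_assoc, ι_sq_zero, zero_mul, sub_zero, sub_self])

/-- Multivector fields act on `NuTwist A L`. -/
def NuTwist.act : ExteriorAlgebra A L →ₐ[A] Module.End A (NuTwist A L) :=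
  lift A ⟨NuTwist.step, NuTwist.step_sq⟩

theorem NuTwist.act_ι_mul (X : L) (z : ExteriorAlgebra A L) (w : NuTwist A L) :
    act (ι A X * z) w = step X (act z w) := by
  rw [map_mul, act, lift_ι_apply]; rfl

theorem NuTwist.act_algebraMap (a : A) (w : NuTwist A L) :
    act (algebraMap A (ExteriorAlgebra A L) a) w = a • w := by
  rw [AlgHom.commutes]; rfl

theorem NuTwist.act_fst (z : ExteriorAlgebra A L) (w : NuTwist A L) :
    (act z w).1 = z * w.1 := by
  induction z using CliffordAlgebra.left_induction with
  | algebraMap a => rw [act_algebraMap, ← Algebra.smul_def]; rfl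
  | add a b ha hb =>
    rw [map_add, add_mul, ← ha, ← hb]; rfl
  | ι_mul a Y ha =>
    exact (congrArg Prod.fst (act_ι_mul Y a w)).trans
      ((congrArg (ι A Y * ·) ha).trans (mul_assoc _ _ _).symm)

/-- The Schouten bracket in its graded symmetric form of degree `-1`, `ν(x, z) = (-1)^{|x|-1} [x, z]`,
on the exterior algebra `Λ` of `L` over `A`. It is determined by the rules `nu_add_left`,
`nu_add_right`, `nu_algebraMap` and `nu_ι_mul` below:
`ν(a, z)` is contraction with the differential of `a ∈ A`, so that `ν(a, X) = X(a)`, and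
`ν(X ∧ y, z) = y ∧ L_X z - X ∧ ν(y, z)` for `X ∈ L`, where `L_X` is the derivation of `Λ` with
`L_X a = X(a)` and `L_X Y = [X, Y]`. In particular `ν(X, Y) = [X, Y]` and `ν(X, a) = X(a)`.
On products of elements of `L` this gives the classical formula
`ν(X₁ ∧ ⋯ ∧ X_r, Y₁ ∧ ⋯ ∧ Y_s) = (-1)^{r-1} ∑_{i, j} (-1)^{i+j} [X_i, Y_j] ∧ X₁ ∧ ⋯ ∧ Y_s`,
with `X_i` and `Y_j` omitted in the remaining product. -/
def nu (x z : ExteriorAlgebra A L) : ExteriorAlgebra A L :=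
  (NuTwist.act x (NuTwist.mk 1 0)).2 z

theorem nu_add_left (x y z : ExteriorAlgebra A L) : nu (x + y) z = nu x z + nu y z := by
  rw [nu, map_add]; rfl

theorem nu_add_right (x y z : ExteriorAlgebra A L) : nu x (y + z) = nu x y + nu x z :=
  map_add _ _ _

theorem nu_algebraMap (a : A) (z : ExteriorAlgebra A L) :
    nu (algebraMap A (ExteriorAlgebra A L) a) z = fnBracket a z := by
  rw [nu, NuTwist.act_algebraMap]
  change a • (0 : ExteriorAlgebra A L) + CliffordAlgebra.involute 1 * fnBracket a z = _
  rw [smul_zero, zero_add, map_one, one_mul]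

theorem nu_ι_mul (X : L) (y z : ExteriorAlgebra A L) :
    nu (ι A X * y) z = y * lieMv X z - ι A X * nu y z := by
  rw [nu, NuTwist.act_ι_mul]
  change (NuTwist.act y (NuTwist.mk 1 0)).1 * lieMv X z - _ = _
  rw [NuTwist.act_fst]
  change (y * 1) * _ - _ = _
  rw [mul_one]; rfl

theorem nu_ι (X : L) (z : ExteriorAlgebra A L) : nu (ι A X) z = lieMv X z := by
  have h := nu_ι_mul X 1 z
  have h2 := nu_algebraMap (1 : A) z
  rw [map_one, fnBracket_one] at h2
  rwa [mul_one, one_mul, h2, mul_zero, sub_zero] at h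

theorem nu_ι_ι (X Y : L) : nu (ι A X) (ι A Y) = ι A ⁅X, Y⁆ := by
  have h := lieMv_ι_mul (A := A) X Y 1
  have h2 := lieMv_algebraMap X (1 : A)
  rw [map_one, lie_one, map_zero] at h2
  rw [nu_ι]
  rwa [mul_one, mul_one, h2, mul_zero, add_zero] at h

end Schouten

section Signs

/-- The Koszul sign `ε(σ)` of a permutation `σ` of homogeneous elements of degrees `p₁, …, pₙ`:
`v₁ ⊗ ⋯ ⊗ vₙ` is sent to `ε(σ) v_{σ(1)} ⊗ ⋯ ⊗ v_{σ(n)}`, and every pair of elements of odd degree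
whose order is reversed contributes a factor `-1`. -/
def koszulSign {n : ℕ} (p : Fin n → ℤ) (σ : Equiv.Perm (Fin n)) : ℤ :=
  ∏ a : Fin n, ∏ b : Fin n,
    if a < b ∧ σ b < σ a then ((p (σ a) * p (σ b)).negOnePow : ℤ) else 1

/-- `σ` is an `(i, n - i)`-unshuffle: it is increasing on the first `i` indices and on the
remaining ones. -/
def IsUnshuffle {n : ℕ} (i : ℕ) (σ : Equiv.Perm (Fin n)) : Prop :=
  ∀ a b : Fin n, a < b → ((b : ℕ) < i ∨ i ≤ (a : ℕ)) → σ a < σ b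

instance {n : ℕ} (i : ℕ) : DecidablePred (IsUnshuffle (n := n) i) := fun σ ↦ by
  unfold IsUnshuffle; infer_instance

/-- The first `i + 1` entries of a tuple. -/
def headPart {α : Type*} {n : ℕ} (i : Fin n) (f : Fin n → α) : Fin (i + 1) → α :=
  fun a ↦ f ⟨a, by omega⟩

/-- The entries of a tuple after the first `i + 1`. -/
def tailPart {α : Type*} {n : ℕ} (i : Fin n) (f : Fin n → α) : Fin (n - (i + 1)) → α :=
  fun b ↦ f ⟨b + (i + 1), by omega⟩

end Signs

section GradedStructures

variable {U U' : Type*} [AddCommGroup U] [Module ℝ U] [AddCommGroup U'] [Module ℝ U']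

/-- The graded subspaces `V k` of `U` and the brackets `l 1, l 2, …` form an `L∞`-algebra, in the
convention with graded symmetric brackets of degree `-1` on a graded vector space that is
concentrated in positive degrees. The value `l r p x` is the bracket of the homogeneous elements
`x i ∈ V (p i)`; it is not restricted elsewhere. The last condition is the family of higher Jacobi
identities `∑_{i + j = r + 1} l_j ⅂ l_i = 0`, where
`(l_j ⅂ l_i)(x₁, …, x_r) = ∑_σ ε(σ) l_j(l_i(x_{σ(1)}, …, x_{σ(i)}), x_{σ(i+1)}, …, x_{σ(r)})`
with `σ` running over the `(i, r - i)`-unshuffles. -/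
structure IsLInfinity (V : ℤ → Submodule ℝ U)
    (l : (r : ℕ) → (Fin r → ℤ) → (Fin r → U) → U) : Prop where
  independent : iSupIndep V
  positive : ∀ k : ℤ, k ≤ 0 → V k = ⊥
  degree : ∀ (r : ℕ) (p : Fin r → ℤ) (x : Fin r → U), 1 ≤ r → (∀ i, x i ∈ V (p i)) →
    l r p x ∈ V (∑ i, p i - 1)
  map_add : ∀ (r : ℕ) (p : Fin r → ℤ) (x : Fin r → U) (i : Fin r) (y : U), 1 ≤ r →
    (∀ i, x i ∈ V (p i)) → y ∈ V (p i) →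
    l r p (Function.update x i (x i + y)) = l r p x + l r p (Function.update x i y)
  map_smul : ∀ (r : ℕ) (p : Fin r → ℤ) (x : Fin r → U) (i : Fin r) (c : ℝ), 1 ≤ r →
    (∀ i, x i ∈ V (p i)) → l r p (Function.update x i (c • x i)) = c • l r p x
  symmetric : ∀ (r : ℕ) (p : Fin r → ℤ) (x : Fin r → U) (σ : Equiv.Perm (Fin r)), 1 ≤ r →
    (∀ i, x i ∈ V (p i)) →
    l r p x = koszulSign p σ • l r (fun i ↦ p (σ i)) (fun i ↦ x (σ i))
  jacobi : ∀ (r : ℕ) (p : Fin r → ℤ) (x : Fin r → U), 1 ≤ r → (∀ i, x i ∈ V (p i)) →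
    ∑ i : Fin r, ∑ σ : Equiv.Perm (Fin r) with IsUnshuffle (i + 1) σ,
      koszulSign p σ • l (r - (i + 1) + 1)
        (Fin.cons (∑ a, headPart i (fun b ↦ p (σ b)) a - 1) (tailPart i fun b ↦ p (σ b)))
        (Fin.cons (l (i + 1) (headPart i fun b ↦ p (σ b)) (headPart i fun b ↦ x (σ b)))
          (tailPart i fun b ↦ x (σ b))) = 0

/-- The graded subspace `V` is closed under the brackets `l 1, l 2, …`, which are of degree `-1`. -/
def IsClosedUnder (V : ℤ → Submodule ℝ U) (l : (r : ℕ) → (Fin r → ℤ) → (Fin r → U) → U) : Prop :=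
  ∀ (r : ℕ) (p : Fin r → ℤ) (x : Fin r → U), 1 ≤ r → (∀ i, x i ∈ V (p i)) →
    l r p x ∈ V (∑ i, p i - 1)

/-- `V` is an `L∞`-subalgebra of the `L∞`-algebra `W` with brackets `l`: it is a graded subspace that
is closed under the brackets, and it is an `L∞`-algebra with them. -/
structure IsLInfinitySubalgebra (V W : ℤ → Submodule ℝ U)
    (l : (r : ℕ) → (Fin r → ℤ) → (Fin r → U) → U) : Prop where
  ambient : IsLInfinity W l
  le : ∀ k, V k ≤ W k
  closed : IsClosedUnder V l
  isLInfinity : IsLInfinity V l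

/-- The graded subspaces `C k` with the maps `d k : C k → C (k + 1)` form a cochain complex. -/
def IsCochainComplex (C : ℤ → Submodule ℝ U) (d : ℤ → U →ₗ[ℝ] U) : Prop :=
  ∀ k : ℤ, ∀ x ∈ C k, d k x ∈ C (k + 1) ∧ d (k + 1) (d k x) = 0

/-- The maps `φ k : C k → C' k` form a cochain map. -/
def IsCochainMap (C : ℤ → Submodule ℝ U) (d : ℤ → U →ₗ[ℝ] U) (C' : ℤ → Submodule ℝ U')
    (d' : ℤ → U' →ₗ[ℝ] U') (φ : ℤ → U →ₗ[ℝ] U') : Prop :=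
  ∀ k : ℤ, ∀ x ∈ C k, φ k x ∈ C' k ∧ φ (k + 1) (d k x) = d' k (φ k x)

/-- The truncation of a graded vector space to the degrees `0, …, m`. -/
def truncSpace (m : ℕ) (C : ℤ → Submodule ℝ U) (k : ℤ) : Submodule ℝ U :=
  if 0 ≤ k ∧ k ≤ m then C k else ⊥

/-- The truncation of a differential to the degrees `0, …, m`. -/
noncomputable def truncDiff (m : ℕ) (d : ℤ → U →ₗ[ℝ] U) (k : ℤ) : U →ₗ[ℝ] U :=
  if 0 ≤ k ∧ k + 1 ≤ m then d k else 0

/-- The defining relations `v w = (-1)^{|v| |w|} w v` of the graded symmetric algebra. -/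
inductive GSymRel (V : ℤ → Submodule ℝ U) :
    TensorAlgebra ℝ (DirectSum ℤ fun k ↦ V k) → TensorAlgebra ℝ (DirectSum ℤ fun k ↦ V k) → Prop
  | comm (p q : ℤ) (v : V p) (w : V q) : GSymRel V
      (TensorAlgebra.ι ℝ (DirectSum.lof ℝ ℤ (fun k ↦ V k) p v) *
        TensorAlgebra.ι ℝ (DirectSum.lof ℝ ℤ (fun k ↦ V k) q w))
      (((p * q).negOnePow : ℤ) • (TensorAlgebra.ι ℝ (DirectSum.lof ℝ ℤ (fun k ↦ V k) q w) *
        TensorAlgebra.ι ℝ (DirectSum.lof ℝ ℤ (fun k ↦ V k) p v)))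

/-- The graded symmetric algebra `S V`: the free graded commutative algebra on `V = ⨁ k, V k`. -/
def GSym (V : ℤ → Submodule ℝ U) : Type _ := RingQuot (GSymRel V)

noncomputable instance (V : ℤ → Submodule ℝ U) : Ring (GSym V) :=
  inferInstanceAs (Ring (RingQuot (GSymRel V)))

noncomputable instance (V : ℤ → Submodule ℝ U) : Algebra ℝ (GSym V) :=
  inferInstanceAs (Algebra ℝ (RingQuot (GSymRel V)))

namespace GSym

/-- The inclusion of `V k` in `S V`. -/
noncomputable def inc (V : ℤ → Submodule ℝ U) (k : ℤ) (v : V k) : GSym V :=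
  RingQuot.mkAlgHom ℝ (GSymRel V) (TensorAlgebra.ι ℝ (DirectSum.lof ℝ ℤ (fun k ↦ V k) k v))

/-- The product in `S V` of homogeneous elements of `V`. -/
noncomputable def prod (V : ℤ → Submodule ℝ U) {r : ℕ} (p : Fin r → ℤ) (x : (i : Fin r) → V (p i)) :
    GSym V :=
  (List.ofFn fun i ↦ inc V (p i) (x i)).prod

/-- The elements of `S V` of total degree `k`. -/
noncomputable def deg (V : ℤ → Submodule ℝ U) (k : ℤ) : Submodule ℝ (GSym V) :=
  Submodule.span ℝ {s | ∃ (r : ℕ) (p : Fin r → ℤ) (x : (i : Fin r) → V (p i)),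
    ∑ i, p i = k ∧ s = prod V p x}

end GSym

end GradedStructures

section GSymLift

variable {U : Type*} [Ring U] [Algebra ℝ U]

/-- The algebra morphism from `S V` that extends the inclusion of `V` in an algebra in which the
homogeneous elements of `V` commute in the graded sense. -/
noncomputable def GSym.lift (V : ℤ → Submodule ℝ U)
    (h : ∀ (p q : ℤ) (v : V p) (w : V q),
      (v : U) * (w : U) = ((p * q).negOnePow : ℤ) • ((w : U) * (v : U))) : GSym V →ₐ[ℝ] U :=
  RingQuot.liftAlgHom ℝ ⟨TensorAlgebra.lift ℝ
    (DirectSum.toModule ℝ ℤ U fun k ↦ (V k).subtype), by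
      rintro _ _ ⟨p, q, v, w⟩
      rw [map_mul, map_zsmul, map_mul, TensorAlgebra.lift_ι_apply, TensorAlgebra.lift_ι_apply,
        DirectSum.toModule_lof, DirectSum.toModule_lof]
      exact h p q v w⟩

theorem GSym.lift_inc (V : ℤ → Submodule ℝ U)
    (h : ∀ (p q : ℤ) (v : V p) (w : V q),
      (v : U) * (w : U) = ((p * q).negOnePow : ℤ) • ((w : U) * (v : U))) (k : ℤ) (v : V k) :
    GSym.lift V h (GSym.inc V k v) = v := by
  refine (RingQuot.liftAlgHom_mkAlgHom_apply ℝ _ _ _).trans ?_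
  rw [TensorAlgebra.lift_ι_apply, DirectSum.toModule_lof]
  rfl

end GSymLift

section GradedCommutativity

variable {A L : Type*} [CommRing A] [AddCommGroup L] [Module A L]

theorem ι_mul_pow (X : L) (q : ℕ) (y : ExteriorAlgebra A L)
    (hy : y ∈ LinearMap.range (ExteriorAlgebra.ι A (M := L)) ^ q) :
    ExteriorAlgebra.ι A X * y =
      ((-1 : ℤ) ^ q) • (y * ExteriorAlgebra.ι A X) := by
  induction hy using Submodule.pow_induction_on_left' with
  | algebraMap a => rw [pow_zero, one_smul]; exact (Algebra.commutes a _).symm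
  | add x y i hx hy ihx ihy => rw [mul_add, ihx, ihy, add_mul, smul_add]
  | mem_mul z hz i x hx ih =>
    obtain ⟨Z, rfl⟩ := hz
    have h : ExteriorAlgebra.ι A X * ExteriorAlgebra.ι A Z =
        - (ExteriorAlgebra.ι A Z * ExteriorAlgebra.ι A X) :=
      eq_neg_of_add_eq_zero_left (ExteriorAlgebra.ι_add_mul_swap _ _)
    rw [← mul_assoc, h, neg_mul, mul_assoc, ih, pow_succ, mul_smul_comm, mul_assoc,
      mul_neg_one, neg_smul]

theorem mul_comm_of_mem_pow {p q : ℕ} {x y : ExteriorAlgebra A L}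
    (hx : x ∈ LinearMap.range (ExteriorAlgebra.ι A (M := L)) ^ p)
    (hy : y ∈ LinearMap.range (ExteriorAlgebra.ι A (M := L)) ^ q) :
    x * y = ((-1 : ℤ) ^ (p * q)) • (y * x) := by
  induction hx using Submodule.pow_induction_on_left' with
  | algebraMap a => rw [zero_mul, pow_zero, one_smul]; exact Algebra.commutes a _
  | add x x' i hx hx' ih ih' => rw [add_mul, ih, ih', mul_add, smul_add]
  | mem_mul z hz i x hx ih =>
    obtain ⟨Z, rfl⟩ := hz
    rw [mul_assoc, ih, mul_smul_comm, ← mul_assoc, ι_mul_pow Z q y hy, smul_mul_assoc, smul_smul,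
      mul_assoc, ← pow_add, Nat.succ_mul]

end GradedCommutativity

section Multivectors

variable {n : ℕ} {M : Type*} [TopologicalSpace M] [ChartedSpace (EuclideanSpace ℝ (Fin n)) M]
  [IsManifold (𝓡 n) ∞ M]

/-- Multivector fields: the exterior algebra of the module of vector fields over the ring of smooth
functions, whose `k`-th exterior power is the space `𝔛^k(M)` of sections of the `k`-th exterior
power of the tangent bundle. -/
abbrev Multivec (n : ℕ) (M : Type*) [TopologicalSpace M]
    [ChartedSpace (EuclideanSpace ℝ (Fin n)) M] [IsManifold (𝓡 n) ∞ M] : Type _ :=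
  ExteriorAlgebra (SmoothFn n M) (VecField n M)

/-- The contraction `ι_x` of differential forms with a multivector field `x`, with the convention
`ι_{X₁ ∧ ⋯ ∧ X_r} = ι_{X₁} ∘ ⋯ ∘ ι_{X_r}`. -/
noncomputable def contraction :
    Multivec n M →ₐ[SmoothFn n M] Module.End (SmoothFn n M) (Forms n M) :=
  ExteriorAlgebra.lift (SmoothFn n M) ⟨contractVec, contractVec_sq⟩

/-- The map `x ↦ ι_x α`. -/
noncomputable def contractMap (α : Forms n M) : Multivec n M →ₗ[ℝ] Forms n M :=
  ((LinearMap.applyₗ α).comp (contraction (n := n) (M := M)).toLinearMap).restrictScalars ℝ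

theorem contractMap_apply (α : Forms n M) (x : Multivec n M) :
    contractMap α x = contraction x α := rfl

/-- The map `x ↦ (-1)^{|x|} x`. -/
noncomputable def signMap (n : ℕ) (M : Type*) [TopologicalSpace M]
    [ChartedSpace (EuclideanSpace ℝ (Fin n)) M] [IsManifold (𝓡 n) ∞ M] :
    Multivec n M →ₗ[ℝ] Multivec n M :=
  (CliffordAlgebra.involute (R := SmoothFn n M)
    (Q := (0 : QuadraticForm (SmoothFn n M) (VecField n M)))).toLinearMap.restrictScalars ℝ

/-- The Lie derivative `L_x α = [d, ι_x] α = d ι_x α - (-1)^{|x|} ι_x d α`, as a function of the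
multivector field `x`. -/
noncomputable def lieDer (α : Forms n M) : Multivec n M →ₗ[ℝ] Forms n M :=
  extDer.comp (contractMap α) - (contractMap (extDer α)).comp (signMap n M)

theorem lieDer_apply (α : Forms n M) (x : Multivec n M) :
    lieDer α x = extDer (contraction x α) - contraction (signMap n M x) (extDer α) := rfl

/-- Differential forms of degree `k`; there are none but `0` if `k` is negative. -/
noncomputable def formDeg (n : ℕ) (M : Type*) [TopologicalSpace M]
    [ChartedSpace (EuclideanSpace ℝ (Fin n)) M] (k : ℤ) : Submodule ℝ (Forms n M) where
  carrier := {α | ∀ j : ℕ, (j : ℤ) ≠ k → α j = 0}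
  add_mem' ha hb j hj := by
    exact (congrArg₂ (· + ·) (ha j hj) (hb j hj)).trans (add_zero 0)
  zero_mem' _ _ := rfl
  smul_mem' c _ ha j hj := by
    exact (congrArg (c • ·) (ha j hj)).trans (smul_zero c)

/-- Multivector fields of degree `k`; there are none but `0` if `k` is negative. -/
noncomputable def mvDeg (n : ℕ) (M : Type*) [TopologicalSpace M]
    [ChartedSpace (EuclideanSpace ℝ (Fin n)) M] [IsManifold (𝓡 n) ∞ M] :
    ℤ → Submodule ℝ (Multivec n M)
  | Int.ofNat k => (⋀[SmoothFn n M]^k (VecField n M)).restrictScalars ℝ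
  | Int.negSucc _ => ⊥

theorem mul_comm_of_mem_mvDeg : ∀ {p q : ℤ} {x y : Multivec n M}, x ∈ mvDeg n M p →
    y ∈ mvDeg n M q → x * y = ((p * q).negOnePow : ℤ) • (y * x)
  | Int.negSucc _, _, x, y, hx, _ => by
    have hx : x = 0 := hx
    rw [hx, zero_mul, mul_zero, smul_zero]
  | Int.ofNat _, Int.negSucc _, x, y, _, hy => by
    have hy : y = 0 := hy
    rw [hy, zero_mul, mul_zero, smul_zero]
  | Int.ofNat p, Int.ofNat q, x, y, hx, hy => by
    have hsign : (((Int.ofNat p * Int.ofNat q).negOnePow : ℤˣ) : ℤ) = (-1) ^ (p * q) := by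
      have : Int.ofNat p * Int.ofNat q = ((p * q : ℕ) : ℤ) := by simp
      rw [this, Int.negOnePow_def, zpow_natCast]; simp
    rw [hsign]
    exact mul_comm_of_mem_pow hx hy

/-- `w` is a pre-`m`-symplectic form: a closed form of degree `m + 1`. -/
def IsPreSymplectic (m : ℕ) (w : Forms n M) : Prop :=
  w ∈ formDeg n M (m + 1) ∧ extDer w = 0

/-- A graded linear subspace of the graded vector space of multivector fields. -/
structure MVSub (n : ℕ) (M : Type*) [TopologicalSpace M]
    [ChartedSpace (EuclideanSpace ℝ (Fin n)) M] [IsManifold (𝓡 n) ∞ M] where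
  carrier : ℤ → Submodule ℝ (Multivec n M)
  le_mvDeg : ∀ k, carrier k ≤ mvDeg n M k

/-- All multivector fields. -/
noncomputable def allMV (n : ℕ) (M : Type*) [TopologicalSpace M]
    [ChartedSpace (EuclideanSpace ℝ (Fin n)) M] [IsManifold (𝓡 n) ∞ M] : MVSub n M :=
  ⟨mvDeg n M, fun _ ↦ le_rfl⟩

/-- The part of positive degree. -/
noncomputable def MVSub.pos (𝒱 : MVSub n M) : MVSub n M where
  carrier k := if 1 ≤ k then 𝒱.carrier k else ⊥
  le_mvDeg k := by
    split_ifs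
    · exact 𝒱.le_mvDeg k
    · exact bot_le

/-- The multisymplectic multivector fields: those with `L_x w = 0`. -/
noncomputable def symMV (w : Forms n M) : MVSub n M where
  carrier k := mvDeg n M k ⊓ LinearMap.ker (lieDer w)
  le_mvDeg _ := inf_le_left

theorem mem_symMV (w : Forms n M) (k : ℤ) (x : Multivec n M) :
    x ∈ (symMV w).carrier k ↔ x ∈ mvDeg n M k ∧ lieDer w x = 0 := Iff.rfl

/-- The Hamiltonian multivector fields: those `x` of degree `k` such that `ι_x w = d α` for a form
`α` of degree `m - k`. -/
noncomputable def hamMV (m : ℕ) (w : Forms n M) : MVSub n M where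
  carrier k := mvDeg n M k ⊓ ((formDeg n M (m - k)).map extDer).comap (contractMap w)
  le_mvDeg _ := inf_le_left

theorem mem_hamMV (m : ℕ) (w : Forms n M) (k : ℤ) (x : Multivec n M) :
    x ∈ (hamMV m w).carrier k ↔
      x ∈ mvDeg n M k ∧ ∃ α ∈ formDeg n M (m - k), contraction x w = extDer α := by
  refine and_congr_right fun _ ↦ ⟨?_, ?_⟩
  · rintro ⟨α, h1, h2⟩
    exact ⟨α, h1, h2.symm⟩
  · rintro ⟨α, h1, h2⟩
    exact ⟨α, h1, h2.symm⟩

/-- The brackets `ν_r = μ^{r-1} ∘ (ν ⊗ id^{r-2})` summed over unshuffles: `ν₁ = 0` and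
`ν_r(x₁, …, x_r) = ∑_σ ε(σ) ν(x_{σ(1)}, x_{σ(2)}) ∧ x_{σ(3)} ∧ ⋯ ∧ x_{σ(r)}`, the sum being over the
`(2, r - 2)`-unshuffles, for homogeneous `x i` of degrees `p i`. -/
noncomputable def nuBracket : (r : ℕ) → (Fin r → ℤ) → (Fin r → Multivec n M) → Multivec n M
  | 0, _, _ => 0
  | 1, _, _ => 0
  | r + 2, p, x => ∑ σ : Equiv.Perm (Fin (r + 2)) with IsUnshuffle 2 σ,
      koszulSign p σ • (nu (x (σ 0)) (x (σ 1)) *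
        (List.ofFn fun i : Fin r ↦ x (σ i.succ.succ)).prod)

namespace MVSub

/-- Closedness under the Schouten bracket. -/
def IsNuClosed (𝒱 : MVSub n M) : Prop :=
  ∀ (p q : ℤ) (x y : Multivec n M), x ∈ 𝒱.carrier p → y ∈ 𝒱.carrier q →
    nu x y ∈ 𝒱.carrier (p + q - 1)

/-- For homogeneous `x₁, …, x_r`, the element
`∑_σ ε(σ) ν(x_{σ(1)}, x_{σ(2)}) · x_{σ(3)} ⋯ x_{σ(r)}` of the graded symmetric algebra, the sum being
over the `(2, r - 2)`-unshuffles (and `0` if `r ≤ 1`). -/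
noncomputable def nuHatProd (𝒱 : MVSub n M) (h : 𝒱.IsNuClosed) :
    (r : ℕ) → (p : Fin r → ℤ) → ((i : Fin r) → 𝒱.carrier (p i)) → GSym 𝒱.carrier
  | 0, _, _ => 0
  | 1, _, _ => 0
  | r + 2, p, x => ∑ σ : Equiv.Perm (Fin (r + 2)) with IsUnshuffle 2 σ,
      koszulSign p σ •
        (GSym.inc 𝒱.carrier (p (σ 0) + p (σ 1) - 1)
          ⟨nu (x (σ 0) : Multivec n M) (x (σ 1)), h _ _ _ _ (x (σ 0)).2 (x (σ 1)).2⟩ *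
        (List.ofFn fun i : Fin r ↦ GSym.inc 𝒱.carrier (p (σ i.succ.succ)) (x (σ i.succ.succ))).prod)

/-- `D` is the codifferential `ν̂₂` of the graded symmetric algebra: the linear map with
`D(x₁ ⋯ x_r) = ∑_σ ε(σ) ν(x_{σ(1)}, x_{σ(2)}) · x_{σ(3)} ⋯ x_{σ(r)}` for homogeneous `x i`. As the
products of homogeneous elements span the algebra, there is at most one. -/
def IsNuHat (𝒱 : MVSub n M) (h : 𝒱.IsNuClosed)
    (D : GSym 𝒱.carrier →ₗ[ℝ] GSym 𝒱.carrier) : Prop :=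
  ∀ (r : ℕ) (p : Fin r → ℤ) (x : (i : Fin r) → 𝒱.carrier (p i)),
    D (GSym.prod 𝒱.carrier p x) = 𝒱.nuHatProd h r p x

end MVSub

namespace MVSub

/-- The shifted graded symmetric algebra: its part of degree `k` is the part of `S 𝒱` of total degree
`m + 1 - k`. -/
noncomputable def shiftedSym (m : ℕ) (𝒱 : MVSub n M) (k : ℤ) : Submodule ℝ (GSym 𝒱.carrier) :=
  GSym.deg 𝒱.carrier (m + 1 - k)

theorem graded_comm (𝒱 : MVSub n M) (p q : ℤ) (v : 𝒱.carrier p) (w : 𝒱.carrier q) :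
    (v : Multivec n M) * (w : Multivec n M) =
      ((p * q).negOnePow : ℤ) • ((w : Multivec n M) * (v : Multivec n M)) :=
  mul_comm_of_mem_mvDeg (𝒱.le_mvDeg p v.2) (𝒱.le_mvDeg q w.2)

/-- The multiplication `S 𝒱 → Λ`, `x₁ ⋯ x_r ↦ x₁ ∧ ⋯ ∧ x_r`. -/
noncomputable def wedge (𝒱 : MVSub n M) : GSym 𝒱.carrier →ₐ[ℝ] Multivec n M :=
  GSym.lift 𝒱.carrier 𝒱.graded_comm

theorem wedge_inc (𝒱 : MVSub n M) (k : ℤ) (v : 𝒱.carrier k) :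
    𝒱.wedge (GSym.inc 𝒱.carrier k v) = v :=
  GSym.lift_inc 𝒱.carrier 𝒱.graded_comm k v

/-- The map `w̃` on `S 𝒱`: `x₁ ⋯ x_r ↦ ι_{x₁ ∧ ⋯ ∧ x_r} w`. -/
noncomputable def pairing (𝒱 : MVSub n M) (w : Forms n M) : GSym 𝒱.carrier →ₗ[ℝ] Forms n M :=
  (contractMap w).comp 𝒱.wedge.toLinearMap

end MVSub

end Multivectors

end Multisymplectic

open Multisymplectic

set_option linter.unusedSimpArgs false

namespace Multisymplectic

/-! ### Cartan calculus of differential forms on a normed space. -/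

section FlatCartan

variable {E : Type*} [NormedAddCommGroup E] [NormedSpace ℝ E]

/-! Everything rests on Cartan's formula ι_{ν(x,y)} = [L_x, ι_y] (`contraction_nu`) and on the
recursion ν_r(x₁, …, x_r) = ν(x₁, x₂ ∧ ⋯ ∧ x_r) + (-1)^{|x₁|} x₁ ∧ ν_{r-1}(x₂, …, x_r), which comes
from asking whether x₁ is one of the two arguments that the unshuffle selects
(`sum_isUnshuffle_two`). If dω = 0 and L_{x_i} ω = 0 for all i, then Cartan's formula turns the
first term into L_{x₁} ι_{x₂ ∧ ⋯ ∧ x_r} ω, and induction on r gives ι_{ν_r(x₁, …, x_r)} ω = d ι_{x₁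
∧ ⋯ ∧ x_r} ω (`contraction_nuList`). So brackets of multisymplectic fields are Hamiltonian, while
Hamiltonian fields are multisymplectic because d² = 0; hence both spaces are closed under ν and
under all ν_r. The same equation makes ω̃ a cochain map, since the multiplication from the graded
symmetric algebra to the exterior algebra carries ν̂₂ to the brackets ν_r
(`MVSub.wedge_codiff_prodList`).

Cartan's formula is proved by splitting one vector field after the other off x. This reduces it to
the commutators of d, ι_X and functions, and these are checked in charts. Symmetry and Jacobi
identity of ν are purely algebraic and hold over any Lie-Rinehart ring: by the Leibniz rule the
Jacobiator is a derivation in its last argument, by symmetry in each one, so functions and vector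
fields suffice (`jacobiator_eq_zero`). Degrees are carried by the predicate `Homog`, whose induction
principle is exactly this splitting.

The map ν̂₂ is constructed from the recursion D(v s) = [v, s] + (-1)^{|v|} v D(s), where [v, -] is
the derivation that extends the bracket. The symmetry of ν makes D well defined, and the Jacobi
identity gives D² = 0 (`GSym.codiff_codiff`).

For the L∞ identities, the recursion applied to ν_i(h) followed by a block t yields ν(ν_i(h), ∏t) ±
ν_i(h) ∧ ν_{r-i}(t), so their left side is a sum over all splittings of the arguments into two
blocks. The second terms cancel when the blocks are exchanged (`splitSum_nuList_mul_nuList`). The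
first ones sum to zero by induction on the number of arguments, where the Jacobi identity enters
(`splitSum_nu_nuList`). -/

theorem hasFDerivAt_curryLeft {k : ℕ} {a : E → E [⋀^Fin (k + 1)]→L[ℝ] ℝ} {y : E}
    (ha : DifferentiableAt ℝ a y) : HasFDerivAt (fun z ↦ (a z).curryLeft)
      ((ContinuousAlternatingMap.curryLeftLI (𝕜 := ℝ) (E := E) (F := ℝ)
        (n := k)).toContinuousLinearMap.comp (fderiv ℝ a y)) y := by
  have h1 := (ContinuousAlternatingMap.curryLeftLI (𝕜 := ℝ) (E := E) (F := ℝ)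
    (n := k)).toContinuousLinearMap.hasFDerivAt (x := a y)
  have := HasFDerivAt.comp (𝕜 := ℝ) (E := E) (F := E [⋀^Fin (k + 1)]→L[ℝ] ℝ)
    (G := E →L[ℝ] E [⋀^Fin k]→L[ℝ] ℝ) (f := a) y h1 ha.hasFDerivAt
  exact this

/-- The derivative of `y ↦ a y (X y, -)`. -/
theorem fderiv_curryLeft_apply {k : ℕ} {a : E → E [⋀^Fin (k + 1)]→L[ℝ] ℝ} {X : E → E} {y : E}
    (ha : DifferentiableAt ℝ a y) (hX : DifferentiableAt ℝ X y) (u : E) (v : Fin k → E) :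
    fderiv ℝ (fun z ↦ (a z).curryLeft (X z)) y u v =
      fderiv ℝ a y u (Matrix.vecCons (X y) v) + a y (Matrix.vecCons (fderiv ℝ X y u) v) := by
  have h3 := ((hasFDerivAt_curryLeft ha).clm_apply hX.hasFDerivAt).fderiv
  rw [h3]
  simp only [add_apply, ContinuousLinearMap.comp_apply,
    ContinuousLinearMap.flip_apply, ContinuousAlternatingMap.add_apply]
  rw [add_comm]
  rfl

theorem differentiableAt_curryLeft {k : ℕ} {a : E → E [⋀^Fin (k + 1)]→L[ℝ] ℝ} {X : E → E} {y : E}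
    (ha : DifferentiableAt ℝ a y) (hX : DifferentiableAt ℝ X y) :
    DifferentiableAt ℝ (fun z ↦ (a z).curryLeft (X z)) y := by
  exact ((hasFDerivAt_curryLeft ha).clm_apply hX.hasFDerivAt).differentiableAt

/-- The coordinate expression of the Lie derivative of a form `a` along a vector field `X`, evaluated
at the vectors `v`. -/
noncomputable def flatLie {k : ℕ} (a : E → E [⋀^Fin k]→L[ℝ] ℝ) (X : E → E) (y : E)
    (v : Fin k → E) : ℝ :=
  fderiv ℝ a y (X y) v + ∑ i, a y (Function.update v i (fderiv ℝ X y (v i)))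

/-- A function has no contraction and no slots, so only ι_X d is left of d ι_X + ι_X d. -/
theorem flatLie_zero (a : E → E [⋀^Fin 0]→L[ℝ] ℝ) (X : E → E) {y : E}
    (ha : DifferentiableAt ℝ a y) (v : Fin 0 → E) :
    (extDeriv a y).curryLeft (X y) v = flatLie a X y v := by
  rw [ContinuousAlternatingMap.curryLeft_apply_apply, extDeriv_apply ha, flatLie]
  simp only [fderiv_continuousAlternatingMap_apply_const_apply ha]
  simp

/-- Cartan's magic formula. The terms that differentiate `a` along some `v i` occur in d ι_X and in
ι_X d with opposite signs; what survives is the derivative of `a` along X and the derivatives of X.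
-/
theorem flatLie_succ {k : ℕ} {a : E → E [⋀^Fin (k + 1)]→L[ℝ] ℝ} {X : E → E} {y : E}
    (ha : DifferentiableAt ℝ a y) (hX : DifferentiableAt ℝ X y) (v : Fin (k + 1) → E) :
    extDeriv (fun z ↦ (a z).curryLeft (X z)) y v + (extDeriv a y).curryLeft (X y) v =
      flatLie a X y v := by
  rw [ContinuousAlternatingMap.curryLeft_apply_apply, extDeriv_apply ha,
    extDeriv_apply (differentiableAt_curryLeft ha hX), add_comm, Fin.sum_univ_succ, flatLie]
  simp only [fderiv_continuousAlternatingMap_apply_const_apply ha,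
    fderiv_continuousAlternatingMap_apply_const_apply (differentiableAt_curryLeft ha hX),
    fderiv_curryLeft_apply ha hX, smul_add, Finset.sum_add_distrib]
  -- Moving the leading vector into slot `i` costs the sign (-1)^i.
  have h1 : ∀ i : Fin (k + 1), (-1 : ℤ) ^ (i : ℕ) •
      a y (Matrix.vecCons (fderiv ℝ X y (v i)) (i.removeNth v)) =
      a y (Function.update v i (fderiv ℝ X y (v i))) := fun i ↦ by
    rw [← ContinuousAlternatingMap.map_insertNth, Fin.insertNth_removeNth]
  -- With X in slot 0 the index of `v i` is raised by one; this is the sign behind the cancellation.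
  have h2 : ∀ i : Fin (k + 1), (-1 : ℤ) ^ (i.succ : ℕ) •
      fderiv ℝ a y ((Matrix.vecCons (X y) v : Fin (k + 2) → E) i.succ)
        (i.succ.removeNth (Matrix.vecCons (X y) v)) =
      - ((-1 : ℤ) ^ (i : ℕ) • fderiv ℝ a y (v i) (Matrix.vecCons (X y) (i.removeNth v))) :=
    fun i ↦ by
      rw [Fin.val_succ, pow_succ, mul_neg_one, neg_smul]
      congr 3
      funext j
      refine Fin.cases ?_ (fun j ↦ ?_) j
      · rfl
      · simp [Fin.removeNth]
  have h3 : (Fin.removeNth 0 (Matrix.vecCons (X y) v) : Fin (k + 1) → E) = v := by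
    funext j; simp [Fin.removeNth]
  simp only [h1, h2, Finset.sum_neg_distrib, h3]
  simp

theorem flatLie_smul {k : ℕ} {a : E → E [⋀^Fin k]→L[ℝ] ℝ} {f : E → ℝ} {X : E → E} {y : E}
    (ha : DifferentiableAt ℝ a y) (hf : DifferentiableAt ℝ f y) (v : Fin k → E) :
    flatLie (fun z ↦ f z • a z) X y v = f y * flatLie a X y v + fderiv ℝ f y (X y) * a y v := by
  rw [flatLie, flatLie, fderiv_fun_smul hf ha]
  simp [mul_add, Finset.mul_sum]
  ring

/-- The coordinate form of [L_X, ι_Y] = ι_{[X, Y]}. Differentiating the contraction produces the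
derivative of Y along X; the slot of Y on the right side produces the derivative of X along Y, which
the left side lacks. Their difference is the bracket. -/
theorem flatLie_curryLeft {k : ℕ} {a : E → E [⋀^Fin (k + 1)]→L[ℝ] ℝ} {X Y : E → E} {y : E}
    (ha : DifferentiableAt ℝ a y) (hY : DifferentiableAt ℝ Y y) (v : Fin k → E) :
    flatLie (fun z ↦ (a z).curryLeft (Y z)) X y v =
      flatLie a X y (Matrix.vecCons (Y y) v) +
        a y (Matrix.vecCons (VectorField.lieBracket ℝ X Y y) v) := by
  rw [flatLie, flatLie, fderiv_curryLeft_apply ha hY, Fin.sum_univ_succ]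
  have h0 : Function.update (Matrix.vecCons (Y y) v : Fin (k + 1) → E) 0
      (fderiv ℝ X y ((Matrix.vecCons (Y y) v : Fin (k + 1) → E) 0)) =
      Matrix.vecCons (fderiv ℝ X y (Y y)) v := by
    funext j
    refine Fin.cases ?_ (fun j ↦ ?_) j <;> simp
  have h1 : ∀ i : Fin k, Function.update (Matrix.vecCons (Y y) v : Fin (k + 1) → E) i.succ
      (fderiv ℝ X y ((Matrix.vecCons (Y y) v : Fin (k + 1) → E) i.succ)) =
      Matrix.vecCons (Y y) (Function.update v i (fderiv ℝ X y (v i))) := fun i ↦ by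
    funext j
    refine Fin.cases ?_ (fun j ↦ ?_) j
    · simp [Function.update_of_ne (Fin.succ_ne_zero i).symm]
    · by_cases hj : j = i
      · subst hj; simp
      · simp [Function.update_of_ne hj, Function.update_of_ne ((Fin.succ_injective _).ne hj)]
  have h2 : a y (Matrix.vecCons (VectorField.lieBracket ℝ X Y y) v) =
      a y (Matrix.vecCons (fderiv ℝ Y y (X y)) v) - a y (Matrix.vecCons (fderiv ℝ X y (Y y)) v) := by
    rw [VectorField.lieBracket]
    exact DFunLike.congr_fun ((a y).curryLeft.map_sub _ _) v
  rw [h2, h0]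
  simp only [h1, ContinuousAlternatingMap.curryLeft_apply_apply]
  ring

end FlatCartan


/-! ### Transfer of the Cartan calculus to the manifold by charts. -/

section ManifoldCartan

variable {n : ℕ} {M : Type*} [TopologicalSpace M] [ChartedSpace (EuclideanSpace ℝ (Fin n)) M]
  [IsManifold (𝓡 n) ∞ M]

open RoughForm

/-- A form at `x` is determined by its representative in the preferred chart at `x`. -/
theorem RoughForm.apply_eq_inChart {k : ℕ} (α : RoughForm n M k) (x : M)
    (v : Fin k → TangentSpace (𝓡 n) x) :
    α x v = α.inChart x (extChartAt (𝓡 n) x x) fun i ↦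
      mfderiv (𝓡 n) 𝓘(ℝ, EuclideanSpace ℝ (Fin n)) (extChartAt (𝓡 n) x) x (v i) := by
  have hx := mem_extChartAt_source (I := 𝓡 n) x
  have hy := (extChartAt (𝓡 n) x).map_source hx
  have hs := (extChartAt (𝓡 n) x).left_inv hx
  -- The differentials of the chart and of its inverse cancel; the base point at which this is known
  -- is `(extChartAt (𝓡 n) x).symm (extChartAt (𝓡 n) x x)`, which equals `x` only propositionally.
  have key : ∀ p : M, p = x → ∀ w : EuclideanSpace ℝ (Fin n),
      (mfderiv 𝓘(ℝ, EuclideanSpace ℝ (Fin n)) (𝓡 n) (extChartAt (𝓡 n) x).symm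
        (extChartAt (𝓡 n) x x)) (mfderiv (𝓡 n) 𝓘(ℝ, EuclideanSpace ℝ (Fin n)) (extChartAt (𝓡 n) x)
          p w) = (w : EuclideanSpace ℝ (Fin n)) := by
    rintro p rfl w
    have := DFunLike.congr_fun (mfderiv_symm_comp hy) w
    rw [hs] at this
    exact this
  refine Eq.trans ?_ (inChart_apply α x _ _).symm
  refine (apply_congr α hs.symm _).trans (congrArg (α _) (funext fun i ↦ ?_))
  exact (key x rfl (v i)).symm

/-- Equality is tested only at the centre of each preferred chart. This is how coordinate identities
become identities of forms on M. -/
theorem SmoothForm.ext_inChart {k : ℕ} {α β : SmoothForm n M k}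
    (h : ∀ (x : M) (v : Fin k → EuclideanSpace ℝ (Fin n)),
      RoughForm.inChart α.1 x (extChartAt (𝓡 n) x x) v =
        RoughForm.inChart β.1 x (extChartAt (𝓡 n) x x) v) : α = β :=
  SmoothForm.ext' fun x ↦ ContinuousAlternatingMap.ext fun v ↦ by
    rw [apply_eq_inChart, apply_eq_inChart β.1]
    exact h x _

theorem vfInChart_differentiableAt (X : VecField n M) {x₀ : M} {y : EuclideanSpace ℝ (Fin n)}
    (hy : y ∈ (extChartAt (𝓡 n) x₀).target) :
    DifferentiableAt ℝ (vfInChart (fun x ↦ X x) x₀) y :=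
  ((vfInChart_contDiffOn X.contMDiff x₀).contDiffAt
    ((isOpen_extChartAt_target x₀).mem_nhds hy)).differentiableAt (by simp)

/-- Equality near `y` and not only at `y`, because both sides get differentiated. -/
theorem contract_inChart_eventuallyEq {k : ℕ} (X : VecField n M)
    (α : RoughForm n M (k + 1)) {x₀ : M} {y : EuclideanSpace ℝ (Fin n)}
    (hy : y ∈ (extChartAt (𝓡 n) x₀).target) :
    (contract (fun x ↦ X x) α).inChart x₀ =ᶠ[nhds y]
      fun z ↦ (α.inChart x₀ z).curryLeft (vfInChart (fun x ↦ X x) x₀ z) := by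
  filter_upwards [(isOpen_extChartAt_target (I := 𝓡 n) x₀).mem_nhds hy] with z hz
  exact contract_inChart _ α hz

/-- The Lie derivative along a vector field, `L_X = d ι_X + ι_X d`. -/
noncomputable def lieForm (X : VecField n M) : Forms n M →ₗ[ℝ] Forms n M :=
  extDer.comp ((contractVec X).restrictScalars ℝ) + ((contractVec X).restrictScalars ℝ).comp extDer

theorem lieForm_apply (X : VecField n M) (α : Forms n M) :
    lieForm X α = extDer (contractVec X α) + contractVec X (extDer α) := rfl

/-- `extD_inChart` and `contract_inChart` compute d and ι_X in one and the same chart, so that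
`flatLie_zero` and `flatLie_succ` apply. -/
theorem lieForm_inChart (X : VecField n M) (α : Forms n M) (k : ℕ) {x : M}
    {y : EuclideanSpace ℝ (Fin n)} (hy : y ∈ (extChartAt (𝓡 n) x).target)
    (v : Fin k → EuclideanSpace ℝ (Fin n)) :
    RoughForm.inChart (lieForm X α k).1 x y v =
      flatLie (RoughForm.inChart (α k).1 x) (vfInChart (fun x ↦ X x) x) y v := by
  have hd := (α k).smooth.differentiableAt hy
  have h2 : RoughForm.inChart (contractVec X (extDer α) k).1 x y v =
      (extDeriv (RoughForm.inChart (α k).1 x) y).curryLeft (vfInChart (fun x ↦ X x) x y) v := by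
    refine (DFunLike.congr_fun (contract_inChart (fun x ↦ X x) (extD (α k).1) hy) v).trans ?_
    rw [extD_inChart (α k).smooth hy]
  cases k with
  | zero =>
    rw [← flatLie_zero _ _ hd, ← h2]
    -- The component of d ι_X in degree 0 is zero by the definition of `extDer`.
    have : lieForm X α 0 = contractVec X (extDer α) 0 := zero_add _
    rw [this]
  | succ k =>
    rw [← flatLie_succ hd (vfInChart_differentiableAt X hy), ← h2]
    have h1 : RoughForm.inChart (extDer (contractVec X α) (k + 1)).1 x y v =
        extDeriv (fun z ↦ (RoughForm.inChart (α (k + 1)).1 x z).curryLeft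
          (vfInChart (fun x ↦ X x) x z)) y v := by
      refine (DFunLike.congr_fun (extD_inChart (contractVec X α k).smooth hy) v).trans ?_
      rw [(contract_inChart_eventuallyEq X (α (k + 1)).1 hy).extDeriv_eq.symm]
      rfl
    rw [← h1]
    rfl

/-- Components 0 and 1 vanish because `extDer` has component 0 equal to zero. In higher degrees both
derivatives are taken in the same chart, where the second derivative is symmetric. -/
theorem extDer_extDer (α : Forms n M) : extDer (extDer α) = 0 := by
  funext k
  match k with
  | 0 => rfl
  | 1 =>
    exact map_zero SmoothForm.d
  | k + 2 =>
    refine SmoothForm.ext_inChart fun x v ↦ ?_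
    have hy := mem_extChartAt_target (I := 𝓡 n) x
    have h := (α k).smooth
    have h1 : RoughForm.inChart (extDer (extDer α) (k + 2)).1 x (extChartAt (𝓡 n) x x) =
        extDeriv (RoughForm.inChart (extD (α k).1) x) (extChartAt (𝓡 n) x x) :=
      extD_inChart h.extD hy
    have h2 : RoughForm.inChart (extD (α k).1) x =ᶠ[nhds (extChartAt (𝓡 n) x x)]
        extDeriv (RoughForm.inChart (α k).1 x) := by
      filter_upwards [(isOpen_extChartAt_target (I := 𝓡 n) x).mem_nhds hy] with z hz
      exact extD_inChart h hz
    rw [h1, h2.extDeriv_eq, extDeriv_extDeriv_apply (r := ∞) ((h x).contDiffAt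
      ((isOpen_extChartAt_target x).mem_nhds hy)) (by simp; exact WithTop.coe_le_coe.2 le_top)]
    rfl

theorem fderiv_fn_inChart (f : SmoothFn n M) (X : VecField n M) (x : M) :
    fderiv ℝ (fun z ↦ f ((extChartAt (𝓡 n) x).symm z)) (extChartAt (𝓡 n) x x)
      (vfInChart (fun x ↦ X x) x (extChartAt (𝓡 n) x x)) =
      ⁅X, f⁆ ((extChartAt (𝓡 n) x).symm (extChartAt (𝓡 n) x x)) := by
  have hy := mem_extChartAt_target (I := 𝓡 n) x
  have h := mfderiv_comp (I' := 𝓡 n) (extChartAt (𝓡 n) x x) (g := f) (I'' := 𝓘(ℝ, ℝ))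
    (f := (extChartAt (𝓡 n) x).symm) (VecField.mdiffAt' f _) (mdiffAt_symm hy)
  rw [← mfderiv_eq_fderiv]
  refine (DFunLike.congr_fun h _).trans ?_
  rw [VecField.lie_fn_apply]
  exact congrArg (mfderiv (𝓡 n) 𝓘(ℝ, ℝ) f _) (DFunLike.congr_fun (mfderiv_symm_comp hy) (X _))

theorem lieForm_smul (X : VecField n M) (f : SmoothFn n M) (α : Forms n M) :
    lieForm X (f • α) = f • lieForm X α + ⁅X, f⁆ • α := by
  funext k
  refine SmoothForm.ext_inChart fun x v ↦ ?_
  have hy := mem_extChartAt_target (I := 𝓡 n) x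
  rw [lieForm_inChart X _ k hy]
  have hf : DifferentiableAt ℝ (fun z ↦ f ((extChartAt (𝓡 n) x).symm z)) (extChartAt (𝓡 n) x x) := by
    have := ((VecField.mdiffAt' f _).comp _ (mdiffAt_symm hy)).differentiableAt
    exact this
  refine (flatLie_smul ((α k).smooth.differentiableAt hy) hf v).trans ?_
  rw [← lieForm_inChart X _ k hy, fderiv_fn_inChart]
  rfl

/-- `mlieBracket` is the bracket of the representatives in the chart at `x`, transported back by the
inverse of the differential of the chart; applying that differential undoes the transport. -/
theorem lieBracket_inChart (X Y : VecField n M) (x : M) :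
    vfInChart (fun z ↦ ⁅X, Y⁆ z) x (extChartAt (𝓡 n) x x) =
      VectorField.lieBracket ℝ (vfInChart (fun z ↦ X z) x) (vfInChart (fun z ↦ Y z) x)
        (extChartAt (𝓡 n) x x) := by
  have hy := mem_extChartAt_target (I := 𝓡 n) x
  -- The pullback by the inverse chart uses the inverse of its differential, and this is the
  -- differential of the chart.
  have hinv : ∀ (Z : VecField n M), VectorField.mpullbackWithin 𝓘(ℝ, EuclideanSpace ℝ (Fin n)) (𝓡 n)
      (extChartAt (𝓡 n) x).symm (fun y ↦ Z y) (Set.range (𝓡 n)) =ᶠ[nhds (extChartAt (𝓡 n) x x)]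
      vfInChart (fun z ↦ Z z) x := by
    intro Z
    filter_upwards [(isOpen_extChartAt_target (I := 𝓡 n) x).mem_nhds hy] with z hz
    rw [VectorField.mpullbackWithin_apply, ModelWithCorners.range_eq_univ, mfderivWithin_univ]
    rw [ContinuousLinearMap.inverse_eq (mfderiv_symm_comp hz) (mfderiv_comp_symm hz)]
    rfl
  have hx := mem_extChartAt_source (I := 𝓡 n) x
  have hs := (extChartAt (𝓡 n) x).left_inv hx
  have h0 : ∀ p : M, p = x → (mfderiv (𝓡 n) 𝓘(ℝ, EuclideanSpace ℝ (Fin n)) (extChartAt (𝓡 n) x)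
      p (⁅X, Y⁆ p) : EuclideanSpace ℝ (Fin n)) =
      mfderiv (𝓡 n) 𝓘(ℝ, EuclideanSpace ℝ (Fin n)) (extChartAt (𝓡 n) x) x (⁅X, Y⁆ x) := by
    rintro p rfl; rfl
  refine (h0 _ hs).trans ?_
  rw [VecField.lie_apply, ← VectorField.mlieBracketWithin_univ,
    VectorField.mlieBracketWithin_apply]
  have h1 := (isInvertible_mfderiv_extChartAt (I := 𝓡 n) hx).self_apply_inverse
  refine (h1 _).trans ?_
  have h2 : ∀ (V W V' W' : EuclideanSpace ℝ (Fin n) → EuclideanSpace ℝ (Fin n))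
      (s : Set (EuclideanSpace ℝ (Fin n))) (y : EuclideanSpace ℝ (Fin n)), s = Set.univ →
      V =ᶠ[nhds y] V' → W =ᶠ[nhds y] W' →
      VectorField.lieBracketWithin ℝ V W s y = VectorField.lieBracket ℝ V' W' y := by
    rintro V W V' W' s y rfl hV hW
    rw [VectorField.lieBracketWithin_univ]
    exact hV.lieBracket_vectorField_eq hW
  exact h2 _ _ _ _ _ _ (by simp) (hinv X) (hinv Y)

/-- The global form of `flatLie_curryLeft`; with `lieForm_smul` it is the analytic input to Cartan's
formula for multivector fields. -/
theorem lieForm_contractVec (X Y : VecField n M) (α : Forms n M) :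
    lieForm X (contractVec Y α) = contractVec Y (lieForm X α) + contractVec ⁅X, Y⁆ α := by
  funext k
  refine SmoothForm.ext_inChart fun x v ↦ ?_
  have hy := mem_extChartAt_target (I := 𝓡 n) x
  have hd := (α (k + 1)).smooth.differentiableAt hy
  rw [lieForm_inChart X _ k hy]
  have h1 : flatLie (RoughForm.inChart (contractVec Y α k).1 x) (vfInChart (fun z ↦ X z) x)
      (extChartAt (𝓡 n) x x) v = flatLie (fun z ↦ (RoughForm.inChart (α (k + 1)).1 x z).curryLeft
          (vfInChart (fun x ↦ Y x) x z)) (vfInChart (fun z ↦ X z) x)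
      (extChartAt (𝓡 n) x x) v := by
    have h := contract_inChart_eventuallyEq Y (α (k + 1)).1 hy
    have h' : RoughForm.inChart (contractVec Y α k).1 x = RoughForm.inChart
      (RoughForm.contract (fun x ↦ Y x) (α (k + 1)).1) x := rfl
    rw [flatLie, flatLie, h', h.fderiv_eq, h.eq_of_nhds]
  rw [h1, flatLie_curryLeft hd (vfInChart_differentiableAt Y hy), ← lieForm_inChart X _ _ hy,
    ← lieBracket_inChart]
  refine congrArg₂ (· + ·) ?_ ?_
  · exact (DFunLike.congr_fun (contract_inChart (fun x ↦ Y x) (lieForm X α (k + 1)).1 hy) v).symm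
  · exact (DFunLike.congr_fun
      (contract_inChart (fun x ↦ ⁅X, Y⁆ x) (α (k + 1)).1 hy) v).symm

end ManifoldCartan


/-! ### Signs. -/

section SignFunction

/-- The sign `(-1)^k`. -/
def sg (k : ℤ) : ℤ := if Even k then 1 else -1

/-- Links the sign of the definitions to `sg`, which is phrased with `Even` so that sign identities
reduce to case distinctions on parities. -/
theorem coe_negOnePow (k : ℤ) : (k.negOnePow : ℤ) = sg k := by
  unfold sg
  split_ifs with h
  · rw [Int.negOnePow_even k h]; rfl
  · rw [Int.negOnePow_odd k (Int.not_even_iff_odd.1 h)]; rfl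

theorem sg_zero : sg 0 = 1 := by simp [sg]

theorem sg_one : sg 1 = -1 := by simp [sg]

theorem sg_mul_self (k : ℤ) : sg k * sg k = 1 := by unfold sg; split_ifs <;> rfl

theorem sg_add (k l : ℤ) : sg (k + l) = sg k * sg l := by
  by_cases hk : Even k <;> by_cases hl : Even l <;>
    simp [sg, Int.even_add, Int.even_sub, Int.even_mul,
      -Int.not_even_iff_odd, ← Int.not_even_iff_odd, hk, hl]

end SignFunction

/-! ### Homogeneous elements of the exterior algebra and graded commutativity. -/

section Homogeneous

open ExteriorAlgebra

variable {A L : Type*} [CommRing A] [LieRing L] [Module A L]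

/-- `x` is a homogeneous element of degree `p` of the exterior algebra. -/
inductive Homog : ℤ → ExteriorAlgebra A L → Prop
  | algebraMap (a : A) : Homog 0 (algebraMap A _ a)
  | zero (p : ℤ) : Homog p 0
  | add {p : ℤ} {x y : ExteriorAlgebra A L} : Homog p x → Homog p y → Homog p (x + y)
  | ι_mul (X : L) {p : ℤ} {x : ExteriorAlgebra A L} : Homog p x → Homog (p + 1) (ι A X * x)

theorem Homog.one : Homog (A := A) (L := L) 0 1 := by
  simpa using Homog.algebraMap (L := L) (1 : A)

theorem Homog.ι (X : L) : Homog (A := A) 1 (ι A X) := by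
  simpa using Homog.ι_mul X Homog.one

theorem Homog.smul {p : ℤ} {x : ExteriorAlgebra A L} (a : A) (hx : Homog p x) :
    Homog p (a • x) := by
  induction hx with
  | algebraMap b => rw [Algebra.smul_def, ← map_mul]; exact .algebraMap _
  | zero p => rw [smul_zero]; exact .zero p
  | add _ _ h1 h2 => rw [smul_add]; exact h1.add h2
  | ι_mul X _ h => rw [← mul_smul_comm]; exact h.ι_mul X

theorem Homog.mul {p q : ℤ} {x y : ExteriorAlgebra A L} (hx : Homog p x) (hy : Homog q y) :
    Homog (p + q) (x * y) := by
  induction hx with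
  | algebraMap a => rw [zero_add, ← Algebra.smul_def]; exact hy.smul a
  | zero p => rw [zero_mul]; exact .zero _
  | add _ _ h1 h2 => rw [add_mul]; exact h1.add h2
  | ι_mul X _ h => rw [mul_assoc, add_right_comm]; exact h.ι_mul X

theorem Homog.neg {p : ℤ} {x : ExteriorAlgebra A L} (hx : Homog p x) : Homog p (-x) := by
  simpa using hx.smul (-1)

theorem Homog.sub {p : ℤ} {x y : ExteriorAlgebra A L} (hx : Homog p x) (hy : Homog p y) :
    Homog p (x - y) := by
  rw [sub_eq_add_neg]; exact hx.add hy.neg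

theorem Homog.ι_comm {q : ℤ} {y : ExteriorAlgebra A L} (hy : Homog q y) (X : L) :
    y * ExteriorAlgebra.ι A X = sg q • (ExteriorAlgebra.ι A X * y) := by
  induction hy with
  | algebraMap a => rw [sg_zero, one_smul]; exact Algebra.commutes a _
  | zero p => simp
  | add _ _ h1 h2 => rw [add_mul, h1, h2, mul_add, smul_add]
  | ι_mul Y _ h =>
    have := eq_neg_of_add_eq_zero_left (ι_add_mul_swap (R := A) Y X)
    rw [mul_assoc, h, mul_smul_comm, ← mul_assoc, this, sg_add, sg_one, mul_neg_one, neg_smul,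
      neg_mul, smul_neg, mul_assoc]

theorem Homog.comm {p q : ℤ} {x y : ExteriorAlgebra A L} (hx : Homog p x) (hy : Homog q y) :
    x * y = sg (p * q) • (y * x) := by
  induction hx with
  | algebraMap a => rw [zero_mul, sg_zero, one_smul]; exact Algebra.commutes a _
  | zero p => simp
  | add _ _ h1 h2 => rw [add_mul, h1, h2, mul_add, smul_add]
  | ι_mul X _ h =>
    rw [mul_assoc, h, mul_smul_comm, ← mul_assoc, ← mul_assoc, hy.ι_comm X, smul_mul_assoc,
      smul_smul, add_mul, sg_add, one_mul, mul_assoc, mul_assoc, sg_mul_self, mul_one]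

theorem Homog.involute {p : ℤ} {x : ExteriorAlgebra A L} (hx : Homog p x) :
    CliffordAlgebra.involute x = sg p • x := by
  induction hx with
  | algebraMap a => rw [sg_zero, one_smul]; exact AlgHom.commutes _ a
  | zero p => simp
  | add _ _ h1 h2 => rw [map_add, h1, h2, smul_add]
  | ι_mul X _ h =>
    rw [map_mul, h, sg_add, sg_one, mul_neg_one, neg_smul, mul_smul_comm]
    refine (congrArg (fun t ↦ _ • (t * _)) (CliffordAlgebra.involute_ι _)).trans ?_
    rw [neg_mul, smul_neg]

end Homogeneous

/-! ### Leibniz rule, symmetry and Jacobi identity of the Schouten bracket. -/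

section SchoutenIdentities

open ExteriorAlgebra

variable {A L : Type*} [CommRing A] [LieRing L] [Module A L] [LieRingModule L A]
  [LieRinehartRing A L]

theorem lieMv_zero (X : L) : lieMv X (0 : ExteriorAlgebra A L) = 0 := map_zero (lieMvHom X)

theorem lieMv_mul (X : L) (y z : ExteriorAlgebra A L) :
    lieMv X (y * z) = lieMv X y * z + y * lieMv X z := by
  induction y using CliffordAlgebra.left_induction with
  | algebraMap a =>
    refine (congrArg _ (Algebra.smul_def a z).symm).trans ?_
    refine (lieMv_smul X a z).trans ?_
    refine Eq.trans ?_ (congrArg (fun t ↦ t * z + _) (lieMv_algebraMap X a).symm)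
    rw [add_comm, Algebra.smul_def, Algebra.smul_def]
  | add a b ha hb => rw [add_mul, lieMv_add, ha, hb, lieMv_add]; noncomm_ring
  | ι_mul a Y ha =>
    refine (congrArg _ (mul_assoc _ _ _)).trans ?_
    refine (lieMv_ι_mul X Y (a * z)).trans ?_
    refine Eq.trans ?_ (congrArg (fun t ↦ t * z + _) (lieMv_ι_mul X Y a).symm)
    rw [ha]
    change _ = _ + ExteriorAlgebra.ι A Y * a * _
    noncomm_ring

theorem Homog.lieMv {p : ℤ} {x : ExteriorAlgebra A L} (hx : Homog p x) (X : L) :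
    Homog p (lieMv X x) := by
  induction hx with
  | algebraMap a => rw [lieMv_algebraMap]; exact .algebraMap _
  | zero p => rw [lieMv_zero]; exact .zero p
  | add _ _ h1 h2 => rw [lieMv_add]; exact h1.add h2
  | ι_mul Y h0 h => rw [lieMv_ι_mul]; exact (h0.ι_mul _).add (h.ι_mul _)

theorem Homog.fnBracket {p : ℤ} {x : ExteriorAlgebra A L} (hx : Homog p x) (a : A) :
    Homog (p - 1) (fnBracket a x) := by
  induction hx with
  | algebraMap b => rw [fnBracket_algebraMap]; exact .zero _
  | zero p => rw [map_zero]; exact .zero _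
  | add _ _ h1 h2 => rw [map_add]; exact h1.add h2
  | @ι_mul Y q z h0 h =>
    rw [fnBracket_ι_mul, add_sub_cancel_right]
    refine (h0.smul _).sub ?_
    have := h.ι_mul Y
    rwa [sub_add_cancel] at this

theorem fnBracket_mul_right (a : A) {q : ℤ} {y : ExteriorAlgebra A L} (hy : Homog q y)
    (z : ExteriorAlgebra A L) :
    fnBracket a (y * z) = fnBracket a y * z + sg q • (y * fnBracket a z) := by
  induction hy with
  | algebraMap b =>
    rw [fnBracket_algebraMap, zero_mul, zero_add, sg_zero, one_smul, ← Algebra.smul_def,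
      map_smul, Algebra.smul_def]
  | zero p => simp
  | add _ _ h1 h2 => rw [add_mul, map_add, h1, h2, map_add, add_mul, add_mul, smul_add]; abel
  | ι_mul Y _ h =>
    rw [mul_assoc, fnBracket_ι_mul, h, fnBracket_ι_mul, sg_add, sg_one]
    simp only [mul_add, sub_mul, smul_mul_assoc, mul_smul_comm, mul_assoc, mul_neg_one, neg_smul]
    abel

theorem nu_zero_left (z : ExteriorAlgebra A L) : nu 0 z = 0 := by
  have := nu_add_left 0 0 z
  rwa [add_zero, left_eq_add] at this

theorem nu_zero_right (z : ExteriorAlgebra A L) : nu z 0 = 0 := by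
  have := nu_add_right z 0 0
  rwa [add_zero, left_eq_add] at this

theorem nu_zsmul_left (k : ℤ) (x z : ExteriorAlgebra A L) : nu (k • x) z = k • nu x z :=
  map_zsmul (AddMonoidHom.mk' (fun x ↦ nu x z) fun x y ↦ nu_add_left x y z) k x

theorem nu_zsmul_right (k : ℤ) (x z : ExteriorAlgebra A L) : nu x (k • z) = k • nu x z :=
  map_zsmul (AddMonoidHom.mk' (fun z ↦ nu x z) fun y z ↦ nu_add_right x y z) k z

/-- The Schouten bracket in its symmetric form has degree `-1`. -/
theorem Homog.nu {p q : ℤ} {x y : ExteriorAlgebra A L} (hx : Homog p x) (hy : Homog q y) :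
    Homog (p + q - 1) (nu x y) := by
  induction hx with
  | algebraMap a => rw [nu_algebraMap, zero_add]; exact hy.fnBracket a
  | zero p => rw [nu_zero_left]; exact .zero _
  | add _ _ h1 h2 => rw [nu_add_left]; exact h1.add h2
  | @ι_mul X r u hu h =>
    rw [nu_ι_mul, show r + 1 + q - 1 = r + q by ring]
    refine (hu.mul (hy.lieMv X)).sub ?_
    have := h.ι_mul X
    rwa [sub_add_cancel] at this

/-- The Leibniz rule in the second argument. -/
theorem nu_mul_right {p q : ℤ} {x y : ExteriorAlgebra A L} (hx : Homog p x) (hy : Homog q y)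
    (z : ExteriorAlgebra A L) :
    nu x (y * z) = nu x y * z + sg ((p - 1) * q) • (y * nu x z) := by
  induction hx with
  | algebraMap a =>
    have h : sg ((0 - 1) * q) = sg q := by
      by_cases hq : Even q <;>
        simp [sg, Int.even_add, Int.even_sub, Int.even_mul,
          -Int.not_even_iff_odd, ← Int.not_even_iff_odd, hq]
    rw [nu_algebraMap, nu_algebraMap, nu_algebraMap, fnBracket_mul_right a hy, h]
  | zero p => simp [nu_zero_left]
  | add _ _ h1 h2 =>
    rw [nu_add_left, h1, h2, nu_add_left, nu_add_left, add_mul, mul_add, smul_add]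
    abel
  | @ι_mul X r u hu h =>
    have h1 := hy.ι_comm X
    have h2 : ι A X * y = sg q • (y * ι A X) := by rw [h1, smul_smul, sg_mul_self, one_smul]
    have h3 := hu.comm hy
    have e1 : sg ((r + 1 - 1) * q) = sg (r * q) := by rw [add_sub_cancel_right]
    have e2 : sg ((r - 1) * q) * sg q = sg (r * q) := by
      rw [← sg_add]; ring_nf
    rw [nu_ι_mul, nu_ι_mul, nu_ι_mul, h, lieMv_mul, e1]
    generalize sg ((r - 1) * q) = s at e2 ⊢
    simp only [mul_add, mul_sub, sub_mul, smul_sub, mul_smul_comm, ← mul_assoc, h2, h3,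
      smul_mul_assoc, smul_smul, e2]
    abel

/-- Symmetry when one argument is a vector field. It comes before `nu_symm`, whose induction step
applies the Leibniz rule to ν(y, X ∧ u) and meets this term. -/
theorem nu_ι_right {q : ℤ} {y : ExteriorAlgebra A L} (hy : Homog q y) (X : L) :
    nu y (ι A X) = sg q • lieMv X y := by
  induction hy with
  | algebraMap a =>
    have h := fnBracket_ι_mul a X 1
    have h2 := fnBracket_algebraMap (L := L) a 1
    rw [map_one] at h2
    rw [mul_one, h2, mul_zero, sub_zero] at h
    rw [nu_algebraMap, h, lieMv_algebraMap, sg_zero, one_smul, Algebra.smul_def, mul_one]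
  | zero p => simp [nu_zero_left, lieMv_zero]
  | add _ _ h1 h2 => rw [nu_add_left, h1, h2, lieMv_add, smul_add]
  | @ι_mul Y r u hu h =>
    have h1 : lieMv Y (ι A X) = - ι A ⁅X, Y⁆ := by
      rw [← nu_ι, nu_ι_ι, ← lie_skew, map_neg]
    rw [nu_ι_mul, h1, h, lieMv_ι_mul, mul_neg, hu.ι_comm, sg_add, sg_one, mul_neg_one, neg_smul,
      smul_add, mul_smul_comm]
    abel

theorem nu_fn_right {p : ℤ} {x : ExteriorAlgebra A L} (hx : Homog p x) (a : A) :
    nu x (algebraMap A _ a) = fnBracket a x := by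
  induction hx with
  | algebraMap b => rw [nu_algebraMap, fnBracket_algebraMap, fnBracket_algebraMap]
  | zero p => rw [nu_zero_left, map_zero]
  | add _ _ h1 h2 => rw [nu_add_left, h1, h2, map_add]
  | ι_mul X _ h =>
    rw [nu_ι_mul, h, lieMv_algebraMap, fnBracket_ι_mul, Algebra.smul_def, Algebra.commutes]

/-- The Schouten bracket in its symmetric form is graded symmetric. -/
theorem nu_symm {p q : ℤ} {x y : ExteriorAlgebra A L} (hx : Homog p x) (hy : Homog q y) :
    nu x y = sg (p * q) • nu y x := by
  induction hx with
  | algebraMap a => rw [zero_mul, sg_zero, one_smul, nu_algebraMap, nu_fn_right hy]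
  | zero p => simp [nu_zero_left, nu_zero_right]
  | add _ _ h1 h2 => rw [nu_add_left, h1, h2, nu_add_right, smul_add]
  | @ι_mul X r u hu h =>
    have e1 : sg ((r + 1) * q) * sg q = sg (r * q) := by
      by_cases hq : Even q <;> by_cases hr : Even r <;>
        simp [sg, Int.even_add, Int.even_sub, Int.even_mul,
          -Int.not_even_iff_odd, ← Int.not_even_iff_odd, hq, hr]
    have e2 : sg ((r + 1) * q) * sg ((q - 1) * 1) = - sg (r * q) := by
      by_cases hq : Even q <;> by_cases hr : Even r <;>
        simp [sg, Int.even_add, Int.even_sub, Int.even_mul,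
          -Int.not_even_iff_odd, ← Int.not_even_iff_odd, hq, hr]
    rw [nu_ι_mul, h, nu_mul_right hy (.ι X), nu_ι_right hy, hu.comm (hy.lieMv X), smul_add,
      smul_mul_assoc, smul_smul, smul_smul, e1, e2, mul_smul_comm, neg_smul]
    abel

/-- The Jacobiator of the Schouten bracket in its symmetric form, for arguments `x` and `y` of degrees
`p` and `q`. -/
def jacobiator (p q : ℤ) (x y z : ExteriorAlgebra A L) : ExteriorAlgebra A L :=
  nu (nu x y) z + sg ((p - 1) * q) • nu y (nu x z) + sg p • nu x (nu y z)

/-- ν(x, -) and ν(y, -) are derivations of degrees p - 1 and q - 1, and the mixed terms of their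
composites cancel. So the Jacobiator is a derivation of degree p + q - 2 in the last argument; only
the parity of p + q matters for the sign. -/
theorem jacobiator_mul {p q r : ℤ} {x y z : ExteriorAlgebra A L} (hx : Homog p x) (hy : Homog q y)
    (hz : Homog r z) (z' : ExteriorAlgebra A L) :
    jacobiator p q x y (z * z') =
      jacobiator p q x y z * z' + sg ((p + q) * r) • (z * jacobiator p q x y z') := by
  unfold jacobiator
  rw [nu_mul_right (hx.nu hy) hz, nu_mul_right hx hz, nu_mul_right hy hz, nu_add_right,
    nu_add_right, nu_mul_right hy (hx.nu hz), nu_mul_right hx (hy.nu hz), nu_zsmul_right,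
    nu_zsmul_right, nu_mul_right hy hz, nu_mul_right hx hz]
  -- With the brackets turned into atoms, both sides are combinations of the same products, and
  -- comparing coefficients is a parity check.
  generalize nu x (nu y z) = a1, nu x (nu y z') = a2, nu (nu x y) z = a3, nu (nu x y) z' = a4,
    nu y (nu x z) = a5, nu y (nu x z') = a6, nu x z = a7, nu x z' = a8, nu y z = a9, nu y z' = a0
  simp only [mul_add, add_mul, smul_add, smul_mul_assoc, mul_smul_comm, smul_smul]
  match_scalars <;>
  by_cases hp : Even p <;> by_cases hq : Even q <;> by_cases hr : Even r <;>
  simp [sg, Int.even_add, Int.even_sub, Int.even_mul, -Int.not_even_iff_odd,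
    ← Int.not_even_iff_odd, hp, hq, hr]

theorem jacobiator_swap_left {p q : ℤ} {x y : ExteriorAlgebra A L} (hx : Homog p x)
    (hy : Homog q y) (z : ExteriorAlgebra A L) :
    jacobiator p q x y z = sg (p * q) • jacobiator q p y x z := by
  unfold jacobiator
  rw [nu_symm hx hy, nu_zsmul_left]
  simp only [smul_add, smul_smul]
  match_scalars <;>
  by_cases hp : Even p <;> by_cases hq : Even q <;>
  simp [sg, Int.even_add, Int.even_sub, Int.even_mul, -Int.not_even_iff_odd,
    ← Int.not_even_iff_odd, hp, hq]

/-- Together with `jacobiator_swap_left`, this moves any argument into the last place, where the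
Jacobiator is known to be a derivation. -/
theorem jacobiator_swap_right {p q r : ℤ} {x y z : ExteriorAlgebra A L} (hx : Homog p x)
    (hy : Homog q y) (hz : Homog r z) :
    jacobiator p q x y z = sg (q * r) • jacobiator p r x z y := by
  unfold jacobiator
  rw [nu_symm hy (hx.nu hz), nu_symm hz (hx.nu hy), nu_symm hy hz, nu_zsmul_right]
  simp only [smul_add, smul_smul]
  match_scalars <;>
  by_cases hp : Even p <;> by_cases hq : Even q <;> by_cases hr : Even r <;>
  simp [sg, Int.even_add, Int.even_sub, Int.even_mul, -Int.not_even_iff_odd,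
    ← Int.not_even_iff_odd, hp, hq, hr]

theorem jacobiator_add (p q : ℤ) (x y z z' : ExteriorAlgebra A L) :
    jacobiator p q x y (z + z') = jacobiator p q x y z + jacobiator p q x y z' := by
  simp only [jacobiator, nu_add_right, smul_add]
  abel

/-- A derivation that kills functions and vector fields kills all their products. -/
theorem jacobiator_eq_zero_of_generators {p q : ℤ} {x y : ExteriorAlgebra A L} (hx : Homog p x)
    (hy : Homog q y) (h0 : ∀ a : A, jacobiator p q x y (algebraMap A _ a) = 0)
    (h1 : ∀ X : L, jacobiator p q x y (ι A X) = 0) {r : ℤ} {z : ExteriorAlgebra A L}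
    (hz : Homog r z) : jacobiator p q x y z = 0 := by
  induction hz with
  | algebraMap a => exact h0 a
  | zero r => simp [jacobiator, nu_zero_right]
  | add _ _ h h' => rw [jacobiator_add, h, h', add_zero]
  | ι_mul X _ h => rw [jacobiator_mul hx hy (.ι X), h1, h, zero_mul, mul_zero, smul_zero, add_zero]

theorem nu_ι_algebraMap (X : L) (a : A) :
    nu (ι A X) (algebraMap A _ a) = algebraMap A _ ⁅X, a⁆ := by
  rw [nu_ι, lieMv_algebraMap]

theorem nu_algebraMap_ι (X : L) (a : A) :
    nu (algebraMap A _ a) (ι A X) = algebraMap A _ ⁅X, a⁆ := by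
  rw [nu_symm (.algebraMap a) (.ι X), zero_mul, sg_zero, one_smul, nu_ι_algebraMap]

theorem nu_algebraMap_algebraMap (a b : A) :
    nu (algebraMap A (ExteriorAlgebra A L) a) (algebraMap A _ b) = 0 := by
  rw [nu_algebraMap, fnBracket_algebraMap]

/-- The graded Jacobi identity for the Schouten bracket in its symmetric form. -/
theorem jacobiator_eq_zero {p q r : ℤ} {x y z : ExteriorAlgebra A L} (hx : Homog p x)
    (hy : Homog q y) (hz : Homog r z) : jacobiator p q x y z = 0 := by
  -- First all three arguments are generators. The only case with content besides the action on
  -- functions is that of three vector fields, the Jacobi identity of the Lie bracket.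
  have fff : ∀ a b c : A, jacobiator (A := A) (L := L) 0 0 (algebraMap A _ a) (algebraMap A _ b)
      (algebraMap A _ c) = 0 := fun a b c ↦ by
    simp [jacobiator, nu_algebraMap_algebraMap, nu_zero_left, nu_zero_right]
  have ffX : ∀ (a b : A) (X : L), jacobiator 0 0 (algebraMap A _ a) (algebraMap A _ b)
      (ι A X) = 0 := fun a b X ↦ by
    simp [jacobiator, nu_algebraMap_algebraMap, nu_zero_left, nu_algebraMap_ι]
  have XYf : ∀ (X Y : L) (a : A), jacobiator 1 1 (ι A X) (ι A Y) (algebraMap A _ a) = 0 :=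
    fun X Y a ↦ by
      simp [jacobiator, nu_ι_algebraMap, nu_ι_ι, sg_zero, sg_one, ← map_add, ← map_neg]
  have XYZ : ∀ (X Y Z : L), jacobiator 1 1 (ι A X) (ι A Y) (ι A Z) = 0 := fun X Y Z ↦ by
    simp only [jacobiator, nu_ι_ι, sub_self, zero_mul, sg_zero, sg_one, one_smul, neg_smul]
    rw [leibniz_lie X Y Z, map_add]
    abel
  -- Now one argument after the other is freed: the argument to be extended is in the last place,
  -- and the swaps reduce its values on generators to cases already settled.
  have ff : ∀ (a b : A) {r : ℤ} {z : ExteriorAlgebra A L}, Homog r z →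
      jacobiator 0 0 (algebraMap A _ a) (algebraMap A _ b) z = 0 := fun a b ↦
    jacobiator_eq_zero_of_generators (.algebraMap a) (.algebraMap b) (fff a b) (ffX a b)
  have XY : ∀ (X Y : L) {r : ℤ} {z : ExteriorAlgebra A L}, Homog r z →
      jacobiator 1 1 (ι A X) (ι A Y) z = 0 := fun X Y ↦
    jacobiator_eq_zero_of_generators (.ι X) (.ι Y) (XYf X Y) (XYZ X Y)
  have fX : ∀ (a : A) (X : L) {r : ℤ} {z : ExteriorAlgebra A L}, Homog r z →
      jacobiator 0 1 (algebraMap A _ a) (ι A X) z = 0 := fun a X ↦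
    jacobiator_eq_zero_of_generators (.algebraMap a) (.ι X)
      (fun b ↦ by rw [jacobiator_swap_right (.algebraMap a) (.ι X) (.algebraMap b), ff _ _ (.ι X),
        smul_zero])
      (fun Y ↦ by
        rw [jacobiator_swap_left (.algebraMap a) (.ι X) _,
          jacobiator_swap_right (.ι X) (.algebraMap a) (.ι Y), XY _ _ (.algebraMap a), smul_zero,
          smul_zero])
  have f : ∀ (a : A) {q r : ℤ} {y z : ExteriorAlgebra A L}, Homog q y → Homog r z →
      jacobiator 0 q (algebraMap A _ a) y z = 0 := fun a q r y z hy hz ↦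
    jacobiator_eq_zero_of_generators (.algebraMap a) hy
      (fun b ↦ by rw [jacobiator_swap_right (.algebraMap a) hy (.algebraMap b), ff _ _ hy,
        smul_zero])
      (fun Y ↦ by rw [jacobiator_swap_right (.algebraMap a) hy (.ι Y), fX _ _ hy, smul_zero]) hz
  have X : ∀ (X : L) {q r : ℤ} {y z : ExteriorAlgebra A L}, Homog q y → Homog r z →
      jacobiator 1 q (ι A X) y z = 0 := fun X q r y z hy hz ↦
    jacobiator_eq_zero_of_generators (.ι X) hy
      (fun b ↦ by
        rw [jacobiator_swap_right (.ι X) hy (.algebraMap b),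
          jacobiator_swap_left (.ι X) (.algebraMap b) _, fX _ _ hy, smul_zero, smul_zero])
      (fun Y ↦ by rw [jacobiator_swap_right (.ι X) hy (.ι Y), XY _ _ hy, smul_zero]) hz
  exact jacobiator_eq_zero_of_generators hx hy
    (fun b ↦ by
      rw [jacobiator_swap_right hx hy (.algebraMap b), jacobiator_swap_left hx (.algebraMap b) _,
        f _ hx hy, smul_zero, smul_zero])
    (fun Y ↦ by
      rw [jacobiator_swap_right hx hy (.ι Y), jacobiator_swap_left hx (.ι Y) _,
        X _ hx hy, smul_zero, smul_zero]) hz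

end SchoutenIdentities


/-! ### Linearity of the bracket over constants. -/

section ConstantScalars

open ExteriorAlgebra

variable {A L : Type*} [CommRing A] [LieRing L] [Module A L] [LieRingModule L A]
  [LieRinehartRing A L]

theorem fnBracket_of_const {a : A} (ha : ∀ X : L, ⁅X, a⁆ = 0) (z : ExteriorAlgebra A L) :
    fnBracket a z = 0 := by
  have : differential (L := L) a = 0 := by ext X; exact ha X
  simp [fnBracket, this]

/-- The bracket is a derivation and not linear over functions; the correction term is a contraction
with the differential of `a`, which vanishes if all X(a) do. -/
theorem nu_smul_left_of_const {a : A} (ha : ∀ X : L, ⁅X, a⁆ = 0) (x z : ExteriorAlgebra A L) :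
    nu (a • x) z = a • nu x z := by
  unfold nu
  rw [map_smul]
  change a • (NuTwist.act x (NuTwist.mk 1 0)).2 z + _ * fnBracket a z = _
  rw [fnBracket_of_const ha, mul_zero, add_zero]

theorem nu_smul_right_of_const {a : A} (ha : ∀ X : L, ⁅X, a⁆ = 0) (x z : ExteriorAlgebra A L) :
    nu x (a • z) = a • nu x z := by
  induction x using CliffordAlgebra.left_induction with
  | algebraMap b =>
    refine (nu_algebraMap b _).trans ?_
    rw [map_smul]
    exact congrArg _ (nu_algebraMap b z).symm
  | add x y hx hy => rw [nu_add_left, nu_add_left, hx, hy, smul_add]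
  | ι_mul x X hx =>
    refine (nu_ι_mul X x _).trans ?_
    rw [hx, lieMv_smul, ha, zero_smul, add_zero, mul_smul_comm, mul_smul_comm, ← smul_sub]
    exact congrArg _ (nu_ι_mul X x z).symm

end ConstantScalars

/-! ### The exterior derivative of a function times a form. -/

section FlatDerivation

variable {E : Type*} [NormedAddCommGroup E] [NormedSpace ℝ E]

/-- The sum is df ∧ a written out. It involves only the value of `a` at `y`, which is what makes [d,
f] linear over functions. -/
theorem extDeriv_fun_smul_apply {k : ℕ} {a : E → E [⋀^Fin k]→L[ℝ] ℝ} {f : E → ℝ} {y : E}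
    (ha : DifferentiableAt ℝ a y) (hf : DifferentiableAt ℝ f y) (v : Fin (k + 1) → E) :
    extDeriv (fun z ↦ f z • a z) y v = f y * extDeriv a y v +
      ∑ i : Fin (k + 1), (-1 : ℤ) ^ (i : ℕ) • (fderiv ℝ f y (v i) * a y (i.removeNth v)) := by
  have hd : DifferentiableAt ℝ (fun z ↦ f z • a z) y := hf.smul ha
  rw [extDeriv_apply hd, extDeriv_apply ha, Finset.mul_sum, ← Finset.sum_add_distrib]
  refine Finset.sum_congr rfl fun i _ ↦ ?_
  rw [fderiv_continuousAlternatingMap_apply_const_apply hd,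
    fderiv_continuousAlternatingMap_apply_const_apply ha]
  rw [fderiv_fun_smul hf ha]
  simp
  ring

end FlatDerivation

/-! ### Cartan's formula for multivector fields. -/

section Contraction

open ExteriorAlgebra

variable {n : ℕ} {M : Type*} [TopologicalSpace M] [ChartedSpace (EuclideanSpace ℝ (Fin n)) M]
  [IsManifold (𝓡 n) ∞ M]

theorem fn_differentiableAt (f : SmoothFn n M) (x : M) :
    DifferentiableAt ℝ (fun z ↦ f ((extChartAt (𝓡 n) x).symm z)) (extChartAt (𝓡 n) x x) :=
  ((VecField.mdiffAt' f _).comp _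
    (RoughForm.mdiffAt_symm (mem_extChartAt_target (I := 𝓡 n) x))).differentiableAt

/-- The operator `d a ∧ - = [d, a]`. -/
noncomputable def wedgeDiff (a : SmoothFn n M) (α : Forms n M) : Forms n M :=
  extDer (a • α) - a • extDer α

theorem wedgeDiff_inChart (a : SmoothFn n M) (α : Forms n M) (k : ℕ) (x : M)
    (v : Fin (k + 1) → EuclideanSpace ℝ (Fin n)) :
    RoughForm.inChart (wedgeDiff a α (k + 1)).1 x (extChartAt (𝓡 n) x x) v =
      ∑ i : Fin (k + 1), (-1 : ℤ) ^ (i : ℕ) • (fderiv ℝ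
        (fun z ↦ a ((extChartAt (𝓡 n) x).symm z)) (extChartAt (𝓡 n) x x) (v i) *
          RoughForm.inChart (α k).1 x (extChartAt (𝓡 n) x x) (i.removeNth v)) := by
  have hy := mem_extChartAt_target (I := 𝓡 n) x
  have h1 := extDeriv_fun_smul_apply ((α k).smooth.differentiableAt hy) (fn_differentiableAt a x) v
  have h2 : RoughForm.inChart (extDer (a • α) (k + 1)).1 x (extChartAt (𝓡 n) x x) v =
      extDeriv (fun z ↦ a ((extChartAt (𝓡 n) x).symm z) • RoughForm.inChart (α k).1 x z)
        (extChartAt (𝓡 n) x x) v :=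
    DFunLike.congr_fun (RoughForm.extD_inChart (a • α k).smooth hy) v
  have h3 : RoughForm.inChart (extDer α (k + 1)).1 x (extChartAt (𝓡 n) x x) v =
      extDeriv (RoughForm.inChart (α k).1 x) (extChartAt (𝓡 n) x x) v :=
    DFunLike.congr_fun (RoughForm.extD_inChart (α k).smooth hy) v
  have h4 : RoughForm.inChart (wedgeDiff a α (k + 1)).1 x (extChartAt (𝓡 n) x x) v =
      RoughForm.inChart (extDer (a • α) (k + 1)).1 x (extChartAt (𝓡 n) x x) v -
      a ((extChartAt (𝓡 n) x).symm (extChartAt (𝓡 n) x x)) *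
      RoughForm.inChart (extDer α (k + 1)).1 x (extChartAt (𝓡 n) x x) v := rfl
  rw [h4, h2, h3, h1]
  ring

/-- By `wedgeDiff_inChart`, the form enters only through its value at the point, so the factor `b`
can be pulled out. In degree 0 both sides vanish. -/
theorem wedgeDiff_smul (a b : SmoothFn n M) (α : Forms n M) :
    wedgeDiff a (b • α) = b • wedgeDiff a α := by
  funext k
  cases k with
  | zero =>
    refine Eq.trans (b := 0) ?_ (Eq.symm ?_)
    · exact (congrArg (fun t ↦ (0 : SmoothForm n M 0) - t) (smul_zero a)).trans (sub_zero 0)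
    · refine (congrArg (b • ·) ?_).trans (smul_zero b)
      exact (congrArg (fun t ↦ (0 : SmoothForm n M 0) - t) (smul_zero a)).trans (sub_zero 0)
  | succ k =>
    refine SmoothForm.ext_inChart fun x v ↦ ?_
    have h1 : ∀ w, RoughForm.inChart ((b • α) k).1 x (extChartAt (𝓡 n) x x) w =
        b ((extChartAt (𝓡 n) x).symm (extChartAt (𝓡 n) x x)) *
        RoughForm.inChart (α k).1 x (extChartAt (𝓡 n) x x) w := fun w ↦ rfl
    have h2 : RoughForm.inChart ((b • wedgeDiff a α) (k + 1)).1 x (extChartAt (𝓡 n) x x) v =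
        b ((extChartAt (𝓡 n) x).symm (extChartAt (𝓡 n) x x)) *
        RoughForm.inChart (wedgeDiff a α (k + 1)).1 x (extChartAt (𝓡 n) x x) v := rfl
    rw [h2, wedgeDiff_inChart, wedgeDiff_inChart, Finset.mul_sum]
    refine Finset.sum_congr rfl fun i _ ↦ ?_
    rw [h1, mul_smul_comm]
    congr 1
    ring

/-- The relation da ∧ ι_Y + ι_Y (da ∧ -) = Y(a), obtained by comparing two expansions of L_Y(a α):
the definition L_Y = d ι_Y + ι_Y d and the Leibniz rule. -/
theorem wedgeDiff_contractVec (a : SmoothFn n M) (Y : VecField n M) (α : Forms n M) :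
    wedgeDiff a (contractVec Y α) = ⁅Y, a⁆ • α - contractVec Y (wedgeDiff a α) := by
  have h := lieForm_smul Y a α
  have hc : ∀ β : Forms n M, contractVec Y (a • β) = a • contractVec Y β := fun β ↦ map_smul _ a β
  rw [lieForm_apply, lieForm_apply, hc, smul_add] at h
  rw [wedgeDiff, wedgeDiff, map_sub, hc, eq_sub_iff_add_eq, sub_add_sub_comm, h]
  abel

theorem contraction_ι_mul (X : VecField n M) (y : Multivec n M) (α : Forms n M) :
    contraction (ι _ X * y) α = contractVec X (contraction y α) := by
  rw [map_mul, contraction, lift_ι_apply]; rfl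

theorem contraction_algebraMap (a : SmoothFn n M) (α : Forms n M) :
    contraction (algebraMap _ (Multivec n M) a) α = a • α := by
  rw [AlgHom.commutes]; rfl

theorem contraction_mul (x y : Multivec n M) (α : Forms n M) :
    contraction (x * y) α = contraction x (contraction y α) := by
  rw [map_mul]; rfl

theorem contraction_add (x y : Multivec n M) (α : Forms n M) :
    contraction (x + y) α = contraction x α + contraction y α := by
  rw [map_add]; rfl

theorem contraction_sub (x y : Multivec n M) (α : Forms n M) :
    contraction (x - y) α = contraction x α - contraction y α := by
  rw [map_sub]; rfl

theorem contraction_zsmul (k : ℤ) (x : Multivec n M) (α : Forms n M) :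
    contraction (k • x) α = k • contraction x α := by
  rw [map_zsmul]; rfl

/-- Cartan's formula with a function as first argument. Since [d, a] = da ∧ -, each vector field
split off from `y` is passed by `wedgeDiff_contractVec`, matching the recursion for contraction with
da. -/
theorem contraction_fnBracket (a : SmoothFn n M) {q : ℤ} {y : Multivec n M} (hy : Homog q y)
    (α : Forms n M) :
    contraction (fnBracket a y) α =
      wedgeDiff a (contraction y α) - sg q • contraction y (wedgeDiff a α) := by
  induction hy with
  | algebraMap b =>
    rw [fnBracket_algebraMap, map_zero, contraction_algebraMap, contraction_algebraMap,
      wedgeDiff_smul, sg_zero, one_smul, sub_self]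
    rfl
  | zero p =>
    simp [wedgeDiff]
  | add _ _ h1 h2 =>
    have : ∀ β γ : Forms n M, wedgeDiff a (β + γ) = wedgeDiff a β + wedgeDiff a γ := fun β γ ↦ by
      simp only [wedgeDiff, smul_add, map_add]; abel
    rw [map_add, contraction_add, h1, h2, contraction_add, this, contraction_add, smul_add]
    abel
  | @ι_mul Y r u hu h =>
    rw [fnBracket_ι_mul, contraction_sub, contraction_ι_mul, h, contraction_ι_mul,
      wedgeDiff_contractVec, contraction_ι_mul, map_sub, map_zsmul, sg_add, sg_one, mul_neg_one,
      neg_smul]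
    have : contraction (⁅Y, a⁆ • u) α = ⁅Y, a⁆ • contraction u α := by rw [map_smul]; rfl
    rw [this]
    abel

/-- Cartan's formula with a vector field as first argument: both sides are derivations in `y`, and
they agree on functions and on vector fields. -/
theorem lieForm_contraction (X : VecField n M) (y : Multivec n M) (α : Forms n M) :
    lieForm X (contraction y α) = contraction y (lieForm X α) + contraction (lieMv X y) α := by
  induction y using CliffordAlgebra.left_induction with
  | algebraMap a =>
    have h1 : ∀ β, contraction (n := n) (M := M) (algebraMap _ _ a) β = a • β :=
      contraction_algebraMap a
    refine (congrArg _ (h1 α)).trans ?_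
    rw [lieForm_smul]
    refine (congrArg₂ _ (h1 _) ((congrArg (fun t ↦ contraction t α)
      (lieMv_algebraMap X a)).trans ?_)).symm
    exact contraction_algebraMap _ α
  | add x y hx hy =>
    rw [lieMv_add, contraction_add, map_add, hx, hy, contraction_add, contraction_add]
    abel
  | ι_mul u Y hu =>
    have h1 : ∀ β, contraction (n := n) (M := M) (ι _ Y * u) β = contractVec Y (contraction u β) :=
      contraction_ι_mul Y u
    refine (congrArg _ (h1 α)).trans ?_
    rw [lieForm_contractVec, hu]
    refine Eq.trans ?_ (congrArg₂ _ (h1 _) ((congrArg (fun t ↦ contraction t α)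
      (lieMv_ι_mul X Y u)).trans (contraction_add _ _ _))).symm
    rw [contraction_ι_mul, contraction_ι_mul, map_add]
    abel

/-- The Lie derivative along a multivector field of degree `p`. -/
noncomputable def lieOp (p : ℤ) (x : Multivec n M) (α : Forms n M) : Forms n M :=
  extDer (contraction x α) - sg p • contraction x (extDer α)

theorem lieDer_of_homog {p : ℤ} {x : Multivec n M} (hx : Homog p x) (α : Forms n M) :
    lieDer α x = lieOp p x α := by
  have : signMap n M x = sg p • x := hx.involute
  rw [lieDer_apply, this, contraction_zsmul, lieOp]

/-- The Cartan formula `ι_{ν(x, y)} = [L_x, ι_y]`. -/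
theorem contraction_nu {p q : ℤ} {x y : Multivec n M} (hx : Homog p x) (hy : Homog q y)
    (α : Forms n M) :
    contraction (nu x y) α =
      lieOp p x (contraction y α) - sg ((p - 1) * q) • contraction y (lieOp p x α) := by
  induction hx with
  | algebraMap a =>
    have e : sg ((0 - 1) * q) = sg q := by
      by_cases hq : Even q <;> simp [sg, hq]
    rw [nu_algebraMap, contraction_fnBracket a hy, e]
    simp only [lieOp, wedgeDiff, contraction_algebraMap, sg_zero, one_smul]
  | zero p => simp [nu_zero_left, lieOp]
  | @add p x x' _ _ h1 h2 =>
    have : ∀ β : Forms n M, lieOp p (x + x') β = lieOp p x β + lieOp p x' β := fun β ↦ by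
      rw [lieOp, lieOp, lieOp, contraction_add, contraction_add, map_add, smul_add]; abel
    rw [nu_add_left, contraction_add, h1, h2, this, this, map_add, smul_add]
    abel
  | @ι_mul X r u hu h =>
    -- L_{X ∧ u} = L_X ι_u - ι_X L_u parallels ν(X ∧ u, y) = u ∧ L_X y - X ∧ ν(u, y), so the
    -- hypothesis for `u` and `lieForm_contraction` close the case once all factors are brought into
    -- one order.
    have hL : ∀ β : Forms n M, lieOp (r + 1) (ι _ X * u) β =
        lieForm X (contraction u β) - contractVec X (lieOp r u β) := fun β ↦ by
      simp only [lieOp, contraction_ι_mul, lieForm_apply, map_sub, map_zsmul, sg_add, sg_one,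
        mul_neg_one, neg_smul]
      abel
    have h1 : ∀ β : Forms n M, contraction u (contraction y β) =
        sg (r * q) • contraction y (contraction u β) := fun β ↦ by
      rw [← contraction_mul, hu.comm hy, contraction_zsmul, contraction_mul]
    have h2 : ∀ β : Forms n M, contraction y (contractVec X β) =
        sg q • contractVec X (contraction y β) := fun β ↦ by
      have h3 : contractVec X β = contraction (ι _ X) β := by
        rw [contraction, lift_ι_apply]
      rw [h3, ← contraction_mul, hy.ι_comm, contraction_zsmul, contraction_ι_mul]
    have e1 : sg ((r + 1 - 1) * q) = sg (r * q) := by rw [add_sub_cancel_right]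
    have e2 : sg ((r - 1) * q) = sg (r * q) * sg q := by
      by_cases hq : Even q <;> by_cases hr : Even r <;>
      simp [sg, Int.even_add, Int.even_sub, Int.even_mul, -Int.not_even_iff_odd,
        ← Int.not_even_iff_odd, hq, hr]
    rw [nu_ι_mul, contraction_sub, contraction_ι_mul, h, hL, hL, hu.comm (hy.lieMv X),
      contraction_zsmul, contraction_mul, e1, e2, h1, map_zsmul, map_sub, map_sub, h2,
      lieForm_contraction, map_zsmul]
    simp only [smul_sub, smul_add, smul_smul]
    abel

end Contraction


/-! ### Permutations of n + 1 letters from those of n letters. -/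

section InsertedPermutations

/-- The permutation that sends `k` to `0` and is `σ` on the remaining indices. -/
def insPerm {n : ℕ} (k : Fin (n + 1)) (σ : Equiv.Perm (Fin n)) : Equiv.Perm (Fin (n + 1)) :=
  (finSuccEquiv' k).trans ((Equiv.optionCongr σ).trans (finSuccEquiv' 0).symm)

variable {n : ℕ}

theorem insPerm_self (k : Fin (n + 1)) (σ : Equiv.Perm (Fin n)) : insPerm k σ k = 0 := by
  simp [insPerm]

theorem insPerm_succAbove (k : Fin (n + 1)) (σ : Equiv.Perm (Fin n)) (j : Fin n) :
    insPerm k σ (k.succAbove j) = (σ j).succ := by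
  simp [insPerm]

/-- A permutation is determined by the preimage of 0 and the arrangement of the other values;
injectivity suffices, as (n + 1) · n! = (n + 1)!. -/
theorem insPerm_bijective :
    Function.Bijective fun q : Fin (n + 1) × Equiv.Perm (Fin n) ↦ insPerm q.1 q.2 := by
  rw [Fintype.bijective_iff_injective_and_card]
  refine ⟨?_, by simp [Fintype.card_perm, Nat.factorial_succ]⟩
  rintro ⟨k, σ⟩ ⟨l, τ⟩ h
  have h : insPerm k σ = insPerm l τ := h
  have hk : k = l := by
    apply (insPerm l τ).injective
    rw [insPerm_self, ← h, insPerm_self]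
  subst hk
  have : σ = τ := by
    ext j
    have := congrArg (fun π : Equiv.Perm (Fin (n + 1)) ↦ π (k.succAbove j)) h
    simp only [insPerm_succAbove] at this
    rw [Fin.succ_injective _ this]
  rw [this]

theorem sum_perm_succ {W : Type*} [AddCommMonoid W] (F : Equiv.Perm (Fin (n + 1)) → W) :
    ∑ τ, F τ = ∑ k, ∑ σ, F (insPerm k σ) := by
  rw [← Fintype.sum_prod_type']
  exact (Fintype.sum_bijective _ insPerm_bijective _ _ fun _ ↦ rfl).symm

/-- The value 0 at position `k` is inverted with exactly the positions before `k`; pairs that avoid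
`k` contribute the sign of `σ`. -/
theorem koszulSign_insPerm_aux (p : Fin (n + 1) → ℤ) (k : Fin (n + 1)) (σ : Equiv.Perm (Fin n)) :
    koszulSign p (insPerm k σ) = koszulSign (fun j ↦ p j.succ) σ *
      ∏ j : Fin n, if k.succAbove j < k then sg (p 0 * p (σ j).succ) else 1 := by
  unfold koszulSign
  rw [Fin.prod_univ_succAbove _ k]
  have h1 : (∏ b : Fin (n + 1), if k < b ∧ insPerm k σ b < insPerm k σ k then
      ((p (insPerm k σ k) * p (insPerm k σ b)).negOnePow : ℤ) else 1) = 1 :=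
    Finset.prod_eq_one fun b _ ↦ by rw [insPerm_self, if_neg]; simp
  rw [h1, one_mul, ← Finset.prod_mul_distrib]
  refine Finset.prod_congr rfl fun a _ ↦ ?_
  rw [Fin.prod_univ_succAbove _ k, mul_comm]
  simp only [insPerm_self, insPerm_succAbove, coe_negOnePow, Fin.succ_lt_succ_iff,
    Fin.succAbove_lt_succAbove_iff, Fin.succ_pos, and_true, mul_comm (p (σ a).succ) (p 0)]

theorem ofFn_eq_take_append_drop {α : Type*} : ∀ {n : ℕ} (f : Fin (n + 1) → α) (g : Fin n → α)
    (k : Fin (n + 1)), (∀ j, f (k.succAbove j) = g j) →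
    List.ofFn f = (List.ofFn g).take k ++ f k :: (List.ofFn g).drop k
  | 0, f, g, k, h => by
    obtain rfl : k = 0 := Fin.ext (by omega)
    simp
  | n + 1, f, g, k, h => by
    induction k using Fin.cases with
    | zero =>
      have : (fun j : Fin (n + 1) ↦ f j.succ) = g := funext fun j ↦ by
        rw [← h j, Fin.succAbove_zero]
      rw [List.ofFn_succ, this]
      simp
    | succ k =>
      have h0 : f 0 = g 0 := by rw [← h 0, Fin.succ_succAbove_zero]
      have := ofFn_eq_take_append_drop (fun j ↦ f j.succ) (fun j ↦ g j.succ) k fun j ↦ by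
        rw [← h j.succ, Fin.succ_succAbove_succ]
      rw [List.ofFn_succ, this, h0, List.ofFn_succ (f := g)]
      simp

theorem prod_succAbove_lt_eq : ∀ {n : ℕ} (c : ℤ) (g : Fin n → ℤ) (k : Fin (n + 1)),
    (∏ j : Fin n, if k.succAbove j < k then sg (c * g j) else 1) =
      sg (c * ((List.ofFn g).take k).sum)
  | 0, c, g, k => by simp [sg_zero]
  | n + 1, c, g, k => by
    induction k using Fin.cases with
    | zero => simp [sg_zero]
    | succ k =>
      rw [Fin.prod_univ_succ]
      have := prod_succAbove_lt_eq c (fun j ↦ g j.succ) k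
      simp [List.ofFn_succ, mul_add, sg_add, this]

end InsertedPermutations

/-! ### Sums over unshuffles by recursion on the list of arguments. -/

section UnshuffleSums

variable {α W W' : Type*} [AddCommGroup W] [AddCommGroup W'] (d : α → ℤ)

theorem ofFn_insPerm {n : ℕ} (z : Fin (n + 1) → α) (k : Fin (n + 1)) (σ : Equiv.Perm (Fin n)) :
    List.ofFn (fun a ↦ z (insPerm k σ a)) =
      (List.ofFn fun j ↦ z (σ j).succ).take k ++ z 0 ::
        (List.ofFn fun j ↦ z (σ j).succ).drop k := by
  rw [ofFn_eq_take_append_drop (fun a ↦ z (insPerm k σ a)) (fun j ↦ z (σ j).succ) k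
    fun j ↦ by rw [insPerm_succAbove], insPerm_self]

theorem koszulSign_insPerm {n : ℕ} (z : Fin (n + 1) → α) (k : Fin (n + 1))
    (σ : Equiv.Perm (Fin n)) :
    koszulSign (fun a ↦ d (z a)) (insPerm k σ) = koszulSign (fun j ↦ d (z j.succ)) σ *
      sg (d (z 0) * (((List.ofFn fun j ↦ z (σ j).succ).take k).map d).sum) := by
  rw [koszulSign_insPerm_aux, prod_succAbove_lt_eq (d (z 0)) (fun j ↦ d (z (σ j).succ)) k,
    List.map_take, List.map_ofFn]
  rfl

/-- The signed sum of `G h t` over all unshuffles of the list `l` into a list `h` of length `i` and a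
list `t`. -/
def unshuffleSum : ℕ → List α → (List α → List α → W) → W
  | 0, l, G => G [] l
  | _ + 1, [], _ => 0
  | i + 1, a :: l, G => unshuffleSum i l (fun h t ↦ G (a :: h) t) +
      unshuffleSum (i + 1) l (fun h t ↦ sg (d a * (h.map d).sum) • G h (a :: t))

theorem map_unshuffleSum (φ : W →+ W') : ∀ (i : ℕ) (l : List α) (G : List α → List α → W),
    φ (unshuffleSum d i l G) = unshuffleSum d i l fun h t ↦ φ (G h t)
  | 0, l, G => by simp [unshuffleSum]
  | i + 1, [], G => by simp [unshuffleSum]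
  | i + 1, a :: l, G => by
    simp only [unshuffleSum, map_add, map_unshuffleSum φ i l, map_unshuffleSum φ (i + 1) l,
      map_zsmul]

theorem unshuffleSum_eq_zero_of_length_lt : ∀ (i : ℕ) (l : List α) (G : List α → List α → W),
    l.length < i → unshuffleSum d i l G = 0
  | 0, l, G, h => by simp at h
  | i + 1, [], G, h => rfl
  | i + 1, a :: l, G, h => by
    rw [List.length_cons] at h
    rw [unshuffleSum, unshuffleSum_eq_zero_of_length_lt i l _ (by omega),
      unshuffleSum_eq_zero_of_length_lt (i + 1) l _ (by omega), add_zero]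

theorem isUnshuffle_insPerm_zero {n i : ℕ} (σ : Equiv.Perm (Fin n)) :
    IsUnshuffle (i + 1) (insPerm 0 σ) ↔ IsUnshuffle i σ := by
  have h0 : ∀ j : Fin n, insPerm 0 σ j.succ = (σ j).succ := fun j ↦ by
    have := insPerm_succAbove 0 σ j
    rwa [Fin.succAbove_zero] at this
  constructor
  · intro h a b hab hi
    have := h a.succ b.succ (Fin.succ_lt_succ_iff.2 hab) (by simp only [Fin.val_succ]; omega)
    rwa [h0, h0, Fin.succ_lt_succ_iff] at this
  · intro h a b hab hi
    induction a using Fin.cases with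
    | zero =>
      induction b using Fin.cases with
      | zero => exact absurd hab (lt_irrefl _)
      | succ b => rw [insPerm_self, h0]; exact Fin.succ_pos _
    | succ a =>
      induction b using Fin.cases with
      | zero => exact absurd hab (Fin.not_lt_zero _)
      | succ b =>
        rw [h0, h0, Fin.succ_lt_succ_iff]
        simp only [Fin.val_succ] at hi
        exact h a b (Fin.succ_lt_succ_iff.1 hab) (by omega)

/-- The value 0 opens the second block here, so deleting it leaves the first block with its `i`
entries. -/
theorem isUnshuffle_insPerm {n i : ℕ} {k : Fin (n + 1)} (hk : (k : ℕ) = i) (σ : Equiv.Perm (Fin n)) :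
    IsUnshuffle i (insPerm k σ) ↔ IsUnshuffle i σ := by
  have hval : ∀ a : Fin n, ((k.succAbove a : Fin (n + 1)) : ℕ) = if (a : ℕ) < i then (a : ℕ) else a + 1 :=
    fun a ↦ by
      unfold Fin.succAbove
      subst hk
      simp only [Fin.lt_def, Fin.val_castSucc]
      split_ifs <;> rfl
  constructor
  · intro h a b hab hi
    have := h (k.succAbove a) (k.succAbove b) (Fin.succAbove_lt_succAbove_iff.2 hab) (by
      rw [hval, hval]
      split_ifs <;> omega)
    rwa [insPerm_succAbove, insPerm_succAbove, Fin.succ_lt_succ_iff] at this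
  · intro h a b hab hi
    rcases Fin.eq_self_or_eq_succAbove k a with ha | ⟨a, rfl⟩ <;>
    rcases Fin.eq_self_or_eq_succAbove k b with hb | ⟨b, rfl⟩
    · exact absurd hab (by rw [ha, hb]; exact lt_irrefl _)
    · rw [ha, insPerm_self, insPerm_succAbove]; exact Fin.succ_pos _
    · rw [hb, Fin.lt_def] at hab
      rw [hb] at hi
      omega
    · rw [insPerm_succAbove, insPerm_succAbove, Fin.succ_lt_succ_iff]
      refine h a b (Fin.succAbove_lt_succAbove_iff.1 hab) ?_
      rw [hval, hval] at hi
      split_ifs at hi <;> omega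

/-- The least value must open one of the two blocks, since an unshuffle increases on each of them.
This dichotomy is the recursion for `unshuffleSum`. -/
theorem IsUnshuffle.eq_zero_or {n i : ℕ} {k : Fin (n + 1)} {σ : Equiv.Perm (Fin n)}
    (h : IsUnshuffle i (insPerm k σ)) : k = 0 ∨ (k : ℕ) = i := by
  by_contra! hk
  obtain ⟨hk1, hk2⟩ := hk
  have hk0 : 0 < (k : ℕ) := Nat.pos_of_ne_zero fun h0 ↦ hk1 (Fin.ext h0)
  have := h ⟨k - 1, by omega⟩ k (by rw [Fin.lt_def]; show (k : ℕ) - 1 < k; omega)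
    (by show (k : ℕ) < i ∨ i ≤ (k : ℕ) - 1; omega)
  rw [insPerm_self] at this
  exact Fin.not_lt_zero _ this

theorem isUnshuffle_zero_iff {n : ℕ} (σ : Equiv.Perm (Fin n)) : IsUnshuffle 0 σ ↔ σ = 1 := by
  constructor
  · intro h
    have hm : StrictMono σ := fun a b hab ↦ h a b hab (Or.inr (Nat.zero_le _))
    ext a
    have := Subsingleton.elim (hm.orderIsoOfSurjective σ σ.surjective) (OrderIso.refl _)
    exact congrArg Fin.val (congrArg (fun e : Fin n ≃o Fin n ↦ e a) this)
  · rintro rfl a b hab _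
    exact hab

theorem koszulSign_one {n : ℕ} (p : Fin n → ℤ) : koszulSign p 1 = 1 := by
  unfold koszulSign
  refine Finset.prod_eq_one fun a _ ↦ Finset.prod_eq_one fun b _ ↦ if_neg ?_
  rintro ⟨h1, h2⟩
  exact lt_asymm h1 h2

/-- The signed sum over `(i, n - i)`-unshuffles, computed by recursion on the list of arguments. -/
theorem sum_isUnshuffle : ∀ (n i : ℕ) (_ : i ≤ n) (z : Fin n → α) (G : List α → List α → W),
    ∑ σ : Equiv.Perm (Fin n) with IsUnshuffle i σ, koszulSign (fun a ↦ d (z a)) σ •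
      G ((List.ofFn fun a ↦ z (σ a)).take i) ((List.ofFn fun a ↦ z (σ a)).drop i) =
      unshuffleSum d i (List.ofFn z) G
  | n, 0, _, z, G => by
    have : (Finset.univ.filter fun σ : Equiv.Perm (Fin n) ↦ IsUnshuffle 0 σ) = {1} := by
      ext σ; simp [isUnshuffle_zero_iff]
    rw [this, Finset.sum_singleton, koszulSign_one]
    simp [unshuffleSum]
  | n + 1, i + 1, hi, z, G => by
    rw [Finset.sum_filter, sum_perm_succ, Fin.sum_univ_succ, List.ofFn_succ, unshuffleSum,
      ← sum_isUnshuffle n i (by omega) (fun j ↦ z j.succ)]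
    congr 1
    · rw [Finset.sum_filter]
      refine Finset.sum_congr rfl fun σ _ ↦ ?_
      rw [if_congr (isUnshuffle_insPerm_zero σ) rfl rfl, koszulSign_insPerm d z, ofFn_insPerm]
      simp [sg_zero]
    -- The first argument opens the second block, preceded by the `i + 1` letters of the first;
    -- hence position `i + 1`. For `i = n` the second block is empty and nothing contributes.
    · rcases Nat.lt_or_ge i n with hin | hin
      · rw [← sum_isUnshuffle n (i + 1) hin (fun j ↦ z j.succ), Finset.sum_filter,
          Finset.sum_eq_single_of_mem (⟨i, hin⟩ : Fin n) (Finset.mem_univ _)]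
        · refine Finset.sum_congr rfl fun σ _ ↦ ?_
          rw [if_congr (isUnshuffle_insPerm (by simp) σ) rfl rfl, koszulSign_insPerm d z,
            ofFn_insPerm]
          refine if_congr Iff.rfl ?_ rfl
          rw [mul_smul]
          have hl : ((List.ofFn fun j ↦ z (σ j).succ).take (i + 1)).length = i + 1 := by
            simp; omega
          simp only [Fin.succ_mk]
          rw [List.take_left' hl, List.drop_left' hl]
        · intro j _ hj
          refine Finset.sum_eq_zero fun σ _ ↦ if_neg fun h ↦ ?_
          rcases h.eq_zero_or with h0 | h0
          · exact Fin.succ_ne_zero _ h0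
          · exact hj (Fin.ext (by simpa using h0))
      · rw [unshuffleSum_eq_zero_of_length_lt _ _ _ _ (by simp; omega)]
        refine Finset.sum_eq_zero fun j _ ↦ Finset.sum_eq_zero fun σ _ ↦ if_neg fun h ↦ ?_
        rcases h.eq_zero_or with h0 | h0
        · exact Fin.succ_ne_zero _ h0
        · have := j.2
          simp at h0
          omega

/-- A function of lists that changes by the Koszul sign under transpositions of neighbours does so
under all permutations. -/
theorem eq_koszulSign_smul_of_swap : ∀ (n : ℕ) (Φ : List α → W)
    (_ : ∀ h a b t, Φ (h ++ a :: b :: t) = sg (d a * d b) • Φ (h ++ b :: a :: t))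
    (z : Fin n → α) (σ : Equiv.Perm (Fin n)),
    Φ (List.ofFn z) = koszulSign (fun a ↦ d (z a)) σ • Φ (List.ofFn fun a ↦ z (σ a))
  | 0, Φ, _, z, σ => by
    rw [Subsingleton.elim σ 1, koszulSign_one, one_smul]
    rfl
  | n + 1, Φ, hΦ, z, σ => by
    -- Moving `a` past the whole list `h`, by one transposition of neighbours after the other.
    have hmove : ∀ (h h' : List α) (a : α) (t : List α), Φ (h' ++ a :: (h ++ t)) =
        sg (d a * (h.map d).sum) • Φ (h' ++ (h ++ a :: t)) := by
      intro h
      induction h with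
      | nil => intro h' a t; simp [sg_zero]
      | cons b h ih =>
        intro h' a t
        have := ih (h' ++ [b]) a t
        simp only [List.append_assoc, List.singleton_append] at this
        rw [List.cons_append, hΦ, this, smul_smul, List.map_cons, List.sum_cons, mul_add, sg_add]
        rfl
    obtain ⟨⟨k, σ⟩, rfl⟩ := insPerm_bijective.2 σ
    simp only
    rw [List.ofFn_succ, eq_koszulSign_smul_of_swap n (fun l ↦ Φ (z 0 :: l))
      (fun h a b t ↦ hΦ (z 0 :: h) a b t) (fun j ↦ z j.succ) σ, koszulSign_insPerm d z, ofFn_insPerm,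
      mul_smul]
    congr 1
    have := hmove ((List.ofFn fun j ↦ z (σ j).succ).take k) [] (z 0)
      ((List.ofFn fun j ↦ z (σ j).succ).drop k)
    rwa [List.take_append_drop] at this

end UnshuffleSums


/-! ### Sums over the choice of two arguments. -/

section PairSums

variable {α S : Type*} [Ring S] (d : α → ℤ) (g : α → S) (c : α → α → S) (B : α → S → S)

/-- The value on a product `g a₁ ⋯ g a_r` of the operator `D` with
`D (g a * s) = B a s + (-1)^{|a|} g a * D s`. -/
def pairSum : List α → S
  | [] => 0
  | a :: l => B a (l.map g).prod + sg (d a) • (g a * pairSum l)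

/-- Iterating the Leibniz rule for `B a` along the product hits each letter once, and `hc` carries
the resulting `c a b` to the front. The default branch of the `match` is never reached, as `h` has
length 1. -/
theorem unshuffleSum_one_eq (hB1 : ∀ a, B a 1 = 0)
    (hB : ∀ a b s, B a (g b * s) = c a b * s + sg ((d a - 1) * d b) • (g b * B a s))
    (hc : ∀ a b e, c a b * g e = sg ((d a + d b - 1) * d e) • (g e * c a b)) (a : α) :
    ∀ l : List α, unshuffleSum d 1 l (fun h t ↦ match h with
      | [b] => c a b * (t.map g).prod
      | _ => 0) = B a (l.map g).prod
  | [] => by simp [unshuffleSum, hB1]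
  | b :: l => by
    rw [List.map_cons, List.prod_cons, hB, ← unshuffleSum_one_eq hB1 hB hc a l]
    let φ : S →+ S := (zsmulAddGroupHom (α := S) (sg ((d a - 1) * d b))).comp
      (AddMonoidHom.mulLeft (g b))
    have hφ : ∀ s, φ s = sg ((d a - 1) * d b) • (g b * s) := fun _ ↦ rfl
    rw [← hφ, map_unshuffleSum, unshuffleSum, unshuffleSum]
    congr 2
    funext h t
    rw [hφ]
    rcases h with _ | ⟨e, _ | ⟨f, h⟩⟩
    · simp
    · simp only [List.map_cons, List.prod_cons, List.map_nil, List.sum_cons, List.sum_nil, add_zero]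
      rw [← mul_assoc, hc, smul_mul_assoc, smul_smul, mul_assoc]
      congr 1
      generalize d a = p, d b = q, d e = r
      by_cases hp : Even p <;> by_cases hq : Even q <;> by_cases hr : Even r <;>
      simp [sg, Int.even_add, Int.even_sub, Int.even_mul, -Int.not_even_iff_odd,
        ← Int.not_even_iff_odd, hp, hq, hr]
    · simp

/-- Either the first letter is selected, and its partner is found by `unshuffleSum_one_eq`, or it is
not, and then it is moved to the front of the remaining product, which gives the second term of
`pairSum`. -/
theorem unshuffleSum_two_eq (hB1 : ∀ a, B a 1 = 0)
    (hB : ∀ a b s, B a (g b * s) = c a b * s + sg ((d a - 1) * d b) • (g b * B a s))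
    (hc : ∀ a b e, c a b * g e = sg ((d a + d b - 1) * d e) • (g e * c a b)) :
    ∀ l : List α, unshuffleSum d 2 l (fun h t ↦ match h with
      | [a, b] => c a b * (t.map g).prod
      | _ => 0) = pairSum d g B l
  | [] => rfl
  | a :: l => by
    rw [pairSum, ← unshuffleSum_two_eq hB1 hB hc l, ← unshuffleSum_one_eq d g c B hB1 hB hc a l]
    let φ : S →+ S := (zsmulAddGroupHom (α := S) (sg (d a))).comp (AddMonoidHom.mulLeft (g a))
    have hφ : ∀ s, φ s = sg (d a) • (g a * s) := fun _ ↦ rfl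
    rw [← hφ, map_unshuffleSum, unshuffleSum]
    congr 2
    · funext h t
      rcases h with _ | ⟨e, _ | ⟨f, h⟩⟩ <;> rfl
    · funext h t
      rw [hφ]
      rcases h with _ | ⟨e, _ | ⟨f, _ | ⟨f', h⟩⟩⟩
      · simp
      · simp
      · simp only [List.map_cons, List.prod_cons, List.map_nil, List.sum_cons, List.sum_nil,
          add_zero]
        rw [← mul_assoc, hc, smul_mul_assoc, smul_smul, mul_assoc]
        congr 1
        generalize d a = p, d f = q, d e = r
        by_cases hp : Even p <;> by_cases hq : Even q <;> by_cases hr : Even r <;>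
        simp [sg, Int.even_add, Int.even_sub, Int.even_mul, -Int.not_even_iff_odd,
          ← Int.not_even_iff_odd, hp, hq, hr]
      · simp

/-- The data `g`, `c`, `B` stay abstract because two instances are needed: the exterior algebra,
which gives ν_r, and the graded symmetric algebra, which gives ν̂₂. -/
theorem sum_isUnshuffle_two (hB1 : ∀ a, B a 1 = 0)
    (hB : ∀ a b s, B a (g b * s) = c a b * s + sg ((d a - 1) * d b) • (g b * B a s))
    (hc : ∀ a b e, c a b * g e = sg ((d a + d b - 1) * d e) • (g e * c a b)) {r : ℕ}
    (z : Fin (r + 2) → α) :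
    ∑ σ : Equiv.Perm (Fin (r + 2)) with IsUnshuffle 2 σ, koszulSign (fun a ↦ d (z a)) σ •
      (c (z (σ 0)) (z (σ 1)) * (List.ofFn fun i : Fin r ↦ g (z (σ i.succ.succ))).prod) =
      pairSum d g B (List.ofFn z) := by
  rw [← unshuffleSum_two_eq d g c B hB1 hB hc, ← sum_isUnshuffle d (r + 2) 2 (by omega)]
  refine Finset.sum_congr rfl fun σ _ ↦ ?_
  congr 1
  simp only [List.ofFn_succ, List.take_succ_cons, List.take_zero, List.drop_succ_cons,
    List.drop_zero, List.map_ofFn]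
  rfl

end PairSums

/-! ### Induction and recursive definitions on the graded symmetric algebra. -/

section GradedSymmetric

variable {U : Type*} [AddCommGroup U] [Module ℝ U] (V : ℤ → Submodule ℝ U)

namespace GSym

/-- The projection of the tensor algebra to `S V`. -/
noncomputable def proj : TensorAlgebra ℝ (DirectSum ℤ fun k ↦ V k) →ₐ[ℝ] GSym V :=
  RingQuot.mkAlgHom ℝ (GSymRel V)

/-- The inclusion of `V k` in `S V` as a linear map. -/
noncomputable def incₗ (k : ℤ) : V k →ₗ[ℝ] GSym V :=
  (proj V).toLinearMap ∘ₗ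
    TensorAlgebra.ι ℝ ∘ₗ DirectSum.lof ℝ ℤ (fun k ↦ V k) k

theorem inc_add {k : ℤ} (v w : V k) : inc V k (v + w) = inc V k v + inc V k w :=
  (incₗ V k).map_add v w

theorem inc_smul {k : ℤ} (a : ℝ) (v : V k) : inc V k (a • v) = a • inc V k v :=
  (incₗ V k).map_smul a v

theorem inc_zsmul {k : ℤ} (a : ℤ) (v : V k) : inc V k (a • v) = a • inc V k v :=
  map_zsmul (incₗ V k) a v

theorem inc_congr {k l : ℤ} {v : V k} {w : V l} (h : k = l) (hv : (v : U) = w) :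
    inc V k v = inc V l w := by
  subst h
  rw [Subtype.ext hv]

theorem inc_comm {p q : ℤ} (v : V p) (w : V q) :
    inc V p v * inc V q w = sg (p * q) • (inc V q w * inc V p v) := by
  have h := RingQuot.mkAlgHom_rel ℝ (GSymRel.comm (V := V) p q v w)
  rw [map_mul, map_zsmul, map_mul, coe_negOnePow] at h
  exact h

theorem inc_mul_inc_mul {p q : ℤ} (v : V p) (w : V q) (s : GSym V) :
    inc V p v * (inc V q w * s) = sg (p * q) • (inc V q w * (inc V p v * s)) := by
  rw [← mul_assoc, inc_comm, smul_mul_assoc, mul_assoc]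

/-- Products are built up by one factor on the left, matching the recursions for derivations and for
the codifferential. -/
theorem induction {P : GSym V → Prop} (one : P 1) (add : ∀ s t, P s → P t → P (s + t))
    (smul : ∀ (a : ℝ) s, P s → P (a • s)) (inc_mul : ∀ k (v : V k) s, P s → P (inc V k v * s))
    (s : GSym V) : P s := by
  have zero : P 0 := by simpa using smul 0 1 one
  have key : ∀ (t : TensorAlgebra ℝ (DirectSum ℤ fun k ↦ V k)) (s : GSym V), P s →
      P (proj V t * s) := by
    intro t
    induction t using TensorAlgebra.induction with
    | algebraMap a =>
      intro s hs
      rw [AlgHom.commutes]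
      rw [← Algebra.smul_def]
      exact smul a s hs
    | ι x =>
      intro s hs
      induction x using DirectSum.induction_on with
      | zero => rw [map_zero, map_zero, zero_mul]; exact zero
      | of k v => exact inc_mul k v s hs
      | add x y hx hy => rw [map_add, map_add, add_mul]; exact add _ _ hx hy
    | mul a b ha hb =>
      intro s hs
      rw [map_mul, mul_assoc]
      exact ha _ (hb _ hs)
    | add a b ha hb =>
      intro s hs
      rw [map_add, add_mul]
      exact add _ _ (ha _ hs) (hb _ hs)
  obtain ⟨t, rfl⟩ := RingQuot.mkAlgHom_surjective ℝ (GSymRel V) s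
  have := key t 1 one
  rwa [mul_one] at this

/-- The algebra morphism on `S V` given by linear maps on the spaces `V k` whose values commute in
the graded sense. -/
noncomputable def liftHom {R : Type*} [Ring R] [Algebra ℝ R] (f : ∀ k, V k →ₗ[ℝ] R)
    (h : ∀ (p q : ℤ) (v : V p) (w : V q), f p v * f q w = sg (p * q) • (f q w * f p v)) :
    GSym V →ₐ[ℝ] R :=
  RingQuot.liftAlgHom ℝ ⟨TensorAlgebra.lift ℝ (DirectSum.toModule ℝ ℤ R f), by
    rintro _ _ ⟨p, q, v, w⟩
    rw [map_mul, map_zsmul, map_mul, TensorAlgebra.lift_ι_apply, TensorAlgebra.lift_ι_apply,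
      DirectSum.toModule_lof, DirectSum.toModule_lof, coe_negOnePow]
    exact h p q v w⟩

theorem liftHom_inc {R : Type*} [Ring R] [Algebra ℝ R] (f : ∀ k, V k →ₗ[ℝ] R)
    (h : ∀ (p q : ℤ) (v : V p) (w : V q), f p v * f q w = sg (p * q) • (f q w * f p v)) (k : ℤ)
    (v : V k) : liftHom V f h (inc V k v) = f k v := by
  refine (RingQuot.liftAlgHom_mkAlgHom_apply ℝ _ _ _).trans ?_
  rw [TensorAlgebra.lift_ι_apply, DirectSum.toModule_lof]

section Twisted

variable (e : ∀ k, V k →ₗ[ℝ] GSym V →ₗ[ℝ] GSym V) (ε : ℤ → ℤ)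

/-- The action `(s, t) ↦ (v s, e(v, s) + ε v t)` of `v ∈ V k` on `S V × S V`. -/
noncomputable def twistStep (k : ℤ) : V k →ₗ[ℝ] Module.End ℝ (GSym V × GSym V) :=
  LinearMap.mk₂ ℝ (fun v w ↦ (inc V k v * w.1, e k v w.1 + ε k • (inc V k v * w.2)))
    (fun v v' w ↦ Prod.ext (by simp [inc_add, add_mul])
      (by simp only [inc_add, add_mul, map_add, LinearMap.add_apply, smul_add, Prod.snd_add]; abel))
    (fun a v w ↦ Prod.ext (by simp [inc_smul])
      (by simp only [inc_smul, map_smul, LinearMap.smul_apply, smul_mul_assoc, Prod.smul_snd,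
            smul_add, smul_comm (ε k) a]))
    (fun v w w' ↦ Prod.ext (by simp [mul_add])
      (by simp only [Prod.fst_add, Prod.snd_add, mul_add, map_add, smul_add]; abel))
    (fun a v w ↦ Prod.ext (by simp)
      (by simp only [Prod.smul_fst, Prod.smul_snd, map_smul, mul_smul_comm, smul_add,
            smul_comm (ε k) a]))

theorem twistStep_apply (k : ℤ) (v : V k) (w : GSym V × GSym V) :
    twistStep V e ε k v w = (inc V k v * w.1, e k v w.1 + ε k • (inc V k v * w.2)) := rfl

variable (h : ∀ (p q : ℤ) (v : V p) (w : V q) (s : GSym V),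
  e p v (inc V q w * s) + ε p • (inc V p v * e q w s) =
    sg (p * q) • (e q w (inc V p v * s) + ε q • (inc V q w * e p v s)))

-- The hypothesis `h` is precisely graded commutativity of the operators in the second component, so
-- they define an action of S V; the recursion for `twistMap` is read off from the orbit of (1, 0).
include h in
theorem twistStep_comm (p q : ℤ) (v : V p) (w : V q) :
    twistStep V e ε p v * twistStep V e ε q w =
      sg (p * q) • (twistStep V e ε q w * twistStep V e ε p v) := by
  refine LinearMap.ext fun u ↦ Prod.ext ?_ ?_
  · change inc V p v * (inc V q w * u.1) = sg (p * q) • (inc V q w * (inc V p v * u.1))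
    exact inc_mul_inc_mul V v w u.1
  · change e p v (inc V q w * u.1) + ε p • (inc V p v * (e q w u.1 + ε q • (inc V q w * u.2))) =
      sg (p * q) • (e q w (inc V p v * u.1) +
        ε q • (inc V q w * (e p v u.1 + ε p • (inc V p v * u.2))))
    rw [mul_add, smul_add, ← add_assoc, h, mul_add, smul_add, smul_add, smul_add, smul_add,
      add_assoc, mul_smul_comm, inc_mul_inc_mul, mul_smul_comm]
    congr 2
    simp only [smul_smul]
    congr 1
    ring

/-- The linear map `T` on `S V` with `T 1 = 0` and `T (v s) = e(v, s) + ε v T(s)` for `v ∈ V k`. -/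
noncomputable def twistMap : GSym V →ₗ[ℝ] GSym V :=
  LinearMap.snd ℝ _ _ ∘ₗ LinearMap.applyₗ ((1, 0) : GSym V × GSym V) ∘ₗ
    (liftHom V (twistStep V e ε) (twistStep_comm V e ε h)).toLinearMap

theorem twistMap_one : twistMap V e ε h 1 = 0 := by
  simp [twistMap]

theorem twistMap_inc_mul (k : ℤ) (v : V k) (s : GSym V) :
    twistMap V e ε h (inc V k v * s) = e k v s + ε k • (inc V k v * twistMap V e ε h s) := by
  -- The first component of the action on (1, 0) recovers `s`.
  have h1 : ∀ s : GSym V, (liftHom V (twistStep V e ε) (twistStep_comm V e ε h) s (1, 0)).1 = s := by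
    intro s
    induction s using induction with
    | one => simp
    | add s t hs ht => rw [map_add, LinearMap.add_apply, Prod.fst_add, hs, ht]
    | smul a s hs => rw [map_smul, LinearMap.smul_apply, Prod.smul_fst, hs]
    | inc_mul k v s hs =>
      rw [map_mul, liftHom_inc, Module.End.mul_apply, twistStep_apply, hs]
  change (liftHom V (twistStep V e ε) (twistStep_comm V e ε h) (inc V k v * s) (1, 0)).2 = _
  rw [map_mul, liftHom_inc, Module.End.mul_apply, twistStep_apply, h1]
  rfl

end Twisted

end GSym

end GradedSymmetric


/-! ### The codifferential of a shifted graded Lie algebra. -/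

section Codifferential

variable {U : Type*} [AddCommGroup U] [Module ℝ U] {V : ℤ → Submodule ℝ U}

/-- A graded Lie bracket in its graded symmetric form of degree `-1`. -/
structure IsShiftedLie (β : ∀ p q, V p →ₗ[ℝ] V q →ₗ[ℝ] V (p + q - 1)) : Prop where
  symm : ∀ (p q : ℤ) (x : V p) (y : V q), (β p q x y : U) = sg (p * q) • (β q p y x : U)
  jacobi : ∀ (p q r : ℤ) (x : V p) (y : V q) (z : V r),
    (β _ r (β p q x y) z : U) + sg ((p - 1) * q) • (β q _ y (β p r x z) : U) +
      sg p • (β p _ x (β q r y z) : U) = 0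

namespace GSym

variable (β : ∀ p q, V p →ₗ[ℝ] V q →ₗ[ℝ] V (p + q - 1))

/-- The inhomogeneous term `(v, s) ↦ [x, v] s` of the derivation `[x, -]` of `S V`. -/
noncomputable def adTerm {p : ℤ} (x : V p) (k : ℤ) : V k →ₗ[ℝ] GSym V →ₗ[ℝ] GSym V :=
  LinearMap.mul ℝ (GSym V) ∘ₗ incₗ V (p + k - 1) ∘ₗ β p k x

theorem adTerm_apply {p : ℤ} (x : V p) (k : ℤ) (v : V k) (s : GSym V) :
    adTerm β x k v s = inc V (p + k - 1) (β p k x v) * s := rfl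

/-- Well-definedness of the derivation [x, -]: its Leibniz rule respects the relation v w = ± w v.
No property of the bracket besides its degree enters. -/
theorem adTerm_comm {p : ℤ} (x : V p) (a b : ℤ) (v : V a) (w : V b) (s : GSym V) :
    adTerm β x a v (inc V b w * s) + sg ((p - 1) * a) • (inc V a v * adTerm β x b w s) =
      sg (a * b) • (adTerm β x b w (inc V a v * s) +
        sg ((p - 1) * b) • (inc V b w * adTerm β x a v s)) := by
  simp only [adTerm_apply]
  rw [inc_mul_inc_mul V _ w, inc_mul_inc_mul V _ v, smul_add, smul_smul, smul_smul, add_comm]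
  congr 2
  · by_cases hp : Even p <;> by_cases ha : Even a <;> by_cases hb : Even b <;>
    simp [sg, Int.even_add, Int.even_sub, Int.even_mul, -Int.not_even_iff_odd,
      ← Int.not_even_iff_odd, hp, ha, hb]
  · by_cases hp : Even p <;> by_cases ha : Even a <;> by_cases hb : Even b <;>
    simp [sg, Int.even_add, Int.even_sub, Int.even_mul, -Int.not_even_iff_odd,
      ← Int.not_even_iff_odd, hp, ha, hb]

/-- The derivation `[x, -]` of `S V` that extends the bracket with `x ∈ V p`. -/
noncomputable def ad {p : ℤ} (x : V p) : GSym V →ₗ[ℝ] GSym V :=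
  twistMap V (adTerm β x) (fun k ↦ sg ((p - 1) * k)) (adTerm_comm β x)

theorem ad_one {p : ℤ} (x : V p) : ad β x 1 = 0 := twistMap_one ..

theorem ad_inc_mul {p k : ℤ} (x : V p) (v : V k) (s : GSym V) :
    ad β x (inc V k v * s) = inc V (p + k - 1) (β p k x v) * s +
      sg ((p - 1) * k) • (inc V k v * ad β x s) :=
  twistMap_inc_mul ..

theorem ad_add {p : ℤ} (x y : V p) (s : GSym V) : ad β (x + y) s = ad β x s + ad β y s := by
  induction s using induction with
  | one => simp [ad_one]
  | add s t hs ht => rw [map_add, map_add, map_add, hs, ht]; abel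
  | smul a s hs => rw [map_smul, hs, map_smul, map_smul, smul_add]
  | inc_mul k v s hs =>
    rw [ad_inc_mul, ad_inc_mul, ad_inc_mul, hs, map_add, LinearMap.add_apply, inc_add, add_mul,
      mul_add, smul_add]
    abel

theorem ad_smul {p : ℤ} (a : ℝ) (x : V p) (s : GSym V) : ad β (a • x) s = a • ad β x s := by
  induction s using induction with
  | one => simp [ad_one]
  | add s t hs ht => rw [map_add, map_add, hs, ht, smul_add]
  | smul a s hs => rw [map_smul, hs, map_smul, smul_comm]
  | inc_mul k v s hs =>
    rw [ad_inc_mul, ad_inc_mul, hs, map_smul, LinearMap.smul_apply, inc_smul, smul_add,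
      smul_mul_assoc, mul_smul_comm, smul_comm a]

/-- `ad` as a bilinear map. -/
noncomputable def adₗ (p : ℤ) : V p →ₗ[ℝ] GSym V →ₗ[ℝ] GSym V :=
  LinearMap.mk₂ ℝ (fun x s ↦ ad β x s) (ad_add β) (ad_smul β) (fun _ ↦ map_add _)
    (fun a _ s ↦ map_smul _ a s)

theorem adₗ_apply (p : ℤ) (x : V p) (s : GSym V) : adₗ β p x s = ad β x s := rfl

variable {β} (hβ : IsShiftedLie β)

-- Well-definedness of the codifferential. It is the symmetry of the bracket that matters here, not
-- the Jacobi identity.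
include hβ in
theorem adₗ_comm (p q : ℤ) (v : V p) (w : V q) (s : GSym V) :
    adₗ β p v (inc V q w * s) + sg p • (inc V p v * adₗ β q w s) =
      sg (p * q) • (adₗ β q w (inc V p v * s) + sg q • (inc V q w * adₗ β p v s)) := by
  have h : inc V (p + q - 1) (β p q v w) = sg (p * q) • inc V (q + p - 1) (β q p w v) := by
    rw [← inc_zsmul]
    exact inc_congr V (by ring) (hβ.symm p q v w)
  simp only [adₗ_apply]
  rw [ad_inc_mul, ad_inc_mul, h, smul_mul_assoc, add_assoc, add_assoc, smul_add]
  congr 1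
  rw [add_comm, smul_add, smul_smul, smul_smul]
  congr 2 <;>
  by_cases hp : Even p <;> by_cases hq : Even q <;>
  simp [sg, Int.even_add, Int.even_sub, Int.even_mul, -Int.not_even_iff_odd,
    ← Int.not_even_iff_odd, hp, hq]

/-- The codifferential of `S V`, with `D (v s) = [v, s] + (-1)^{|v|} v D(s)`. -/
noncomputable def codiff : GSym V →ₗ[ℝ] GSym V :=
  twistMap V (adₗ β) sg (adₗ_comm hβ)

theorem codiff_one : codiff hβ 1 = 0 := twistMap_one ..

theorem codiff_inc_mul {k : ℤ} (v : V k) (s : GSym V) :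
    codiff hβ (inc V k v * s) = ad β v s + sg k • (inc V k v * codiff hβ s) :=
  twistMap_inc_mul ..

-- Each composite is governed by the Leibniz rule on v s: mixed terms cancel, and the terms on `v`
-- vanish by the Jacobi identity in V.
include hβ in
theorem ad_jacobi {p q : ℤ} (x : V p) (y : V q) (s : GSym V) :
    ad β (β p q x y) s + sg ((p - 1) * q) • ad β y (ad β x s) + sg p • ad β x (ad β y s) = 0 := by
  induction s using induction with
  | one => simp [ad_one]
  | add s t hs ht =>
    simp only [map_add, smul_add]
    rw [← add_zero (0 : GSym V)]
    nth_rw 1 [← hs]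
    rw [← ht]
    abel
  | smul a s hs =>
    simp only [map_smul]
    rw [smul_comm _ a, smul_comm _ a, ← smul_add, ← smul_add, hs, smul_zero]
  | inc_mul r v s hs =>
    have h : inc V (p + q - 1 + r - 1) (β _ r (β p q x y) v) +
        sg ((p - 1) * q) • inc V (q + (p + r - 1) - 1) (β q _ y (β p r x v)) +
        sg p • inc V (p + (q + r - 1) - 1) (β p _ x (β q r y v)) = 0 := by
      have h1 := hβ.jacobi p q r x y v
      -- The three double brackets lie in spaces whose degrees agree only after rearrangement; they
      -- are moved into one space before the Jacobi identity is applied.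
      have e1 : V (q + (p + r - 1) - 1) = V (p + q - 1 + r - 1) := congrArg V (by ring)
      have e2 : V (p + (q + r - 1) - 1) = V (p + q - 1 + r - 1) := congrArg V (by ring)
      rw [inc_congr V (w := ⟨β q _ y (β p r x v), e1 ▸ (β q _ y (β p r x v)).2⟩)
          (by ring : q + (p + r - 1) - 1 = p + q - 1 + r - 1) rfl,
        inc_congr V (w := ⟨β p _ x (β q r y v), e2 ▸ (β p _ x (β q r y v)).2⟩)
          (by ring : p + (q + r - 1) - 1 = p + q - 1 + r - 1) rfl, ← inc_zsmul, ← inc_zsmul,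
        ← inc_add, ← inc_add]
      have : β _ r (β p q x y) v + sg ((p - 1) * q) •
            (⟨β q _ y (β p r x v), e1 ▸ (β q _ y (β p r x v)).2⟩ : V (p + q - 1 + r - 1)) +
          sg p • (⟨β p _ x (β q r y v), e2 ▸ (β p _ x (β q r y v)).2⟩ :
            V (p + q - 1 + r - 1)) = 0 := Subtype.ext h1
      rw [this]
      exact (incₗ V _).map_zero
    rw [ad_inc_mul, ad_inc_mul, ad_inc_mul, map_add, map_add, map_zsmul, map_zsmul, ad_inc_mul,
      ad_inc_mul, ad_inc_mul, ad_inc_mul]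
    have h2 : ad β (β p q x y) s = - (sg ((p - 1) * q) • ad β y (ad β x s)) -
        sg p • ad β x (ad β y s) := by
      rw [← sub_eq_zero, ← hs]; abel
    have h3 : inc V (p + q - 1 + r - 1) (β _ r (β p q x y) v) =
        - (sg ((p - 1) * q) • inc V (q + (p + r - 1) - 1) (β q _ y (β p r x v))) -
        sg p • inc V (p + (q + r - 1) - 1) (β p _ x (β q r y v)) := by
      rw [← sub_eq_zero, ← h]; abel
    rw [h2, h3]
    simp only [add_mul, sub_mul, neg_mul, mul_sub, mul_neg, smul_add, smul_sub, smul_neg,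
      smul_mul_assoc, mul_smul_comm, smul_smul]
    match_scalars <;>
    by_cases hp : Even p <;> by_cases hq : Even q <;> by_cases hr : Even r <;>
    simp [sg, Int.even_add, Int.even_sub, Int.even_mul, -Int.not_even_iff_odd,
      ← Int.not_even_iff_odd, hp, hq, hr]

/-- The codifferential anticommutes with the derivations `[x, -]`. -/
theorem codiff_ad {p : ℤ} (x : V p) (s : GSym V) :
    codiff hβ (ad β x s) = - (sg p • ad β x (codiff hβ s)) := by
  induction s using induction with
  | one => simp [ad_one, codiff_one]
  | add s t hs ht => simp only [map_add, smul_add, hs, ht]; abel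
  | smul a s hs => rw [map_smul, map_smul, map_smul, hs, map_smul, smul_neg, smul_comm a]
  | inc_mul k v s hs =>
    have h := ad_jacobi hβ x v s
    have h2 : ad β (β p k x v) s = - (sg ((p - 1) * k) • ad β v (ad β x s)) -
        sg p • ad β x (ad β v s) := by
      rw [← sub_eq_zero, ← h]; abel
    rw [ad_inc_mul, map_add, map_zsmul, codiff_inc_mul, codiff_inc_mul, codiff_inc_mul, map_add,
      map_zsmul, ad_inc_mul, hs, h2]
    simp only [mul_sub, mul_neg, mul_add, smul_add, smul_sub, smul_neg, mul_smul_comm, smul_smul]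
    match_scalars <;>
    by_cases hp : Even p <;> by_cases hk : Even k <;>
    simp [sg, Int.even_add, Int.even_sub, Int.even_mul, -Int.not_even_iff_odd,
      ← Int.not_even_iff_odd, hp, hk]

/-- On v s, D[v, s] cancels against [v, D s] because D anticommutes with [v, -]; the rest is v
D²(s). -/
theorem codiff_codiff (s : GSym V) : codiff hβ (codiff hβ s) = 0 := by
  induction s using induction with
  | one => simp [codiff_one]
  | add s t hs ht => rw [map_add, map_add, hs, ht, add_zero]
  | smul a s hs => rw [map_smul, map_smul, hs, smul_zero]
  | inc_mul k v s hs =>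
    rw [codiff_inc_mul, map_add, map_zsmul, codiff_ad, codiff_inc_mul, hs, mul_zero, smul_zero,
      add_zero, neg_add_cancel]

variable (V) in
/-- The product in `S V` of a list of homogeneous elements. -/
noncomputable def prodList (l : List (Σ k, V k)) : GSym V := (l.map fun a ↦ inc V a.1 a.2).prod

theorem prodList_cons (a : Σ k, V k) (l : List (Σ k, V k)) :
    prodList V (a :: l) = inc V a.1 a.2 * prodList V l := by
  rw [prodList, List.map_cons, List.prod_cons]; rfl

theorem prod_eq_prodList {r : ℕ} (p : Fin r → ℤ) (x : (i : Fin r) → V (p i)) :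
    prod V p x = prodList V (List.ofFn fun i ↦ ⟨p i, x i⟩) := by
  rw [prodList, List.map_ofFn]; rfl

theorem codiff_prodList (l : List (Σ k, V k)) :
    codiff hβ (prodList V l) =
      pairSum (fun a : Σ k, V k ↦ a.1) (fun a ↦ inc V a.1 a.2) (fun a ↦ ad β a.2) l := by
  induction l with
  | nil => exact codiff_one hβ
  | cons a l ih => rw [prodList_cons, codiff_inc_mul, ih]; rfl

theorem sum_isUnshuffle_codiff {r : ℕ} (z : Fin (r + 2) → Σ k, V k) :
    ∑ σ : Equiv.Perm (Fin (r + 2)) with IsUnshuffle 2 σ, koszulSign (fun a ↦ (z a).1) σ •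
      (inc V _ (β _ _ (z (σ 0)).2 (z (σ 1)).2) *
        (List.ofFn fun i : Fin r ↦ inc V _ (z (σ i.succ.succ)).2).prod) =
      codiff hβ (prodList V (List.ofFn z)) := by
  rw [codiff_prodList]
  exact sum_isUnshuffle_two (fun a : Σ k, V k ↦ a.1) (fun a ↦ inc V a.1 a.2)
    (fun a b ↦ inc V _ (β _ _ a.2 b.2)) (fun a ↦ ad β a.2) (fun a ↦ ad_one β a.2)
    (fun a b s ↦ ad_inc_mul β a.2 b.2 s) (fun a b e ↦ inc_comm V _ e.2) z

theorem prodList_mem_deg (l : List (Σ k, V k)) :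
    prodList V l ∈ deg V (l.map fun a ↦ a.1).sum := by
  refine Submodule.subset_span ⟨l.length, fun i ↦ (l.get i).1, fun i ↦ (l.get i).2, ?_, ?_⟩
  · rw [← List.sum_ofFn]
    congr 1
    conv_rhs => rw [← List.ofFn_get l, List.map_ofFn]
    rfl
  · rw [prod_eq_prodList]
    congr 1
    exact (List.ofFn_get l).symm

theorem deg_induction {k : ℤ} {P : GSym V → Prop} (zero : P 0)
    (add : ∀ s t, P s → P t → P (s + t)) (smul : ∀ (a : ℝ) s, P s → P (a • s))
    (prodList : ∀ l : List (Σ k, V k), (l.map fun a ↦ a.1).sum = k → P (prodList V l)) {s : GSym V}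
    (hs : s ∈ deg V k) : P s := by
  induction hs using Submodule.span_induction with
  | mem s hs =>
    obtain ⟨r, p, x, hk, rfl⟩ := hs
    rw [prod_eq_prodList]
    refine prodList _ ?_
    rw [List.map_ofFn, List.sum_ofFn, ← hk]
    rfl
  | zero => exact zero
  | add s t _ _ hs ht => exact add s t hs ht
  | smul a s _ hs => exact smul a s hs

theorem inc_mul_mem_deg {k l : ℤ} (v : V k) {s : GSym V} (hs : s ∈ deg V l) :
    inc V k v * s ∈ deg V (k + l) := by
  refine deg_induction (P := fun s ↦ inc V k v * s ∈ deg V (k + l)) ?_ (fun s t hs ht ↦ ?_)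
    (fun a s hs ↦ ?_) (fun L hL ↦ ?_) hs
  · rw [mul_zero]; exact zero_mem _
  · rw [mul_add]; exact add_mem hs ht
  · rw [mul_smul_comm]; exact Submodule.smul_mem _ a hs
  · have := prodList_mem_deg (⟨k, v⟩ :: L : List (Σ k, V k))
    rwa [prodList_cons, List.map_cons, List.sum_cons, hL] at this

theorem ad_prodList_mem_deg {p : ℤ} (x : V p) (l : List (Σ k, V k)) :
    ad β x (prodList V l) ∈ deg V (p + (l.map fun a ↦ a.1).sum - 1) := by
  induction l with
  | nil =>
    have : ad β x (prodList V []) = 0 := ad_one β x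
    rw [this]; exact zero_mem _
  | cons a l ih =>
    rw [prodList_cons, ad_inc_mul, List.map_cons, List.sum_cons]
    refine add_mem ?_ (zsmul_mem ?_ _)
    · convert inc_mul_mem_deg (β p a.1 x a.2) (prodList_mem_deg l) using 2
      ring
    · convert inc_mul_mem_deg a.2 ih using 2
      ring

theorem codiff_mem_deg {k : ℤ} {s : GSym V} (hs : s ∈ deg V k) :
    codiff hβ s ∈ deg V (k - 1) := by
  refine deg_induction (P := fun s ↦ codiff hβ s ∈ deg V (k - 1)) ?_ (fun s t hs ht ↦ ?_)
    (fun a s hs ↦ ?_) (fun l hl ↦ ?_) hs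
  · rw [map_zero]; exact zero_mem _
  · rw [map_add]; exact add_mem hs ht
  · rw [map_smul]; exact Submodule.smul_mem _ a hs
  · subst hl
    clear hs
    induction l with
    | nil =>
      have : codiff hβ (prodList V []) = 0 := codiff_one hβ
      rw [this]; exact zero_mem _
    | cons a l ih =>
      rw [prodList_cons, codiff_inc_mul, List.map_cons, List.sum_cons]
      refine add_mem (ad_prodList_mem_deg a.2 l) (zsmul_mem ?_ _)
      convert inc_mul_mem_deg a.2 ih using 2
      ring

end GSym

end Codifferential


/-! ### Sums over all splittings into two blocks. -/

section FullUnshuffleSums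

variable {α W W' : Type*} [AddCommGroup W] [AddCommGroup W'] (d : α → ℤ)

/-- The signed sum of `G h t` over all unshuffles of the list `l` into two lists `h` and `t`. -/
def splitSum : List α → (List α → List α → W) → W
  | [], G => G [] []
  | a :: l, G => splitSum l (fun h t ↦ G (a :: h) t) +
      splitSum l (fun h t ↦ sg (d a * (h.map d).sum) • G h (a :: t))

theorem map_splitSum (φ : W →+ W') : ∀ (l : List α) (G : List α → List α → W),
    φ (splitSum d l G) = splitSum d l fun h t ↦ φ (G h t)
  | [], G => rfl
  | a :: l, G => by simp only [splitSum, map_add, map_splitSum φ l, map_zsmul]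

theorem splitSum_add : ∀ (l : List α) (G G' : List α → List α → W),
    splitSum d l (fun h t ↦ G h t + G' h t) = splitSum d l G + splitSum d l G'
  | [], G, G' => rfl
  | a :: l, G, G' => by
    simp only [splitSum, smul_add, splitSum_add l]
    abel

theorem splitSum_zsmul (k : ℤ) (l : List α) (G : List α → List α → W) :
    splitSum d l (fun h t ↦ k • G h t) = k • splitSum d l G :=
  (map_splitSum d (zsmulAddGroupHom k : W →+ W) l G).symm

/-- Exchanging the two blocks is an involution of the splittings, at the price of the Koszul sign.
-/
theorem splitSum_swap : ∀ (l : List α) (G : List α → List α → W),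
    splitSum d l (fun h t ↦ sg ((h.map d).sum * (t.map d).sum) • G t h) = splitSum d l G
  | [], G => by simp [splitSum, sg_zero]
  | a :: l, G => by
    rw [splitSum, splitSum, ← splitSum_swap l (fun h t ↦ G (a :: h) t),
      ← splitSum_swap l (fun h t ↦ sg (d a * (h.map d).sum) • G h (a :: t)), add_comm]
    congr 2 <;> funext h t <;> rw [List.map_cons, List.sum_cons, smul_smul] <;> congr 1 <;>
    generalize d a = p, (h.map d).sum = q, (t.map d).sum = r <;>
    by_cases hp : Even p <;> by_cases hq : Even q <;> by_cases hr : Even r <;>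
    simp [sg, Int.even_add, Int.even_sub, Int.even_mul, -Int.not_even_iff_odd,
      ← Int.not_even_iff_odd, hp, hq, hr]

/-- Splittings are grouped by the length of the first block. -/
theorem sum_unshuffleSum : ∀ (l : List α) (G : List α → List α → W),
    ∑ i ∈ Finset.range (l.length + 1), unshuffleSum d i l G = splitSum d l G
  | [], G => by simp [splitSum, unshuffleSum]
  | a :: l, G => by
    rw [splitSum, ← sum_unshuffleSum l, ← sum_unshuffleSum l, List.length_cons,
      Finset.sum_range_succ']
    have h0 : unshuffleSum d 0 (a :: l) G =
        unshuffleSum d 0 l (fun h t ↦ sg (d a * (h.map d).sum) • G h (a :: t)) := by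
      simp [unshuffleSum, sg_zero]
    simp only [h0, unshuffleSum, Finset.sum_add_distrib]
    rw [add_assoc]
    congr 1
    -- The first block of `l` cannot have `l.length + 1` entries; adding this zero term aligns the
    -- shifted ranges.
    have h1 := Finset.sum_range_succ' (fun i ↦ unshuffleSum d i l
      (fun h t ↦ sg (d a * (h.map d).sum) • G h (a :: t))) (l.length + 1)
    rw [Finset.sum_range_succ, unshuffleSum_eq_zero_of_length_lt d _ l _ (Nat.lt_succ_self _),
      add_zero] at h1
    rw [h1]
    simp [unshuffleSum, sg_zero]

end FullUnshuffleSums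

/-! ### The Jacobi identities of the higher brackets in the exterior algebra. -/

section SchoutenSums

open ExteriorAlgebra

variable {A L : Type*} [CommRing A] [LieRing L] [Module A L] [LieRingModule L A]
  [LieRinehartRing A L]

theorem Homog.zsmul {p : ℤ} {x : ExteriorAlgebra A L} (k : ℤ) (hx : Homog p x) :
    Homog p (k • x) := by
  have := hx.smul (k : A)
  rwa [Int.cast_smul_eq_zsmul] at this

/-- The Leibniz rule in the first argument. -/
theorem nu_mul_left {p q r : ℤ} {x y z : ExteriorAlgebra A L} (hx : Homog p x) (hy : Homog q y)
    (hz : Homog r z) :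
    nu (x * y) z = sg p • (x * nu y z) + sg (q * r) • (nu x z * y) := by
  rw [nu_symm (hx.mul hy) hz, nu_mul_right hz hx, nu_symm hz hx, nu_symm hz hy]
  simp only [smul_add, smul_mul_assoc, mul_smul_comm, smul_smul]
  match_scalars <;>
  by_cases hp : Even p <;> by_cases hq : Even q <;> by_cases hr : Even r <;>
  simp [sg, Int.even_add, Int.even_sub, Int.even_mul, -Int.not_even_iff_odd,
    ← Int.not_even_iff_odd, hp, hq, hr]

variable {α : Type*} (d : α → ℤ) (g : α → ExteriorAlgebra A L)

/-- The bracket `ν_r` as a function of the list of its arguments. -/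
def nuList : List α → ExteriorAlgebra A L := pairSum d g fun a ↦ nu (g a)

theorem nuList_cons (a : α) (l : List α) :
    nuList d g (a :: l) = nu (g a) (l.map g).prod + sg (d a) • (g a * nuList d g l) := rfl

variable {d g} (hg : ∀ a, Homog (d a) (g a))

include hg

theorem homog_prod (l : List α) : Homog (l.map d).sum (l.map g).prod := by
  induction l with
  | nil => exact .one
  | cons a l ih => simp only [List.map_cons, List.sum_cons, List.prod_cons]; exact (hg a).mul ih

theorem homog_nuList (l : List α) : Homog ((l.map d).sum - 1) (nuList d g l) := by
  induction l with
  | nil => exact .zero _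
  | cons a l ih =>
    rw [nuList_cons, List.map_cons, List.sum_cons]
    refine ((hg a).nu (homog_prod hg l)).add (Homog.zsmul _ ?_)
    rw [add_sub_assoc]
    exact (hg a).mul ih

/-- Both sides collect the terms ν(a, b) times the remaining letters. A given pair is separated by
twice as many splittings as have it inside the first block, whence the factor 2. -/
theorem splitSum_nu_prod (l : List α) :
    splitSum d l (fun h t ↦ nu (h.map g).prod (t.map g).prod) =
      (2 : ℤ) • splitSum d l (fun h t ↦ nuList d g h * (t.map g).prod) := by
  induction l with
  | nil =>
    have : nu (1 : ExteriorAlgebra A L) 1 = 0 := by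
      simpa using nu_algebraMap_algebraMap (L := L) (1 : A) 1
    simp [splitSum, nuList, pairSum, this]
  | cons a l ih =>
    let φ : ExteriorAlgebra A L →+ ExteriorAlgebra A L := AddMonoidHom.mulLeft (g a)
    have hφ : ∀ s, φ s = g a * s := fun _ ↦ rfl
    -- The Leibniz rule is applied with `a` in either block. The last two terms are images of each
    -- other under exchanging the blocks.
    have h1 : splitSum d (a :: l) (fun h t ↦ nu (h.map g).prod (t.map g).prod) =
        splitSum d l (fun h t ↦ (2 * sg (d a)) • φ (nu (h.map g).prod (t.map g).prod) +
          (nu (g a) (h.map g).prod * (t.map g).prod +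
          sg ((h.map d).sum * (t.map d).sum) • (nu (g a) (t.map g).prod * (h.map g).prod))) := by
      rw [splitSum, ← splitSum_add]
      congr 1
      funext h t
      have hh := homog_prod hg h
      have ht := homog_prod hg t
      simp only [List.map_cons, List.prod_cons, hφ]
      rw [nu_mul_left (hg a) hh ht, nu_mul_right hh (hg a), nu_symm hh (hg a)]
      generalize (h.map d).sum = q, (t.map d).sum = r, d a = p
      simp only [smul_add, smul_mul_assoc, mul_smul_comm, smul_smul]
      match_scalars <;>
      by_cases hp : Even p <;> by_cases hq : Even q <;> by_cases hr : Even r <;>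
      simp [sg, Int.even_add, Int.even_sub, Int.even_mul, -Int.not_even_iff_odd,
        ← Int.not_even_iff_odd, hp, hq, hr]
    have h2 : splitSum d (a :: l) (fun h t ↦ nuList d g h * (t.map g).prod) =
        splitSum d l (fun h t ↦ (2 * sg (d a)) • φ (nuList d g h * (t.map g).prod) +
          nu (g a) (h.map g).prod * (t.map g).prod) := by
      rw [splitSum, ← splitSum_add]
      congr 1
      funext h t
      have hh := homog_nuList hg h
      have h3 := hh.comm (hg a)
      simp only [List.map_cons, List.prod_cons, hφ, nuList_cons]
      rw [← mul_assoc, h3]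
      generalize (h.map d).sum = q, d a = p
      simp only [add_mul, smul_mul_assoc, smul_smul, mul_assoc]
      match_scalars <;>
      by_cases hp : Even p <;> by_cases hq : Even q <;>
      simp [sg, Int.even_add, Int.even_sub, Int.even_mul, -Int.not_even_iff_odd,
        ← Int.not_even_iff_odd, hp, hq]
    rw [h1, h2, splitSum_add, splitSum_add, splitSum_add,
      splitSum_swap d l (fun h t ↦ nu (g a) (h.map g).prod * (t.map g).prod), splitSum_zsmul,
      splitSum_zsmul, ← map_splitSum, ← map_splitSum, ih, map_zsmul]
    module

/-- ν lowers the degree by one in both factors, so the summand changes sign when the blocks are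
exchanged; the sum equals its negative and vanishes without 2-torsion. -/
theorem splitSum_nuList_mul_nuList (h2 : ∀ x : ExteriorAlgebra A L, x + x = 0 → x = 0)
    (l : List α) :
    splitSum d l (fun h t ↦ sg ((h.map d).sum - 1) • (nuList d g h * nuList d g t)) = 0 := by
  have h := splitSum_swap d l
    (fun h t ↦ sg ((h.map d).sum - 1) • (nuList d g h * nuList d g t))
  have h3 : (fun h t : List α ↦ sg ((h.map d).sum * (t.map d).sum) •
      sg ((t.map d).sum - 1) • (nuList d g t * nuList d g h)) = fun h t ↦
      (-1 : ℤ) • sg ((h.map d).sum - 1) • (nuList d g h * nuList d g t) := by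
    funext h t
    rw [(homog_nuList hg t).comm (homog_nuList hg h), smul_smul, smul_smul, smul_smul]
    congr 1
    generalize (h.map d).sum = q, (t.map d).sum = r
    by_cases hq : Even q <;> by_cases hr : Even r <;>
    simp [sg, Int.even_add, Int.even_sub, Int.even_mul, -Int.not_even_iff_odd,
      ← Int.not_even_iff_odd, hq, hr]
  rw [h3, splitSum_zsmul, neg_one_smul] at h
  exact h2 _ (add_eq_zero_iff_eq_neg.2 h.symm)

/-- A new first letter `a` yields the old sum multiplied by 2 g(a), the terms ν(ν(a, ∏h), ∏t), and
the values of ν(a, -) on ν(h) ∧ ∏t. The first vanishes by induction; twice the second cancels twice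
the third by `h4` below. -/
theorem splitSum_nu_nuList (h2 : ∀ x : ExteriorAlgebra A L, x + x = 0 → x = 0) (l : List α) :
    splitSum d l (fun h t ↦ nu (nuList d g h) (t.map g).prod) = 0 := by
  induction l with
  | nil =>
    have : nu (0 : ExteriorAlgebra A L) 1 = 0 := nu_zero_left 1
    simpa [splitSum, nuList, pairSum] using this
  | cons a l ih =>
    let φ : ExteriorAlgebra A L →+ ExteriorAlgebra A L := AddMonoidHom.mulLeft (g a)
    let ψ : ExteriorAlgebra A L →+ ExteriorAlgebra A L :=
      AddMonoidHom.mk' (fun z ↦ nu (g a) z) fun y z ↦ nu_add_right _ y z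
    have hφ : ∀ s, φ s = g a * s := fun _ ↦ rfl
    have hψ : ∀ s, ψ s = nu (g a) s := fun _ ↦ rfl
    have h1 : splitSum d (a :: l) (fun h t ↦ nu (nuList d g h) (t.map g).prod) =
        splitSum d l (fun h t ↦ (2 : ℤ) • φ (nu (nuList d g h) (t.map g).prod) +
          (nu (nu (g a) (h.map g).prod) (t.map g).prod +
          sg (d a) • ψ (nuList d g h * (t.map g).prod))) := by
      rw [splitSum, ← splitSum_add]
      congr 1
      funext h t
      have hh := homog_prod hg h
      have ht := homog_prod hg t
      have hn := homog_nuList hg h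
      simp only [List.map_cons, List.prod_cons, hφ, hψ, nuList_cons]
      rw [nu_add_left, nu_zsmul_left, nu_mul_left (hg a) hn ht, nu_mul_right hn (hg a),
        nu_mul_right (hg a) hn, (hn.nu (hg a)).comm ht, nu_symm hn (hg a), hn.comm ((hg a).nu ht),
        ((hg a).nu hn).comm ht]
      generalize (h.map d).sum = q, (t.map d).sum = r, d a = p
      simp only [smul_add, smul_mul_assoc, mul_smul_comm, smul_smul]
      match_scalars <;>
      by_cases hp : Even p <;> by_cases hq : Even q <;> by_cases hr : Even r <;>
      simp [sg, Int.even_add, Int.even_sub, Int.even_mul, -Int.not_even_iff_odd,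
        ← Int.not_even_iff_odd, hp, hq, hr]
    -- Symmetrizing over the two blocks completes ν(ν(a, ∏h), ∏t) to two of the three Jacobi terms;
    -- the third is ν(a, ν(∏h, ∏t)), and `splitSum_nu_prod` evaluates its sum.
    have h4 : splitSum d l (fun h t ↦ nu (nu (g a) (h.map g).prod) (t.map g).prod) +
        splitSum d l (fun h t ↦ nu (nu (g a) (h.map g).prod) (t.map g).prod) =
        splitSum d l (fun h t ↦ -(sg (d a)) • ψ (nu (h.map g).prod (t.map g).prod)) := by
      nth_rw 1 [← splitSum_swap]
      rw [← splitSum_add]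
      congr 1
      funext h t
      have hh := homog_prod hg h
      have ht := homog_prod hg t
      have hJ := jacobiator_eq_zero (hg a) hh ht
      rw [jacobiator, nu_symm hh ((hg a).nu ht)] at hJ
      rw [hψ, neg_smul, ← sub_eq_zero, ← hJ]
      generalize (h.map d).sum = q, (t.map d).sum = r, d a = p
      simp only [smul_add, smul_mul_assoc, mul_smul_comm, smul_smul]
      match_scalars <;>
      by_cases hp : Even p <;> by_cases hq : Even q <;> by_cases hr : Even r <;>
      simp [sg, Int.even_add, Int.even_sub, Int.even_mul, -Int.not_even_iff_odd,
        ← Int.not_even_iff_odd, hp, hq, hr]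
    rw [splitSum_zsmul, ← map_splitSum, splitSum_nu_prod hg, map_zsmul] at h4
    rw [h1, splitSum_add, splitSum_add, splitSum_zsmul, splitSum_zsmul, ← map_splitSum,
      ← map_splitSum, ih, map_zero, smul_zero, zero_add]
    refine h2 _ ?_
    rw [add_add_add_comm, h4]
    module

/-- The total Jacobi identity for the brackets `ν_r`. -/
theorem splitSum_nuList_cons (h2 : ∀ x : ExteriorAlgebra A L, x + x = 0 → x = 0) (l : List α) :
    splitSum d l (fun h t ↦ nu (nuList d g h) (t.map g).prod +
      sg ((h.map d).sum - 1) • (nuList d g h * nuList d g t)) = 0 := by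
  rw [splitSum_add, splitSum_nu_nuList hg h2, splitSum_nuList_mul_nuList hg h2, add_zero]

theorem prod_append_swap (h : List α) (a b : α) (t : List α) :
    ((h ++ a :: b :: t).map g).prod = sg (d a * d b) • ((h ++ b :: a :: t).map g).prod := by
  induction h with
  | nil =>
    simp only [List.nil_append, List.map_cons, List.prod_cons]
    rw [← mul_assoc, (hg a).comm (hg b), smul_mul_assoc, mul_assoc]
  | cons c h ih =>
    simp only [List.cons_append, List.map_cons, List.prod_cons] at ih ⊢
    rw [ih, mul_smul_comm]

/-- The brackets `ν_r` are graded symmetric. -/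
theorem nuList_append_swap (h : List α) (a b : α) (t : List α) :
    nuList d g (h ++ a :: b :: t) = sg (d a * d b) • nuList d g (h ++ b :: a :: t) := by
  induction h with
  | nil =>
    simp only [List.nil_append, nuList_cons, List.map_cons, List.prod_cons]
    rw [nu_mul_right (hg a) (hg b), nu_mul_right (hg b) (hg a), nu_symm (hg a) (hg b)]
    simp only [smul_add, mul_add, mul_smul_comm, smul_mul_assoc, smul_smul]
    rw [← mul_assoc (g a), (hg a).comm (hg b)]
    simp only [smul_mul_assoc, mul_assoc, smul_smul]
    generalize d a = p, d b = q
    match_scalars <;>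
    by_cases hp : Even p <;> by_cases hq : Even q <;>
    simp [sg, Int.even_add, Int.even_sub, Int.even_mul, -Int.not_even_iff_odd,
      ← Int.not_even_iff_odd, hp, hq]
  | cons c h ih =>
    rw [List.cons_append, List.cons_append, nuList_cons, nuList_cons, ih, prod_append_swap hg,
      nu_zsmul_right, mul_smul_comm, smul_add, smul_comm]

end SchoutenSums


/-! ### Degrees of multivector fields and of contractions. -/

section MultivectorFields

variable {n : ℕ} {M : Type*} [TopologicalSpace M] [ChartedSpace (EuclideanSpace ℝ (Fin n)) M]
  [IsManifold (𝓡 n) ∞ M]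

theorem homog_of_mem_pow {k : ℕ} {x : Multivec n M}
    (hx : x ∈ LinearMap.range (ExteriorAlgebra.ι (SmoothFn n M) (M := VecField n M)) ^ k) :
    Homog k x := by
  induction hx using Submodule.pow_induction_on_left' with
  | algebraMap a => exact .algebraMap a
  | add x y i _ _ ihx ihy => exact ihx.add ihy
  | mem_mul z hz i x hx ih =>
    obtain ⟨Z, rfl⟩ := hz
    exact ih.ι_mul Z

/-- The point is negative degrees, where induction shows that only 0 is homogeneous: the step from
degree -1 to 0 multiplies 0 by a vector field. -/
theorem mem_mvDeg_iff {k : ℤ} {x : Multivec n M} : x ∈ mvDeg n M k ↔ Homog k x := by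
  constructor
  · intro hx
    match k, hx with
    | Int.negSucc _, hx =>
      have hx : x = 0 := hx
      rw [hx]; exact .zero _
    | Int.ofNat k, hx => exact homog_of_mem_pow hx
  · intro hx
    induction hx with
    | algebraMap a =>
      change _ ∈ LinearMap.range (ExteriorAlgebra.ι (SmoothFn n M) (M := VecField n M)) ^ 0
      rw [pow_zero]
      exact Submodule.algebraMap_mem a
    | zero p => exact zero_mem _
    | add _ _ h1 h2 => exact add_mem h1 h2
    | @ι_mul X p x _ h =>
      match p, h with
      | Int.negSucc _, h =>
        have h : x = 0 := h
        rw [h, mul_zero]; exact zero_mem _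
      | Int.ofNat k, h =>
        change _ ∈ LinearMap.range (ExteriorAlgebra.ι (SmoothFn n M) (M := VecField n M)) ^ (k + 1)
        rw [pow_succ']
        exact Submodule.mul_mem_mul ⟨X, rfl⟩ h

theorem lie_algebraMap_real (c : ℝ) (X : VecField n M) :
    ⁅X, algebraMap ℝ (SmoothFn n M) c⁆ = 0 := by
  rw [Algebra.algebraMap_eq_smul_one, lie_smul, lie_one, smul_zero]

theorem nu_real_smul_left (c : ℝ) (x y : Multivec n M) : nu (c • x) y = c • nu x y := by
  rw [← algebraMap_smul (SmoothFn n M) c x, ← algebraMap_smul (SmoothFn n M) c (nu x y)]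
  exact nu_smul_left_of_const (lie_algebraMap_real c) x y

theorem nu_real_smul_right (c : ℝ) (x y : Multivec n M) : nu x (c • y) = c • nu x y := by
  rw [← algebraMap_smul (SmoothFn n M) c y, ← algebraMap_smul (SmoothFn n M) c (nu x y)]
  exact nu_smul_right_of_const (lie_algebraMap_real c) x y

theorem multivec_eq_zero_of_add_self (x : Multivec n M) (h : x + x = 0) : x = 0 := by
  rw [← two_smul ℝ] at h
  exact (smul_eq_zero.1 h).resolve_left two_ne_zero

theorem nu_one_right {p : ℤ} {x : Multivec n M} (hx : Homog p x) : nu x 1 = 0 := by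
  have h := nu_fn_right hx (1 : SmoothFn n M)
  rwa [map_one, fnBracket_one] at h

theorem iSupIndep_mvDeg : iSupIndep (mvDeg n M) := by
  intro k
  match k with
  | Int.negSucc _ => exact disjoint_bot_left
  | Int.ofNat k =>
    -- The projection to degree `k` fixes that component and kills all others.
    let π : Multivec n M →ₗ[ℝ] Multivec n M := (GradedAlgebra.proj
      (fun i : ℕ ↦ ⋀[SmoothFn n M]^i (VecField n M)) k).restrictScalars ℝ
    rw [Submodule.disjoint_def]
    intro x hx hx'
    have h1 : π x = x := DirectSum.decompose_of_mem_same
      (fun i : ℕ ↦ ⋀[SmoothFn n M]^i (VecField n M)) hx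
    have h2 : (⨆ j, ⨆ (_ : j ≠ Int.ofNat k), mvDeg n M j) ≤ LinearMap.ker π := by
      refine iSup₂_le fun j hj y hy ↦ ?_
      match j, hj, hy with
      | Int.negSucc _, _, hy =>
        have hy : y = 0 := hy
        rw [hy]; exact zero_mem _
      | Int.ofNat j, hj, hy =>
        exact DirectSum.decompose_of_mem_ne (fun i : ℕ ↦ ⋀[SmoothFn n M]^i (VecField n M)) hy
          fun h ↦ hj (congrArg Int.ofNat h)
    rw [← h1]
    exact h2 hx'

theorem contractVec_mem_formDeg {j : ℤ} (X : VecField n M) {α : Forms n M}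
    (hα : α ∈ formDeg n M j) : contractVec X α ∈ formDeg n M (j - 1) := by
  intro i hi
  have h : α (i + 1) = 0 := hα (i + 1) (by push_cast; omega)
  change SmoothForm.contract X (α (i + 1)) = 0
  rw [h]
  rfl

theorem extDer_mem_formDeg {j : ℤ} {α : Forms n M} (hα : α ∈ formDeg n M j) :
    extDer α ∈ formDeg n M (j + 1) := by
  intro i hi
  cases i with
  | zero => rfl
  | succ i =>
    have h : α i = 0 := hα i (by push_cast at hi; omega)
    change SmoothForm.d (α i) = 0
    rw [h, map_zero]

theorem fn_smul_mem_formDeg {j : ℤ} (a : SmoothFn n M) {α : Forms n M}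
    (hα : α ∈ formDeg n M j) : a • α ∈ formDeg n M j := by
  intro i hi
  change a • α i = 0
  rw [hα i hi, smul_zero]

theorem contraction_mem_formDeg {p j : ℤ} {x : Multivec n M} (hx : Homog p x) {α : Forms n M}
    (hα : α ∈ formDeg n M j) : contraction x α ∈ formDeg n M (j - p) := by
  induction hx with
  | algebraMap a => rw [contraction_algebraMap, sub_zero]; exact fn_smul_mem_formDeg a hα
  | zero p => rw [map_zero]; exact zero_mem _
  | add _ _ h1 h2 => rw [contraction_add]; exact add_mem h1 h2
  | ι_mul X _ h =>
    rw [contraction_ι_mul, ← sub_sub]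
    exact contractVec_mem_formDeg X h

end MultivectorFields

/-! ### The L∞-structure on multivector fields. -/

section HigherBrackets

variable {n : ℕ} {M : Type*} [TopologicalSpace M] [ChartedSpace (EuclideanSpace ℝ (Fin n)) M]
  [IsManifold (𝓡 n) ∞ M]

variable (n M) in
/-- The multilinear map `(x₁, …, x_r) ↦ ν(x₁, x₂) ∧ x₃ ∧ ⋯ ∧ x_r`. -/
noncomputable def nuTerm (r : ℕ) :
    MultilinearMap ℝ (fun _ : Fin (r + 2) ↦ Multivec n M) (Multivec n M) :=
  have hu : ∀ [DecidableEq (Fin (r + 2))] (z : Fin (r + 2) → Multivec n M) (k : Fin r)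
      (v : Multivec n M), (List.ofFn fun i : Fin r ↦
        Function.update z k.succ.succ v i.succ.succ).prod =
      MultilinearMap.mkPiAlgebraFin ℝ r (Multivec n M)
        (Function.update (fun i : Fin r ↦ z i.succ.succ) k v) := fun z k v ↦ by
    rw [MultilinearMap.mkPiAlgebraFin_apply]
    congr 2
    funext i
    by_cases h : i = k
    · subst h; simp
    · rw [Function.update_of_ne h, Function.update_of_ne]
      simpa using h
  have h01 : (0 : Fin (r + 2)) ≠ 1 := by simp [Fin.ext_iff]
  { toFun := fun z ↦ nu (z 0) (z 1) * (List.ofFn fun i : Fin r ↦ z i.succ.succ).prod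
    map_update_add' := fun z j v w ↦ by
      refine Fin.cases ?_ (fun j ↦ ?_) j
      · simp only [Function.update_self, Function.update_of_ne (Fin.succ_ne_zero _),
          Function.update_of_ne h01.symm, nu_add_left, add_mul]
      · refine Fin.cases ?_ (fun k ↦ ?_) j
        · have h : ∀ i : Fin r, i.succ.succ ≠ 1 := fun i ↦ by simp [Fin.ext_iff]
          simp only [Function.update_self, Fin.succ_zero_eq_one, Function.update_of_ne (h _),
            Function.update_of_ne h01, nu_add_right, add_mul]
        · have h0 : (0 : Fin (r + 2)) ≠ k.succ.succ := (Fin.succ_ne_zero _).symm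
          have h1 : (1 : Fin (r + 2)) ≠ k.succ.succ := by simp [Fin.ext_iff]
          rw [hu, hu, hu, MultilinearMap.map_update_add, mul_add, Function.update_of_ne h0,
            Function.update_of_ne h1, Function.update_of_ne h0,
            Function.update_of_ne h1, Function.update_of_ne h0,
            Function.update_of_ne h1]
    map_update_smul' := fun z j c v ↦ by
      refine Fin.cases ?_ (fun j ↦ ?_) j
      · simp only [Function.update_self, Function.update_of_ne (Fin.succ_ne_zero _),
          Function.update_of_ne h01.symm, nu_real_smul_left, smul_mul_assoc]
      · refine Fin.cases ?_ (fun k ↦ ?_) j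
        · have h : ∀ i : Fin r, i.succ.succ ≠ 1 := fun i ↦ by simp [Fin.ext_iff]
          simp only [Function.update_self, Fin.succ_zero_eq_one, Function.update_of_ne (h _),
            Function.update_of_ne h01, nu_real_smul_right, smul_mul_assoc]
        · have h0 : (0 : Fin (r + 2)) ≠ k.succ.succ := (Fin.succ_ne_zero _).symm
          have h1 : (1 : Fin (r + 2)) ≠ k.succ.succ := by simp [Fin.ext_iff]
          rw [hu, hu, MultilinearMap.map_update_smul, mul_smul_comm, Function.update_of_ne h0,
            Function.update_of_ne h1, Function.update_of_ne h0,
            Function.update_of_ne h1] }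

/-- The brackets `ν_r` as multilinear maps. -/
noncomputable def nuMultilinear : (r : ℕ) → (Fin r → ℤ) →
    MultilinearMap ℝ (fun _ : Fin r ↦ Multivec n M) (Multivec n M)
  | 0, _ => 0
  | 1, _ => 0
  | r + 2, p => ∑ σ : Equiv.Perm (Fin (r + 2)) with IsUnshuffle 2 σ,
      koszulSign p σ • (nuTerm n M r).domDomCongr σ

theorem nuMultilinear_apply : ∀ (r : ℕ) (p : Fin r → ℤ) (x : Fin r → Multivec n M),
    nuMultilinear r p x = nuBracket r p x
  | 0, _, _ => rfl
  | 1, _, _ => rfl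
  | r + 2, p, x => by
    rw [nuMultilinear, sum_apply]
    rfl

variable (n M) in
/-- The degree of a homogeneous multivector field. -/
abbrev mvFst (a : Σ k, mvDeg n M k) : ℤ := a.1

variable (n M) in
/-- A homogeneous multivector field as an element of the exterior algebra. -/
abbrev mvSnd (a : Σ k, mvDeg n M k) : Multivec n M := a.2

theorem homog_mvSnd (a : Σ k, mvDeg n M k) : Homog (mvFst n M a) (mvSnd n M a) :=
  mem_mvDeg_iff.1 a.2.2

/-- For a single argument the recursion gives ν(x, 1) = 0, in accordance with ν₁ = 0. -/
theorem nuBracket_eq_nuList : ∀ {r : ℕ} (z : Fin r → Σ k, mvDeg n M k),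
    nuBracket r (fun i ↦ (z i).1) (fun i ↦ (z i).2) =
      nuList (mvFst n M) (mvSnd n M) (List.ofFn z)
  | 0, _ => rfl
  | 1, z => by
    rw [List.ofFn_succ, List.ofFn_zero, nuList_cons]
    have h1 : nu (mvSnd n M (z 0)) ([].map (mvSnd n M)).prod = 0 := nu_one_right (homog_mvSnd _)
    have h2 : nuList (mvFst n M) (mvSnd n M) [] = 0 := rfl
    rw [h1, h2, mul_zero, smul_zero, add_zero]
    rfl
  | r + 2, z =>
    sum_isUnshuffle_two (mvFst n M) (mvSnd n M) (fun a b ↦ nu (mvSnd n M a) (mvSnd n M b)) _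
      (fun a ↦ nu_one_right (homog_mvSnd a))
      (fun a b s ↦ nu_mul_right (homog_mvSnd a) (homog_mvSnd b) s)
      (fun a b e ↦ ((homog_mvSnd a).nu (homog_mvSnd b)).comm (homog_mvSnd e)) z

theorem sum_map_ofFn {r : ℕ} (z : Fin r → Σ k, mvDeg n M k) :
    ((List.ofFn z).map (mvFst n M)).sum = ∑ i, (z i).1 := by
  rw [List.map_ofFn, List.sum_ofFn]
  rfl

theorem nuBracket_mem_mvDeg {r : ℕ} (p : Fin r → ℤ) (x : Fin r → Multivec n M)
    (hx : ∀ i, x i ∈ mvDeg n M (p i)) : nuBracket r p x ∈ mvDeg n M (∑ i, p i - 1) := by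
  rw [mem_mvDeg_iff]
  have h := homog_nuList homog_mvSnd (List.ofFn fun i ↦ (⟨p i, x i, hx i⟩ : Σ k, mvDeg n M k))
  rwa [sum_map_ofFn, ← nuBracket_eq_nuList] at h

theorem nuBracket_symm {r : ℕ} (p : Fin r → ℤ) (x : Fin r → Multivec n M)
    (hx : ∀ i, x i ∈ mvDeg n M (p i)) (σ : Equiv.Perm (Fin r)) :
    nuBracket r p x = koszulSign p σ • nuBracket r (fun i ↦ p (σ i)) (fun i ↦ x (σ i)) := by
  let z : Fin r → Σ k, mvDeg n M k := fun i ↦ ⟨p i, x i, hx i⟩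
  have h := eq_koszulSign_smul_of_swap (mvFst n M) r (nuList (mvFst n M) (mvSnd n M))
    (nuList_append_swap homog_mvSnd) z σ
  rwa [← nuBracket_eq_nuList, ← nuBracket_eq_nuList] at h

theorem ofFn_headPart {α : Type*} {r : ℕ} (i : Fin r) (f : Fin r → α) :
    List.ofFn (headPart i f) = (List.ofFn f).take (i + 1) := by
  refine List.ext_getElem (by rw [List.length_ofFn, List.length_take, List.length_ofFn]; omega)
    fun j h1 h2 ↦ ?_
  rw [List.getElem_ofFn, List.getElem_take, List.getElem_ofFn]
  rfl

theorem ofFn_tailPart {α : Type*} {r : ℕ} (i : Fin r) (f : Fin r → α) :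
    List.ofFn (tailPart i f) = (List.ofFn f).drop (i + 1) := by
  refine List.ext_getElem (by simp) fun j h1 h2 ↦ ?_
  simp [tailPart, Nat.add_comm]

/-- The recursion with ν_i(h) as first letter turns each term into the summand `G` of
`splitSum_nuList_cons`; summing over all block lengths gives the full sum over splittings. -/
theorem nuBracket_jacobi {r : ℕ} (p : Fin r → ℤ) (x : Fin r → Multivec n M)
    (hx : ∀ i, x i ∈ mvDeg n M (p i)) :
    ∑ i : Fin r, ∑ σ : Equiv.Perm (Fin r) with IsUnshuffle (i + 1) σ,
      koszulSign p σ • nuBracket (r - (i + 1) + 1)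
        (Fin.cons (∑ a, headPart i (fun b ↦ p (σ b)) a - 1) (tailPart i fun b ↦ p (σ b)))
        (Fin.cons (nuBracket (i + 1) (headPart i fun b ↦ p (σ b)) (headPart i fun b ↦ x (σ b)))
          (tailPart i fun b ↦ x (σ b))) = 0 := by
  let z : Fin r → Σ k, mvDeg n M k := fun i ↦ ⟨p i, x i, hx i⟩
  let N := nuList (mvFst n M) (mvSnd n M)
  let G : List (Σ k, mvDeg n M k) → List (Σ k, mvDeg n M k) → Multivec n M := fun h t ↦
    nu (N h) (t.map (mvSnd n M)).prod + sg ((h.map (mvFst n M)).sum - 1) • (N h * N t)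
  have hterm : ∀ (i : Fin r) (σ : Equiv.Perm (Fin r)), nuBracket (r - (i + 1) + 1)
        (Fin.cons (∑ a, headPart i (fun b ↦ p (σ b)) a - 1) (tailPart i fun b ↦ p (σ b)))
        (Fin.cons (nuBracket (i + 1) (headPart i fun b ↦ p (σ b)) (headPart i fun b ↦ x (σ b)))
          (tailPart i fun b ↦ x (σ b))) =
      G ((List.ofFn fun a ↦ z (σ a)).take (i + 1)) ((List.ofFn fun a ↦ z (σ a)).drop (i + 1)) := by
    intro i σ
    let y : Fin r → Σ k, mvDeg n M k := fun a ↦ z (σ a)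
    let e : Σ k, mvDeg n M k := ⟨∑ a, headPart i (fun b ↦ p (σ b)) a - 1,
      nuBracket (i + 1) (headPart i fun b ↦ p (σ b)) (headPart i fun b ↦ x (σ b)),
      nuBracket_mem_mvDeg _ _ fun a ↦ hx _⟩
    have h1 := nuBracket_eq_nuList (headPart i y)
    have h2 := nuBracket_eq_nuList (Fin.cons e (tailPart i y) : Fin (r - (i + 1) + 1) → _)
    have h3 := sum_map_ofFn (headPart i y)
    rw [ofFn_headPart] at h1 h3
    rw [List.ofFn_succ] at h2
    simp only [Fin.cons_zero, Fin.cons_succ] at h2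
    rw [ofFn_tailPart, nuList_cons] at h2
    have e1 : mvSnd n M e = N ((List.ofFn y).take (i + 1)) := h1
    have e2 : mvFst n M e = (((List.ofFn y).take (i + 1)).map (mvFst n M)).sum - 1 :=
      congrArg (· - 1) h3.symm
    rw [e1, e2] at h2
    refine Eq.trans ?_ h2
    congr 1
    · funext a
      refine Fin.cases rfl (fun a ↦ rfl) a
    · funext a
      refine Fin.cases rfl (fun a ↦ rfl) a
  have hsum : ∀ i : Fin r, (∑ σ : Equiv.Perm (Fin r) with IsUnshuffle (i + 1) σ,
      koszulSign p σ • nuBracket (r - (i + 1) + 1)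
        (Fin.cons (∑ a, headPart i (fun b ↦ p (σ b)) a - 1) (tailPart i fun b ↦ p (σ b)))
        (Fin.cons (nuBracket (i + 1) (headPart i fun b ↦ p (σ b)) (headPart i fun b ↦ x (σ b)))
          (tailPart i fun b ↦ x (σ b)))) =
      unshuffleSum (mvFst n M) (i + 1) (List.ofFn z) G := by
    intro i
    rw [← sum_isUnshuffle (mvFst n M) r (i + 1) i.2 z G]
    exact Finset.sum_congr rfl fun σ _ ↦ congrArg _ (hterm i σ)
  rw [Finset.sum_congr rfl fun i _ ↦ hsum i,
    Fin.sum_univ_eq_sum_range (fun i ↦ unshuffleSum (mvFst n M) (i + 1) (List.ofFn z) G) r]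
  have h := sum_unshuffleSum (mvFst n M) (List.ofFn z) G
  rw [splitSum_nuList_cons homog_mvSnd multivec_eq_zero_of_add_self, Finset.sum_range_succ',
    List.length_ofFn] at h
  -- The identity starts with i = 1, the sum over splittings with an empty first block; that extra
  -- term vanishes, as the bracket of no arguments is 0.
  have h0 : unshuffleSum (mvFst n M) 0 (List.ofFn z) G = 0 := by
    have hN : N [] = 0 := rfl
    rw [unshuffleSum]
    change nu (N []) _ + sg _ • (N [] * _) = 0
    rw [hN, nu_zero_left, zero_mul, smul_zero, add_zero]
  rwa [h0, add_zero] at h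

/-- A graded subspace of the multivector fields that is concentrated in positive degrees and closed
under the brackets `ν_r` is an `L∞`-algebra. -/
theorem isLInfinity_nuBracket {V : ℤ → Submodule ℝ (Multivec n M)} (hV : ∀ k, V k ≤ mvDeg n M k)
    (hpos : ∀ k ≤ 0, V k = ⊥) (hc : IsClosedUnder V nuBracket) : IsLInfinity V nuBracket where
  independent := iSupIndep_mvDeg.mono hV
  positive := hpos
  degree := hc
  map_add r p x i y _ _ _ := by
    rw [← nuMultilinear_apply, MultilinearMap.map_update_add, Function.update_eq_self,
      nuMultilinear_apply, nuMultilinear_apply]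
  map_smul r p x i c _ _ := by
    rw [← nuMultilinear_apply, MultilinearMap.map_update_smul, Function.update_eq_self,
      nuMultilinear_apply]
  symmetric r p x σ _ hx := nuBracket_symm p x (fun i ↦ hV _ (hx i)) σ
  jacobi r p x _ hx := nuBracket_jacobi p x fun i ↦ hV _ (hx i)

end HigherBrackets


/-! ### Truncation of complexes and cochain maps. -/

section Truncation

variable {U U' : Type*} [AddCommGroup U] [Module ℝ U] [AddCommGroup U'] [Module ℝ U']
  {C : ℤ → Submodule ℝ U} {d : ℤ → U →ₗ[ℝ] U} {C' : ℤ → Submodule ℝ U'} {d' : ℤ → U' →ₗ[ℝ] U'}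
  {φ : ℤ → U →ₗ[ℝ] U'}

theorem truncSpace_le (m : ℕ) (C : ℤ → Submodule ℝ U) (k : ℤ) : truncSpace m C k ≤ C k := by
  unfold truncSpace
  split_ifs
  · exact le_rfl
  · exact bot_le

theorem truncDiff_of_mem {m : ℕ} {k : ℤ} (h : 0 ≤ k ∧ k + 1 ≤ m) : truncDiff m d k = d k :=
  if_pos h

theorem truncDiff_of_not_mem {m : ℕ} {k : ℤ} (h : ¬ (0 ≤ k ∧ k + 1 ≤ m)) : truncDiff m d k = 0 :=
  if_neg h

/-- The truncated differential leaves degree m by 0, so a composite of two differentials is either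
the original one or has a zero factor. -/
theorem IsCochainComplex.trunc (m : ℕ) (h : IsCochainComplex C d) :
    IsCochainComplex (truncSpace m C) (truncDiff m d) := by
  intro k x hx
  obtain ⟨h1, h2⟩ := h k x (truncSpace_le m C k hx)
  by_cases hk : 0 ≤ k ∧ k + 1 ≤ m
  · rw [truncDiff_of_mem hk]
    refine ⟨?_, ?_⟩
    · rw [truncSpace, if_pos ⟨by omega, by omega⟩]
      exact h1
    · by_cases hk' : 0 ≤ k + 1 ∧ k + 1 + 1 ≤ m
      · rwa [truncDiff_of_mem hk']
      · rw [truncDiff_of_not_mem hk']; rfl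
  · rw [truncDiff_of_not_mem hk]
    exact ⟨zero_mem _, map_zero _⟩

theorem IsCochainMap.trunc (m : ℕ) (h : IsCochainMap C d C' d' φ) :
    IsCochainMap (truncSpace m C) (truncDiff m d) (truncSpace m C') (truncDiff m d') φ := by
  intro k x hx
  obtain ⟨h1, h2⟩ := h k x (truncSpace_le m C k hx)
  refine ⟨?_, ?_⟩
  · unfold truncSpace at hx ⊢
    split_ifs at hx ⊢ with hk
    · exact h1
    · rw [(Submodule.mem_bot ℝ).1 hx, map_zero]; exact zero_mem _
  · by_cases hk : 0 ≤ k ∧ k + 1 ≤ m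
    · rwa [truncDiff_of_mem hk, truncDiff_of_mem hk]
    · rw [truncDiff_of_not_mem hk, truncDiff_of_not_mem hk]
      exact map_zero _

end Truncation

/-! ### Linear maps on the graded symmetric algebra. -/

section GradedSymmetricSpan

variable {U : Type*} [AddCommGroup U] [Module ℝ U] {V : ℤ → Submodule ℝ U}

theorem GSym.mem_span_prodList (s : GSym V) :
    s ∈ Submodule.span ℝ (Set.range (GSym.prodList V)) := by
  induction s using GSym.induction with
  | one => exact Submodule.subset_span ⟨[], rfl⟩
  | add s t hs ht => exact add_mem hs ht
  | smul a s hs => exact Submodule.smul_mem _ a hs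
  | inc_mul k v s hs =>
    induction hs using Submodule.span_induction with
    | mem s hs =>
      obtain ⟨l, rfl⟩ := hs
      exact Submodule.subset_span ⟨⟨k, v⟩ :: l, GSym.prodList_cons _ l⟩
    | zero => rw [mul_zero]; exact zero_mem _
    | add s t _ _ hs ht => rw [mul_add]; exact add_mem hs ht
    | smul a s _ hs => rw [mul_smul_comm]; exact Submodule.smul_mem _ a hs

/-- Yields the uniqueness of ν̂₂ and reduces the cochain map identity to products. -/
theorem GSym.linearMap_ext {W : Type*} [AddCommGroup W] [Module ℝ W] {f g : GSym V →ₗ[ℝ] W}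
    (h : ∀ l, f (GSym.prodList V l) = g (GSym.prodList V l)) : f = g := by
  refine LinearMap.ext fun s ↦ ?_
  induction GSym.mem_span_prodList s using Submodule.span_induction with
  | mem s hs =>
    obtain ⟨l, rfl⟩ := hs
    exact h l
  | zero => rw [map_zero, map_zero]
  | add s t _ _ hs ht => rw [map_add, map_add, hs, ht]
  | smul a s _ hs => rw [map_smul, map_smul, hs]

end GradedSymmetricSpan

/-! ### Multisymplectic and Hamiltonian multivector fields. -/

section Multisymplectic

variable {n : ℕ} {M : Type*} [TopologicalSpace M] [ChartedSpace (EuclideanSpace ℝ (Fin n)) M]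
  [IsManifold (𝓡 n) ∞ M] {m : ℕ} {w : Forms n M}

namespace MVSub

variable (𝒱 : MVSub n M)

/-- The underlying multivector field of a homogeneous element. -/
abbrev elt (a : Σ k, 𝒱.carrier k) : Multivec n M := a.2

/-- The degree of a homogeneous element. -/
abbrev eltDeg (a : Σ k, 𝒱.carrier k) : ℤ := a.1

theorem homog_coe {k : ℤ} (v : 𝒱.carrier k) : Homog k (v : Multivec n M) :=
  mem_mvDeg_iff.1 (𝒱.le_mvDeg k v.2)

theorem homog_elt (a : Σ k, 𝒱.carrier k) : Homog (𝒱.eltDeg a) (𝒱.elt a) := 𝒱.homog_coe a.2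

variable {𝒱}

/-- The Schouten bracket of a subspace that is closed under it. -/
noncomputable def nuₗ (h : 𝒱.IsNuClosed) (p q : ℤ) :
    𝒱.carrier p →ₗ[ℝ] 𝒱.carrier q →ₗ[ℝ] 𝒱.carrier (p + q - 1) :=
  LinearMap.mk₂ ℝ (fun x y ↦ ⟨nu (x : Multivec n M) y, h p q x y x.2 y.2⟩)
    (fun x x' y ↦ Subtype.ext (nu_add_left (x : Multivec n M) x' y))
    (fun c x y ↦ Subtype.ext (nu_real_smul_left c (x : Multivec n M) y))
    (fun x y y' ↦ Subtype.ext (nu_add_right (x : Multivec n M) y y'))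
    (fun c x y ↦ Subtype.ext (nu_real_smul_right c (x : Multivec n M) y))

theorem coe_nuₗ (h : 𝒱.IsNuClosed) {p q : ℤ} (x : 𝒱.carrier p) (y : 𝒱.carrier q) :
    (nuₗ h p q x y : Multivec n M) = nu (x : Multivec n M) y := rfl

theorem isShiftedLie_nuₗ (h : 𝒱.IsNuClosed) : IsShiftedLie (nuₗ h) where
  symm _ _ x y := nu_symm (𝒱.homog_coe x) (𝒱.homog_coe y)
  jacobi _ _ _ x y z := jacobiator_eq_zero (𝒱.homog_coe x) (𝒱.homog_coe y) (𝒱.homog_coe z)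

theorem wedge_zsmul (c : ℤ) (s : GSym 𝒱.carrier) : 𝒱.wedge (c • s) = c • 𝒱.wedge s :=
  map_zsmul 𝒱.wedge.toLinearMap c s

theorem wedge_prodList (l : List (Σ k, 𝒱.carrier k)) :
    𝒱.wedge (GSym.prodList 𝒱.carrier l) = (l.map 𝒱.elt).prod := by
  induction l with
  | nil => exact map_one _
  | cons a l ih => rw [GSym.prodList_cons, map_mul, wedge_inc, ih, List.map_cons, List.prod_cons]

/-- [x, -] and ν(x, -) obey the same Leibniz rule, agree on generators and kill 1. -/
theorem wedge_ad (h : 𝒱.IsNuClosed) {p : ℤ} (x : 𝒱.carrier p) (s : GSym 𝒱.carrier) :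
    𝒱.wedge (GSym.ad (nuₗ h) x s) = nu (x : Multivec n M) (𝒱.wedge s) := by
  induction s using GSym.induction with
  | one => rw [GSym.ad_one, map_zero, map_one, nu_one_right (𝒱.homog_coe x)]
  | add s t hs ht => rw [map_add, map_add, map_add, nu_add_right, hs, ht]
  | smul a s hs => rw [map_smul, map_smul, map_smul, nu_real_smul_right, hs]
  | inc_mul k v s hs =>
    have h1 : 𝒱.wedge (GSym.inc 𝒱.carrier k v * s) = (v : Multivec n M) * 𝒱.wedge s := by
      rw [map_mul, wedge_inc]
    have h2 : 𝒱.wedge (GSym.inc 𝒱.carrier _ (nuₗ h p k x v) * s) =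
        nu (x : Multivec n M) v * 𝒱.wedge s := by
      rw [map_mul, wedge_inc, coe_nuₗ]
    have h3 : 𝒱.wedge (GSym.inc 𝒱.carrier k v * GSym.ad (nuₗ h) x s) =
        (v : Multivec n M) * nu (x : Multivec n M) (𝒱.wedge s) := by
      rw [map_mul, wedge_inc, hs]
    refine (congrArg 𝒱.wedge (GSym.ad_inc_mul (nuₗ h) x v s)).trans ?_
    refine (map_add 𝒱.wedge _ _).trans ?_
    refine (congrArg₂ (· + ·) h2 ((wedge_zsmul _ _).trans (congrArg _ h3))).trans ?_
    rw [h1]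
    exact (nu_mul_right (𝒱.homog_coe x) (𝒱.homog_coe v) _).symm

/-- The codifferential and ν_r satisfy the same recursion, and multiplication respects its two
terms. -/
theorem wedge_codiff_prodList (h : 𝒱.IsNuClosed) (l : List (Σ k, 𝒱.carrier k)) :
    𝒱.wedge (GSym.codiff (isShiftedLie_nuₗ h) (GSym.prodList 𝒱.carrier l)) =
      nuList 𝒱.eltDeg 𝒱.elt l := by
  induction l with
  | nil =>
    refine (congrArg _ (GSym.codiff_one (isShiftedLie_nuₗ h))).trans (map_zero _)
  | cons a l ih =>
    rw [GSym.prodList_cons, GSym.codiff_inc_mul, map_add, wedge_zsmul, map_mul, wedge_inc, ih,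
      wedge_ad, wedge_prodList, nuList_cons]

theorem isNuHat_codiff (h : 𝒱.IsNuClosed) : 𝒱.IsNuHat h (GSym.codiff (isShiftedLie_nuₗ h))
  | 0, _, _ => GSym.codiff_one (isShiftedLie_nuₗ h)
  | 1, p, x => by
    have h1 : GSym.prod 𝒱.carrier p x = GSym.inc 𝒱.carrier _ (x 0) * 1 := by
      rw [GSym.prod, List.ofFn_succ, List.ofFn_zero, List.prod_cons, List.prod_nil]
    rw [h1, GSym.codiff_inc_mul, GSym.ad_one, GSym.codiff_one, mul_zero, smul_zero, add_zero]
    rfl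
  | r + 2, p, x => by
    rw [GSym.prod_eq_prodList]
    exact (GSym.sum_isUnshuffle_codiff (isShiftedLie_nuₗ h) fun i ↦ ⟨p i, x i⟩).symm

theorem IsNuHat.unique {h : 𝒱.IsNuClosed} {D D' : GSym 𝒱.carrier →ₗ[ℝ] GSym 𝒱.carrier}
    (hD : 𝒱.IsNuHat h D) (hD' : 𝒱.IsNuHat h D') : D' = D := by
  refine GSym.linearMap_ext fun l ↦ ?_
  have := (hD' l.length (fun i ↦ (l.get i).1) fun i ↦ (l.get i).2).trans (hD _ _ _).symm
  rw [GSym.prod_eq_prodList] at this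
  have hl : (List.ofFn fun i ↦ (⟨(l.get i).1, (l.get i).2⟩ : Σ k, 𝒱.carrier k)) = l :=
    List.ofFn_get l
  rwa [hl] at this

theorem isCochainComplex_shiftedSym (m : ℕ) (h : 𝒱.IsNuClosed) :
    IsCochainComplex (𝒱.shiftedSym m) (fun _ ↦ GSym.codiff (isShiftedLie_nuₗ h)) := by
  refine fun k s hs ↦ ⟨?_, GSym.codiff_codiff _ s⟩
  have := GSym.codiff_mem_deg (isShiftedLie_nuₗ h) hs
  rwa [sub_sub] at this

end MVSub

theorem isCochainComplex_formDeg : IsCochainComplex (formDeg n M) (fun _ ↦ extDer) :=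
  fun _ α hα ↦ ⟨extDer_mem_formDeg hα, extDer_extDer α⟩

theorem lieOp_of_closed (hw : extDer w = 0) (p : ℤ) (x : Multivec n M) :
    lieOp p x w = extDer (contraction x w) := by
  rw [lieOp, hw, map_zero, smul_zero, sub_zero]

theorem mem_symMV_of_closed (hw : extDer w = 0) {k : ℤ} {x : Multivec n M} :
    x ∈ (symMV w).carrier k ↔ x ∈ mvDeg n M k ∧ extDer (contraction x w) = 0 := by
  rw [mem_symMV]
  refine and_congr_right fun hx ↦ ?_
  rw [lieDer_of_homog (mem_mvDeg_iff.1 hx), lieOp_of_closed hw]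

/-- For closed ω, L_x ω = d ι_x ω, and this is zero if ι_x ω is exact. -/
theorem hamMV_le_symMV (hw : extDer w = 0) (k : ℤ) :
    (hamMV m w).carrier k ≤ (symMV w).carrier k := by
  intro x hx
  obtain ⟨hx, α, -, hα⟩ := (mem_hamMV m w k x).1 hx
  exact (mem_symMV_of_closed hw).2 ⟨hx, by rw [hα, extDer_extDer]⟩

/-- The contraction of `w` with `ν_r(x₁, …, x_r)` is the exterior derivative of its contraction with
`x₁ ∧ ⋯ ∧ x_r`. -/
theorem contraction_nuList (hw : extDer w = 0) {α : Type*} {d : α → ℤ} {g : α → Multivec n M}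
    (hg : ∀ a, Homog (d a) (g a)) (hsym : ∀ a, extDer (contraction (g a) w) = 0) (l : List α) :
    contraction (nuList d g l) w = extDer (contraction (l.map g).prod w) := by
  induction l with
  | nil =>
    have h1 : contraction (1 : Multivec n M) w = w := by rw [map_one]; rfl
    have h2 : nuList d g [] = 0 := rfl
    rw [h2, map_zero, List.map_nil, List.prod_nil, h1, hw]
    rfl
  | cons a l ih =>
    -- As L_{x₁} ω = 0, Cartan's formula gives d ι_{x₁} ι_P ω - (-1)^{|x₁|} ι_{x₁} d ι_P ω with P
    -- the product of the other arguments; by induction, the second term cancels against the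
    -- contraction with x₁ ∧ ν_{r-1}.
    rw [nuList_cons, contraction_add, contraction_zsmul, contraction_mul, ih,
      contraction_nu (hg a) (homog_prod hg l), lieOp_of_closed hw, hsym, map_zero, smul_zero,
      sub_zero, lieOp, List.map_cons, List.prod_cons, contraction_mul]
    abel

/-- Under these hypotheses Cartan's formula collapses to ι_{ν(x,y)} ω = d ι_x ι_y ω, so ι_x ι_y ω is
a potential; its degree is m + 1 - p - q. -/
theorem nu_mem_hamMV (hw : IsPreSymplectic m w) {p q : ℤ} {x y : Multivec n M}
    (hx : x ∈ (symMV w).carrier p) (hy : y ∈ (symMV w).carrier q) :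
    nu x y ∈ (hamMV m w).carrier (p + q - 1) := by
  obtain ⟨hx, hx'⟩ := (mem_symMV_of_closed hw.2).1 hx
  obtain ⟨hy, hy'⟩ := (mem_symMV_of_closed hw.2).1 hy
  rw [mem_mvDeg_iff] at hx hy
  refine (mem_hamMV m w _ _).2 ⟨mem_mvDeg_iff.2 (hx.nu hy), contraction x (contraction y w), ?_, ?_⟩
  · have := contraction_mem_formDeg hx (contraction_mem_formDeg hy hw.1)
    convert this using 2
    ring
  · rw [contraction_nu hx hy, lieOp_of_closed hw.2, hx', map_zero, smul_zero, sub_zero, lieOp, hy',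
      map_zero, smul_zero, sub_zero]

/-- The potential is the contraction of ω with x₁ ∧ ⋯ ∧ x_r. -/
theorem nuBracket_mem_hamMV (hw : IsPreSymplectic m w) {r : ℕ} (p : Fin r → ℤ)
    (x : Fin r → Multivec n M) (hx : ∀ i, x i ∈ (symMV w).carrier (p i)) :
    nuBracket r p x ∈ (hamMV m w).carrier (∑ i, p i - 1) := by
  let z : Fin r → Σ k, (symMV w).carrier k := fun i ↦ ⟨p i, x i, hx i⟩
  let y : Fin r → Σ k, mvDeg n M k := fun i ↦ ⟨p i, x i, (symMV w).le_mvDeg _ (hx i)⟩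
  have hxd : ∀ i, x i ∈ mvDeg n M (p i) := fun i ↦ (symMV w).le_mvDeg _ (hx i)
  -- The bracket does not see in which graded subspace its arguments are taken.
  have hN : ∀ l : List (Σ k, (symMV w).carrier k), nuList (symMV w).eltDeg (symMV w).elt l =
      nuList (mvFst n M) (mvSnd n M)
        (l.map fun a ↦ (⟨a.1, a.2, (symMV w).le_mvDeg _ a.2.2⟩ : Σ k, mvDeg n M k)) := by
    intro l
    induction l with
    | nil => rfl
    | cons a l ih =>
      rw [List.map_cons, nuList_cons, nuList_cons, ih, List.map_map]
      rfl
  have h1 : nuBracket r p x = nuList (symMV w).eltDeg (symMV w).elt (List.ofFn z) := by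
    rw [hN, List.map_ofFn]
    exact nuBracket_eq_nuList y
  refine (mem_hamMV m w _ _).2 ⟨nuBracket_mem_mvDeg p x hxd,
    contraction ((List.ofFn z).map (symMV w).elt).prod w, ?_, ?_⟩
  · have := contraction_mem_formDeg (homog_prod (symMV w).homog_elt (List.ofFn z)) hw.1
    rw [List.map_ofFn, List.sum_ofFn] at this
    convert this using 2
    change (m : ℤ) - (∑ i, p i - 1) = m + 1 - ∑ i, p i
    ring
  · rw [h1]
    exact contraction_nuList hw.2 (symMV w).homog_elt
      (fun a ↦ ((mem_symMV_of_closed hw.2).1 a.2.2).2) _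

namespace MVSub

variable {𝒱 : MVSub n M}

/-- Brackets of multisymplectic fields are Hamiltonian, so every graded space between the two is
closed; this treats both choices of 𝒱 at once. -/
theorem isNuClosed_of_le (hw : IsPreSymplectic m w) (h1 : ∀ k, 𝒱.carrier k ≤ (symMV w).carrier k)
    (h2 : ∀ k, (hamMV m w).carrier k ≤ 𝒱.carrier k) : 𝒱.IsNuClosed :=
  fun p q _ _ hx hy ↦ h2 _ (nu_mem_hamMV hw (h1 p hx) (h1 q hy))

theorem isClosedUnder_of_le (hw : IsPreSymplectic m w)
    (h1 : ∀ k, 𝒱.carrier k ≤ (symMV w).carrier k) (h2 : ∀ k, (hamMV m w).carrier k ≤ 𝒱.carrier k) :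
    IsClosedUnder 𝒱.carrier nuBracket :=
  fun _ p x _ hx ↦ h2 _ (nuBracket_mem_hamMV hw p x fun i ↦ h1 _ (hx i))

theorem pos_carrier_le (k : ℤ) : 𝒱.pos.carrier k ≤ 𝒱.carrier k := by
  change (if 1 ≤ k then 𝒱.carrier k else ⊥) ≤ _
  split_ifs
  · exact le_rfl
  · exact bot_le

theorem pos_carrier_of_pos {k : ℤ} (hk : 1 ≤ k) : 𝒱.pos.carrier k = 𝒱.carrier k := if_pos hk

theorem pos_carrier_of_nonpos {k : ℤ} (hk : k ≤ 0) : 𝒱.pos.carrier k = ⊥ := if_neg (by omega)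

theorem IsNuClosed.pos (h : 𝒱.IsNuClosed) : 𝒱.pos.IsNuClosed := by
  intro p q x y hx hy
  rcases le_or_gt p 0 with hp | hp
  · rw [pos_carrier_of_nonpos hp, Submodule.mem_bot] at hx
    rw [hx, nu_zero_left]
    exact zero_mem _
  rcases le_or_gt q 0 with hq | hq
  · rw [pos_carrier_of_nonpos hq, Submodule.mem_bot] at hy
    rw [hy, nu_zero_right]
    exact zero_mem _
  -- For p, q ≥ 1 the degree p + q - 1 is still positive.
  rw [pos_carrier_of_pos (by omega)]
  exact h p q x y (pos_carrier_le p hx) (pos_carrier_le q hy)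

/-- For r ≥ 2 arguments of positive degree the bracket has degree at least r - 1 ≥ 1, and ν₁ = 0. If
a prescribed degree is not positive, the argument is 0 and multilinearity applies. -/
theorem isClosedUnder_pos (h : IsClosedUnder 𝒱.carrier nuBracket) :
    IsClosedUnder 𝒱.pos.carrier nuBracket := by
  intro r p x hr hx
  by_cases hp : ∀ i, 1 ≤ p i
  · obtain ⟨r, rfl⟩ : ∃ r', r = r' + 1 := ⟨r - 1, by omega⟩
    cases r with
    | zero =>
      have : nuBracket (0 + 1) p x = 0 := rfl
      rw [this]
      exact zero_mem _
    | succ r =>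
      have h1 : ((r + 1 + 1 : ℕ) : ℤ) ≤ ∑ i, p i := by
        have := Finset.card_nsmul_le_sum Finset.univ p 1 fun i _ ↦ hp i
        simpa using this
      rw [pos_carrier_of_pos (by push_cast at h1; omega)]
      exact h _ p x hr fun i ↦ pos_carrier_le _ (hx i)
  · push Not at hp
    obtain ⟨i, hi⟩ := hp
    have h0 : x i = 0 := by
      have := hx i
      rwa [pos_carrier_of_nonpos (by omega), Submodule.mem_bot] at this
    rw [← nuMultilinear_apply, MultilinearMap.map_coord_zero _ i h0]
    exact zero_mem _

theorem isLInfinity_pos (h : IsClosedUnder 𝒱.carrier nuBracket) :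
    IsLInfinity 𝒱.pos.carrier nuBracket :=
  isLInfinity_nuBracket 𝒱.pos.le_mvDeg (fun _ ↦ pos_carrier_of_nonpos) (isClosedUnder_pos h)

theorem isLInfinitySubalgebra_pos (h : IsClosedUnder 𝒱.carrier nuBracket) :
    IsLInfinitySubalgebra 𝒱.pos.carrier (allMV n M).pos.carrier nuBracket where
  ambient := isLInfinity_pos fun _ p x _ hx ↦ nuBracket_mem_mvDeg p x hx
  le k := by
    rcases le_or_gt k 0 with hk | hk
    · rw [pos_carrier_of_nonpos hk]; exact bot_le
    · rw [pos_carrier_of_pos hk, pos_carrier_of_pos hk]; exact 𝒱.le_mvDeg k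
  closed := isClosedUnder_pos h
  isLInfinity := isLInfinity_pos h

/-- On products, both composites are computed by `contraction_nuList`, once multiplication has
carried ν̂₂ to ν_r. -/
theorem isCochainMap_pairing (hw : IsPreSymplectic m w)
    (h1 : ∀ k, 𝒱.carrier k ≤ (symMV w).carrier k) (h : 𝒱.IsNuClosed) :
    IsCochainMap (𝒱.shiftedSym m) (fun _ ↦ GSym.codiff (isShiftedLie_nuₗ h)) (formDeg n M)
      (fun _ ↦ extDer) (fun _ ↦ 𝒱.pairing w) := by
  have hD : (𝒱.pairing w).comp (GSym.codiff (isShiftedLie_nuₗ h)) =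
      extDer.comp (𝒱.pairing w) := by
    refine GSym.linearMap_ext fun l ↦ ?_
    change contraction (𝒱.wedge _) w = extDer (contraction (𝒱.wedge _) w)
    rw [wedge_codiff_prodList, wedge_prodList]
    exact contraction_nuList hw.2 𝒱.homog_elt
      (fun a ↦ ((mem_symMV_of_closed hw.2).1 (h1 _ a.2.2)).2) l
  refine fun k s hs ↦ ⟨?_, LinearMap.congr_fun hD s⟩
  refine GSym.deg_induction (P := fun s ↦ 𝒱.pairing w s ∈ formDeg n M k) ?_ (fun s t hs ht ↦ ?_)
    (fun a s hs ↦ ?_) (fun l hl ↦ ?_) hs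
  · rw [map_zero]; exact zero_mem _
  · rw [map_add]; exact add_mem hs ht
  · rw [map_smul]; exact Submodule.smul_mem _ a hs
  · change contraction (𝒱.wedge _) w ∈ _
    rw [wedge_prodList]
    have := contraction_mem_formDeg (homog_prod 𝒱.homog_elt l) hw.1
    convert this using 2
    change k = m + 1 - (l.map fun a ↦ a.1).sum
    rw [hl]
    ring

end MVSub

end Multisymplectic

end Multisymplectic

theorem proposition3p3 {n : ℕ} {M : Type*} [TopologicalSpace M]
    [ChartedSpace (EuclideanSpace ℝ (Fin n)) M] [IsManifold (𝓡 n) ∞ M] [T2Space M]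
    [SecondCountableTopology M] (m : ℕ) (w : Forms n M) (hw : IsPreSymplectic m w) :
    (∀ 𝒱 : MVSub n M, (𝒱 = symMV w ∨ 𝒱 = hamMV m w ∨ 𝒱 = (symMV w).pos ∨ 𝒱 = (hamMV m w).pos) →
      ∃ (h : 𝒱.IsNuClosed) (D : GSym 𝒱.carrier →ₗ[ℝ] GSym 𝒱.carrier),
        𝒱.IsNuHat h D ∧ (∀ D', 𝒱.IsNuHat h D' → D' = D) ∧
        IsCochainComplex (𝒱.shiftedSym m) (fun _ ↦ D) ∧
        IsCochainComplex (formDeg n M) (fun _ ↦ extDer) ∧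
        IsCochainMap (𝒱.shiftedSym m) (fun _ ↦ D) (formDeg n M) (fun _ ↦ extDer)
          (fun _ ↦ 𝒱.pairing w) ∧
        IsCochainComplex (truncSpace m (𝒱.shiftedSym m)) (truncDiff m fun _ ↦ D) ∧
        IsCochainComplex (truncSpace m (formDeg n M)) (truncDiff m fun _ ↦ extDer) ∧
        IsCochainMap (truncSpace m (𝒱.shiftedSym m)) (truncDiff m fun _ ↦ D)
          (truncSpace m (formDeg n M)) (truncDiff m fun _ ↦ extDer) (fun _ ↦ 𝒱.pairing w)) ∧
    (∀ 𝒱 : MVSub n M, (𝒱 = symMV w ∨ 𝒱 = hamMV m w) →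
      IsClosedUnder 𝒱.carrier nuBracket ∧
      IsLInfinitySubalgebra 𝒱.pos.carrier (allMV n M).pos.carrier nuBracket) := by
  have hle := hamMV_le_symMV (m := m) hw.2
  refine ⟨fun 𝒱 h𝒱 ↦ ?_, fun 𝒱 h𝒱 ↦ ?_⟩
  · have hs : (symMV w).IsNuClosed := MVSub.isNuClosed_of_le hw (fun _ ↦ le_rfl) hle
    have hh : (hamMV m w).IsNuClosed := MVSub.isNuClosed_of_le hw hle fun _ ↦ le_rfl
    -- All four cases enter only through these two properties: closed under ν, and made of
    -- multisymplectic fields.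
    obtain ⟨h, h1⟩ : 𝒱.IsNuClosed ∧ ∀ k, 𝒱.carrier k ≤ (symMV w).carrier k := by
      rcases h𝒱 with rfl | rfl | rfl | rfl
      · exact ⟨hs, fun _ ↦ le_rfl⟩
      · exact ⟨hh, hle⟩
      · exact ⟨hs.pos, MVSub.pos_carrier_le⟩
      · exact ⟨hh.pos, fun k ↦ (MVSub.pos_carrier_le k).trans (hle k)⟩
    have hC := MVSub.isCochainComplex_shiftedSym m h
    have hF := isCochainComplex_formDeg (n := n) (M := M)
    have hφ := MVSub.isCochainMap_pairing hw h1 h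
    exact ⟨h, _, MVSub.isNuHat_codiff h, fun _ ↦ (MVSub.isNuHat_codiff h).unique, hC, hF, hφ,
      hC.trunc m, hF.trunc m, hφ.trunc m⟩
  · have hc : IsClosedUnder 𝒱.carrier nuBracket := by
      rcases h𝒱 with rfl | rfl
      · exact MVSub.isClosedUnder_of_le hw (fun _ ↦ le_rfl) hle
      · exact MVSub.isClosedUnder_of_le hw hle fun _ ↦ le_rfl
    exact ⟨hc, MVSub.isLInfinitySubalgebra_pos hc⟩
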